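/- For $\alpha\in\mathbb{R}$ consider the second Painlevé equation $$y''(s)-s\,y(s)-2y(s)^3-\alpha=0,\qquad s\in\mathbb{R}.\tag{1}$$ A solution $y:\mathbb{R}\to\mathbb{R}$ of (1) on the whole line is called minimal if $E(y,\operatorname{supp}\phi)\le E(y+\phi,\operatorname{supp}\phi)$ for every $\phi\in C_c^\infty(\mathbb{R})$, where $$E(u,I)=\int_I\Big[\tfrac12|u'(s)|^2+\tfrac12 s\,u(s)^2+\tfrac12u(s)^4+\alpha u(s)\Big]\,ds .$$ A function is called bounded at $\infty$ if it is bounded on some half-line $[s_0,\infty)$. We write $f\sim g$ if $f=g(1+o(1))$ in the indicated limit, and $\mathrm{Ai}$ is the Airy function, $\mathrm{Ai}(s)=\frac1\pi\int_0^\infty\cos(t^3/3+st)\,dt=\frac1{2\pi}\int_{\operatorname{Im}\zeta=1}e^{i(\zeta^3/3+s\zeta)}\,d\zeta$. **Theorem 3** (a generalisation of the Hastings–McLeod result). (i) For every $\alpha\le 0$, equation (1) has a positive minimal solution $y$ which is strictly decreasing ($y'<0$ on $\mathbb{R}$) and such that: (a) if $\alpha=0$, then $y(s)\sim\mathrm{Ai}(s)$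 as $s\to+\infty$ and $y(s)\sim\sqrt{|s|/2}$ as $s\to-\infty$; moreover, $y$ is the only nonnegative minimal solution that is bounded at $\infty$; (b) if $\alpha<0$, then $y(s)\sim\frac{|\alpha|}{s}$ as $s\to+\infty$ and $y(s)\sim\sqrt{|s|/2}$ as $s\to-\infty$. (ii) If $\alpha<0$ and $y$ is a minimal solution of (1), bounded at $\infty$, that vanishes at some point $\bar s\in\mathbb{R}$, then $y(s)\sim\frac{|\alpha|}{s}$ as $s\to+\infty$ and $y(s)\sim-\sqrt{|s|/2}$ as $s\to-\infty$. -/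

import Mathlib

open Filter Asymptotics
open scoped ContDiff

namespace PainleveII

/-- `y` is a classical solution on the whole real line of
`y''(s) - s y(s) - 2 y(s)³ - α = 0`. -/
def IsSolution (α : ℝ) (y : ℝ → ℝ) : Prop :=
  Differentiable ℝ y ∧ ∀ s : ℝ, HasDerivAt (deriv y) (s * y s + 2 * y s ^ 3 + α) s

/-- The energy of `u` on `I`: the integral over `I` of
`|u'|² / 2 + s u² / 2 + u⁴ / 2 + α u`. -/
noncomputable def energy (α : ℝ) (u : ℝ → ℝ) (I : Set ℝ) : ℝ :=
  ∫ s in I, (1 / 2 * deriv u s ^ 2 + 1 / 2 * s * u s ^ 2 + 1 / 2 * u s ^ 4 + α * u s)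

/-- A solution is minimal if no smooth compactly supported perturbation `φ` lowers its energy
on the (closed) support of `φ`. -/
def IsMinimalSolution (α : ℝ) (y : ℝ → ℝ) : Prop :=
  IsSolution α y ∧
    ∀ φ : ℝ → ℝ, ContDiff ℝ ∞ φ → HasCompactSupport φ →
      energy α y (tsupport φ) ≤ energy α (fun s => y s + φ s) (tsupport φ)

/-- `y` is bounded in a neighbourhood of `+∞`. -/
def BoundedAtInfty (y : ℝ → ℝ) : Prop :=
  ∃ M s₀ : ℝ, ∀ s : ℝ, s₀ ≤ s → |y s| ≤ M

/-- The Airy function of the first kind,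
`Ai(s) = (1 / 2π) ∫_{Im ζ = 1} exp (i (ζ³ / 3 + s ζ)) dζ`,
an absolutely convergent integral (the line is parametrised by `ζ = t + i`); moving the line of
integration to the real axis gives the improper integral
`Ai(s) = (1 / π) ∫_0^∞ cos (t³ / 3 + s t) dt`. The value of the integral is real. -/
noncomputable def airyAi (s : ℝ) : ℝ :=
  (1 / (2 * Real.pi)) *
    (∫ t : ℝ, Complex.exp (Complex.I *
      (((t : ℂ) + Complex.I) ^ 3 / 3 + (s : ℂ) * ((t : ℂ) + Complex.I)))).re

end PainleveII

/-! ### Calculus lemmas and elementary properties of solutions. -/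

namespace PainleveII

open Set Topology

/-! Existence and minimality. Relative to a solution `y`, the energy excess of a perturbation `φ` is
the integral of `excessDensity`, the linear part being an exact derivative. If `y > 0` and `α ≤ 0`,
Picone's identity writes this density as an exact derivative plus nonnegative terms, so every
positive solution is minimal (`IsSolution.isMinimalSolution`). A positive solution comes from
monotone iteration between an explicit subsolution and an explicit supersolution
(`exists_pos_isSolution`).

Size. The cubic term makes solutions blow up unless `y²` stays below about `max (-s) 0 / 2`
(`IsSolution.sq_le`). So every global solution is bounded on the right, and two applications of an
interior estimate for `w'' = p w + f` give `y = -α/s + O(s⁻²)`. On the left, minimality supplies the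
matching lower bound: a minimal solution lies above strict subsolutions
(`IsMinimalSolution.le_of_subsolution`), in particular above bumps of nearly equilibrium height.
Hence `y² = -s/2 + O(1)`.

Order. At a maximum of the ratio of a subsolution to a positive solution, the cubic term gives a
contradiction if the ratio exceeds one. This yields uniqueness of positive solutions and, since left
translates are subsolutions, monotonicity. For part (ii), `-y` is a strict subsolution when `α < 0`,
so a minimal solution cannot dip below zero between points where it is nonnegative. A zero therefore
forces `y < 0` to its left, and the left asymptotics apply to `-y`.

The Airy constant. For `α = 0` a Wronskian argument gives `u / Ai → k`. That `k = 1` uses the Lax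
pair. Take its joint solution `(f, g)` in `(s, μ)` with limits `(1, κ)` at `s = +∞` for `μ = 0`,
where `κ = (1 + k)/2`. As `μ → ∞` the normalised `g` tends to `κ - k`, because the Laplace transform
of `u` detects `k` (`IsLaxSolution.tendsto_snd_normalized`). Far to the left, `f - g = (1 - κ) exp
(∫ u)` dominates at `μ = 0`, and this fixes opposite signs of `f` and `g` for all `μ ≥ 0`
(`IsLaxSolution.mul_neg_of_dominates`). Comparing signs gives `(κ - k)(1 - κ) ≤ 0`, that is `(1 -
κ)² ≤ 0`. -/

theorem le_of_hasDerivAt_nonneg {f f' : ℝ → ℝ} {a b : ℝ} (hab : a ≤ b)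
    (hf : ∀ x ∈ Icc a b, HasDerivAt f (f' x) x) (h : ∀ x ∈ Icc a b, 0 ≤ f' x) : f a ≤ f b := by
  have hm : MonotoneOn f (Icc a b) := by
    refine monotoneOn_of_deriv_nonneg (convex_Icc a b)
      (fun x hx => (hf x hx).continuousAt.continuousWithinAt)
      (fun x hx => (hf x (interior_subset hx)).differentiableAt.differentiableWithinAt)
      (fun x hx => ?_)
    rw [(hf x (interior_subset hx)).deriv]
    exact h x (interior_subset hx)
  exact hm (left_mem_Icc.2 hab) (right_mem_Icc.2 hab) hab

/-- If `c > 0`, the second derivative test makes the point a local minimum as well, so `f` is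
locally constant and `c = 0`. This is the maximum principle behind every comparison below. -/
theorem nonpos_of_isLocalMax {f f' : ℝ → ℝ} {a c : ℝ} (hmax : IsLocalMax f a)
    (h1 : ∀ᶠ x in 𝓝 a, HasDerivAt f (f' x) x) (h2 : HasDerivAt f' c a) : c ≤ 0 := by
  by_contra! hc
  have hd : deriv f =ᶠ[𝓝 a] f' := h1.mono fun x hx => hx.deriv
  have h2' : HasDerivAt (deriv f) c a := h2.congr_of_eventuallyEq hd
  have hmin : IsLocalMin f a :=
    isLocalMin_of_deriv_deriv_pos (by rwa [h2'.deriv]) hmax.deriv_eq_zero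
      h1.self_of_nhds.continuousAt
  have hconst : f =ᶠ[𝓝 a] fun _ => f a := by
    filter_upwards [hmax, hmin] with x hx hx'
    exact le_antisymm hx hx'
  have h0 : deriv f =ᶠ[𝓝 a] fun _ => 0 := by
    filter_upwards [hconst.eventuallyEq_nhds] with x hx
    rw [hx.deriv_eq]; simp
  have : c = 0 := h2'.unique ((hasDerivAt_const a (0 : ℝ)).congr_of_eventuallyEq h0)
  exact hc.ne' this

/-- A function dominated in derivative by a function tending to zero stays close to its limit. -/
theorem abs_sub_le_of_tendsto {f f' h h' : ℝ → ℝ} {s L : ℝ}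
    (hf : ∀ t, s ≤ t → HasDerivAt f (f' t) t) (hh : ∀ t, s ≤ t → HasDerivAt h (h' t) t)
    (hle : ∀ t, s ≤ t → |f' t| ≤ -h' t) (hfL : Tendsto f atTop (𝓝 L))
    (hh0 : Tendsto h atTop (𝓝 0)) : |f s - L| ≤ h s := by
  have h1 : L + 0 ≤ f s + h s := by
    refine le_of_tendsto (hfL.add hh0) ?_
    filter_upwards [eventually_ge_atTop s] with t ht
    have := le_of_hasDerivAt_nonneg (f := fun x => -(f x + h x)) ht
      (fun x hx => ((hf x hx.1).add (hh x hx.1)).neg)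
      (fun x hx => by have := abs_le.1 (hle x hx.1); linarith [this.2])
    linarith
  have h2 : f s - h s ≤ L - 0 := by
    refine ge_of_tendsto (hfL.sub hh0) ?_
    filter_upwards [eventually_ge_atTop s] with t ht
    exact le_of_hasDerivAt_nonneg (f := fun x => f x - h x) ht
      (fun x hx => ((hf x hx.1).sub (hh x hx.1)))
      (fun x hx => by have := abs_le.1 (hle x hx.1); linarith [this.1])
  rw [abs_le]
  constructor <;> linarith

theorem gronwall_scalar {N N' : ℝ → ℝ} {C a b : ℝ} (hab : a ≤ b)
    (hN : ∀ x ∈ Icc a b, HasDerivAt N (N' x) x) (h : ∀ x ∈ Icc a b, N' x ≤ C * N x) :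
    N b ≤ N a * Real.exp (C * (b - a)) := by
  have key := le_of_hasDerivAt_nonneg (f := fun x => -(N x * Real.exp (-(C * x))))
    (f' := fun x => -(N' x * Real.exp (-(C * x)) + N x * (Real.exp (-(C * x)) * -(C * 1)))) hab
    (fun x hx => ((hN x hx).mul ((((hasDerivAt_id x).const_mul C).neg).exp)).neg)
    (fun x hx => by
      have h1 := h x hx
      have h2 := Real.exp_pos (-(C * x))
      nlinarith)
  have e1 : Real.exp (C * (b - a)) = Real.exp (C * b) * Real.exp (-(C * a)) := by
    rw [← Real.exp_add]; ring_nf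
  have e2 : N b = N b * Real.exp (-(C * b)) * Real.exp (C * b) := by
    rw [mul_assoc, ← Real.exp_add]; simp
  rw [e1, e2]
  have := Real.exp_pos (C * b)
  nlinarith

theorem eq_zero_of_forall_abs_deriv_le {N N' : ℝ → ℝ} (t₀ : ℝ) (h0 : N t₀ = 0) (hpos : ∀ x, 0 ≤ N x)
    (hN : ∀ x, HasDerivAt N (N' x) x)
    (h : ∀ a b : ℝ, ∃ C, ∀ x ∈ Icc a b, |N' x| ≤ C * N x) (s : ℝ) : N s = 0 := by
  rcases le_total t₀ s with hs | hs
  · obtain ⟨C, hC⟩ := h t₀ s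
    have := gronwall_scalar (C := C) hs (fun x _ => hN x)
      (fun x hx => (le_abs_self _).trans (hC x hx))
    rw [h0, zero_mul] at this
    exact le_antisymm this (hpos s)
  · obtain ⟨C, hC⟩ := h s t₀
    have := gronwall_scalar (N := fun x => N (-x)) (N' := fun x => N' (-x) * (-1)) (C := C)
      (neg_le_neg hs)
      (fun x _ => (hN (-x)).comp x (hasDerivAt_neg x))
      (fun x hx => by
        have := hC (-x) ⟨by linarith [hx.2], by linarith [hx.1]⟩
        linarith [neg_le_abs (N' (-x))])
    simp only [neg_neg, h0, zero_mul] at this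
    exact le_antisymm this (hpos s)

variable {α : ℝ} {y : ℝ → ℝ}

theorem IsSolution.hasDerivAt (h : IsSolution α y) (s : ℝ) : HasDerivAt y (deriv y s) s :=
  (h.1 s).hasDerivAt

theorem IsSolution.continuous (h : IsSolution α y) : Continuous y := h.1.continuous

theorem IsSolution.continuous_deriv (h : IsSolution α y) : Continuous (deriv y) :=
  continuous_iff_continuousAt.2 fun s => (h.2 s).continuousAt

theorem IsSolution.contDiff (h : IsSolution α y) : ContDiff ℝ ∞ y := by
  -- Bootstrap: `y` and `y'` gain regularity together, since `y''` is a polynomial in `s` and `y`.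
  have key : ∀ n : ℕ, ContDiff ℝ n y ∧ ContDiff ℝ n (deriv y) := by
    intro n
    induction n with
    | zero => exact ⟨contDiff_zero.2 h.continuous, contDiff_zero.2 h.continuous_deriv⟩
    | succ n ih =>
      have e : deriv (deriv y) = fun s => s * y s + 2 * y s ^ 3 + α := by
        funext s; exact (h.2 s).deriv
      push_cast
      refine ⟨contDiff_succ_iff_deriv.2 ⟨h.1, by simp, ih.2⟩,
        contDiff_succ_iff_deriv.2 ⟨fun s => (h.2 s).differentiableAt, by simp, ?_⟩⟩
      rw [e]
      have := ih.1
      fun_prop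
  exact contDiff_infty.2 fun n => (key n).1

theorem IsSolution.neg (h : IsSolution α y) : IsSolution (-α) (fun s => -y s) := by
  have e : deriv (fun s => -y s) = fun s => -deriv y s := by funext s; simp
  refine ⟨h.1.neg, fun s => ?_⟩
  rw [e]
  exact (h.2 s).neg.congr_deriv (by ring)

theorem IsSolution.hasDerivAt_shift (h : IsSolution α y) (t s : ℝ) :
    HasDerivAt (fun s => y (s + t)) (deriv y (s + t)) s :=
  (h.hasDerivAt (s + t)).comp_add_const s t

theorem isSolution_of_hasDerivAt {v : ℝ → ℝ} (h1 : ∀ s, HasDerivAt y (v s) s)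
    (h2 : ∀ s, HasDerivAt v (s * y s + 2 * y s ^ 3 + α) s) : IsSolution α y := by
  have e : deriv y = v := funext fun s => (h1 s).deriv
  exact ⟨fun s => (h1 s).differentiableAt, fun s => by rw [e]; exact h2 s⟩

end PainleveII

/-! ### A priori bounds for global solutions and their asymptotics at infinity. -/

namespace PainleveII

open Set Topology

variable {α : ℝ} {y : ℝ → ℝ}

/-- A Keller–Osserman estimate: `y` times the cutoff `1 - (s - s₁)²` has an interior maximum, where
the cubic term must be balanced by the linear terms and the derivatives of the cutoff. In the
constant `9`, the cutoff contributes `8` and the unit half-width of the window `1`; `1 ≤ A` lets `α`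
be absorbed in `|α| * y`. -/
theorem IsSolution.le_of_le_sq (h : IsSolution α y) {s₁ A : ℝ} (hA1 : 1 ≤ A)
    (hA : 9 + |α| + max (-s₁) 0 ≤ 2 * A ^ 2) : y s₁ ≤ A := by
  by_contra! hc
  set F : ℝ → ℝ := fun s => y s * (1 - (s - s₁) ^ 2) with hF
  have hy := h.continuous
  obtain ⟨x, hx, hmax⟩ := (isCompact_Icc (a := s₁ - 1) (b := s₁ + 1)).exists_isMaxOn
    ⟨s₁, by constructor <;> linarith⟩ (f := F) (by fun_prop)
  have hFs : A < F x := by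
    have h1 : F s₁ ≤ F x := hmax (show s₁ ∈ Icc (s₁ - 1) (s₁ + 1) by constructor <;> linarith)
    have h2 : F s₁ = y s₁ := by simp [hF]
    linarith
  have hx1 : x ∈ Ioo (s₁ - 1) (s₁ + 1) := by
    refine ⟨lt_of_le_of_ne hx.1 ?_, lt_of_le_of_ne hx.2 ?_⟩
    · rintro rfl; simp [hF] at hFs; linarith
    · rintro rfl; simp [hF] at hFs; linarith
  have hloc : IsLocalMax F x := hmax.isLocalMax (Icc_mem_nhds hx1.1 hx1.2)
  have hd1 : ∀ s, HasDerivAt F (deriv y s * (1 - (s - s₁) ^ 2) + y s * (-(2 * (s - s₁)))) s := by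
    intro s
    have h3 : HasDerivAt (fun s : ℝ => 1 - (s - s₁) ^ 2) (-(2 * (s - s₁))) s :=
      ((((hasDerivAt_id s).sub_const s₁).pow 2).const_sub 1).congr_deriv (by simp)
    exact (h.hasDerivAt s).mul h3
  have hd2 : HasDerivAt (fun s => deriv y s * (1 - (s - s₁) ^ 2) + y s * (-(2 * (s - s₁))))
      ((x * y x + 2 * y x ^ 3 + α) * (1 - (x - s₁) ^ 2) + deriv y x * (-(2 * (x - s₁)))
        + (deriv y x * (-(2 * (x - s₁))) + y x * (-(2 * 1)))) x := by
    have h3 : HasDerivAt (fun s : ℝ => 1 - (s - s₁) ^ 2) (-(2 * (x - s₁))) x :=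
      ((((hasDerivAt_id x).sub_const s₁).pow 2).const_sub 1).congr_deriv (by simp)
    have h4 : HasDerivAt (fun s : ℝ => -(2 * (s - s₁))) (-(2 * 1)) x :=
      (((hasDerivAt_id x).sub_const s₁).const_mul 2).neg
    exact ((h.2 x).mul h3).add ((h.hasDerivAt x).mul h4)
  have e1 := hloc.hasDerivAt_eq_zero (hd1 x)
  have e2 := nonpos_of_isLocalMax hloc (Eventually.of_forall hd1) hd2
  set X := x - s₁ with hX
  set d := 1 - X ^ 2 with hd
  have hd0 : 0 < d := by
    have h1 := hx1.1; have h2 := hx1.2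
    nlinarith
  have hd1' : d ≤ 1 := by nlinarith [sq_nonneg X]
  set Y := y x with hY
  have hM : A < Y * d := hFs
  have hY0 : A < Y := by
    have : 0 < Y := by
      by_contra! h0
      nlinarith
    nlinarith
  -- Multiply `F'' ≤ 0` by `d` and eliminate `y'` through `F' = 0`; the leftover factor is `8 X² + 2
  -- d = 8 - 6 d ≤ 8`.
  have e3 : (x * Y + 2 * Y ^ 3 + α) * d ^ 2 ≤ 8 * Y := by
    have h5 : deriv y x * d = 2 * X * Y := by linarith
    have h6 := mul_nonpos_of_nonneg_of_nonpos hd0.le e2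
    have h7 : (x * Y + 2 * Y ^ 3 + α) * d ^ 2 - 4 * X * (deriv y x * d) - 2 * Y * d ≤ 0 := by
      linarith
    rw [h5] at h7
    nlinarith
  have hx0 : -(1 + max (-s₁) 0) ≤ x := by
    have := le_max_left (-s₁) 0
    linarith [hx1.1]
  have hm := le_max_right (-s₁) 0
  have hd2' : d ^ 2 ≤ 1 := by nlinarith
  have hd2'' : 0 ≤ d ^ 2 := sq_nonneg d
  have e4 : -(1 + max (-s₁) 0) ≤ x * d ^ 2 := by nlinarith
  have e5 : -|α| * Y ≤ α * d ^ 2 := by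
    have := neg_abs_le α
    have := abs_nonneg α
    nlinarith
  have e6 : (-(1 + max (-s₁) 0) + 2 * (Y * d) ^ 2 - |α| - 8) * Y ≤ 0 := by
    have : -(1 + max (-s₁) 0) * Y ≤ x * d ^ 2 * Y := by
      apply mul_le_mul_of_nonneg_right e4; linarith
    nlinarith
  have e7 : A ^ 2 < (Y * d) ^ 2 := by nlinarith
  nlinarith

/-- Global solutions cannot exceed the equilibrium by much: otherwise they would blow up. -/
theorem IsSolution.sq_le (h : IsSolution α y) (s : ℝ) :
    y s ^ 2 ≤ (9 + |α| + max (-s) 0) / 2 := by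
  have hm := le_max_right (-s) 0
  have ha := abs_nonneg α
  set B := (9 + |α| + max (-s) 0) / 2 with hB
  have hs : √B ^ 2 = B := Real.sq_sqrt (by positivity)
  have h1 : 1 ≤ √B := Real.one_le_sqrt.2 (by linarith)
  have h2 := h.le_of_le_sq (s₁ := s) h1 (by linarith)
  have h3 := h.neg.le_of_le_sq (s₁ := s) h1 (by rw [abs_neg]; linarith)
  rw [← hs, sq_le_sq, abs_of_nonneg (Real.sqrt_nonneg B), abs_le]
  constructor <;> linarith

/-- Subtracting the parabola `M (t - s)²` pushes a large maximum inside the window, since `w ≤ M` at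
the ends, and costs only `2 M` in the second derivative. -/
theorem le_of_linear_window {w w₁ p f : ℝ → ℝ} {s p₀ F M : ℝ} (hp₀ : 0 < p₀)
    (hw : ∀ t ∈ Icc (s - 1) (s + 1), HasDerivAt w (w₁ t) t)
    (hw₁ : ∀ t ∈ Icc (s - 1) (s + 1), HasDerivAt w₁ (p t * w t + f t) t)
    (hp : ∀ t ∈ Icc (s - 1) (s + 1), p₀ ≤ p t) (hf : ∀ t ∈ Icc (s - 1) (s + 1), |f t| ≤ F)
    (hM : ∀ t ∈ Icc (s - 1) (s + 1), |w t| ≤ M) : w s ≤ (F + 2 * M) / p₀ := by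
  have hs : s ∈ Icc (s - 1) (s + 1) := by constructor <;> linarith
  have hM0 : 0 ≤ M := (abs_nonneg _).trans (hM s hs)
  have hF0 : 0 ≤ F := (abs_nonneg _).trans (hf s hs)
  have hB0 : 0 ≤ (F + 2 * M) / p₀ := by positivity
  by_contra! hc
  set H : ℝ → ℝ := fun t => w t - M * (t - s) ^ 2 with hH
  have hd : ∀ t ∈ Icc (s - 1) (s + 1), HasDerivAt H (w₁ t - M * (2 * (t - s))) t := by
    intro t ht
    have h3 : HasDerivAt (fun t : ℝ => M * (t - s) ^ 2) (M * (2 * (t - s))) t :=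
      ((((hasDerivAt_id t).sub_const s).pow 2).const_mul M).congr_deriv (by simp)
    exact (hw t ht).sub h3
  obtain ⟨x, hx, hmax⟩ := (isCompact_Icc (a := s - 1) (b := s + 1)).exists_isMaxOn ⟨s, hs⟩
    (f := H) (fun t ht => (hd t ht).continuousAt.continuousWithinAt)
  have hHx : (F + 2 * M) / p₀ < H x := by
    have h1 : H s ≤ H x := hmax hs
    have h2 : H s = w s := by simp [hH]
    linarith
  have hx1 : x ∈ Ioo (s - 1) (s + 1) := by
    have := hM x hx
    have h2 := le_abs_self (w x)
    refine ⟨lt_of_le_of_ne hx.1 ?_, lt_of_le_of_ne hx.2 ?_⟩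
    · rintro rfl; simp [hH] at hHx; linarith
    · rintro rfl; simp [hH] at hHx; linarith
  have hloc : IsLocalMax H x := hmax.isLocalMax (Icc_mem_nhds hx1.1 hx1.2)
  have hd2 : HasDerivAt (fun t => w₁ t - M * (2 * (t - s))) (p x * w x + f x - M * (2 * 1)) x :=
    (hw₁ x hx).sub ((((hasDerivAt_id x).sub_const s).const_mul 2).const_mul M)
  have e := nonpos_of_isLocalMax hloc
    (by filter_upwards [Icc_mem_nhds hx1.1 hx1.2] with t ht using hd t ht) hd2
  have h1 : (F + 2 * M) / p₀ < w x := by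
    have : 0 ≤ M * (x - s) ^ 2 := by positivity
    simp only [hH] at hHx
    linarith
  have h2 : F + 2 * M < p₀ * w x := by rwa [div_lt_iff₀' hp₀] at h1
  have h3 : p₀ * w x ≤ p x * w x := mul_le_mul_of_nonneg_right (hp x hx) (by linarith)
  have h4 := neg_abs_le (f x)
  have h5 := hf x hx
  linarith

/-- Interior estimate for `w'' = p w + f` with large `p`. -/
theorem abs_le_of_linear_window {w w₁ p f : ℝ → ℝ} {s p₀ F M : ℝ} (hp₀ : 0 < p₀)
    (hw : ∀ t ∈ Icc (s - 1) (s + 1), HasDerivAt w (w₁ t) t)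
    (hw₁ : ∀ t ∈ Icc (s - 1) (s + 1), HasDerivAt w₁ (p t * w t + f t) t)
    (hp : ∀ t ∈ Icc (s - 1) (s + 1), p₀ ≤ p t) (hf : ∀ t ∈ Icc (s - 1) (s + 1), |f t| ≤ F)
    (hM : ∀ t ∈ Icc (s - 1) (s + 1), |w t| ≤ M) : |w s| ≤ (F + 2 * M) / p₀ := by
  have h1 := le_of_linear_window hp₀ hw hw₁ hp hf hM
  have h2 := le_of_linear_window (w := fun t => -w t) (w₁ := fun t => -w₁ t) (f := fun t => -f t)
    (p := p) hp₀ (fun t ht => (hw t ht).neg) (fun t ht => (hw₁ t ht).neg.congr_deriv (by ring)) hp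
    (fun t ht => by simpa using hf t ht) (fun t ht => by simpa using hM t ht)
  rw [abs_le]
  constructor <;> linarith

/-- The equation is linear in form, `y'' = (t + 2 y²) y + α`, with coefficient at least `s - 1` on
the window around `s`; a bounded solution is then `O(1/s)`. -/
theorem IsSolution.abs_le_div (h : IsSolution α y) : ∃ C, 0 ≤ C ∧ ∀ s, 2 ≤ s → |y s| ≤ C / s := by
  set M := √((9 + |α|) / 2) with hM
  have hb : ∀ t, 0 ≤ t → |y t| ≤ M := by
    intro t ht
    have := h.sq_le t
    rw [max_eq_right (by linarith), add_zero] at this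
    exact Real.abs_le_sqrt this
  have hM0 : 0 ≤ M := Real.sqrt_nonneg _
  refine ⟨2 * (|α| + 2 * M), by positivity, fun s hs => ?_⟩
  have h1 := abs_le_of_linear_window (w := y) (w₁ := deriv y) (p := fun t => t + 2 * y t ^ 2)
    (f := fun _ => α) (s := s) (p₀ := s - 1) (F := |α|) (M := M) (by linarith)
    (fun t _ => h.hasDerivAt t) (fun t _ => (h.2 t).congr_deriv (by ring))
    (fun t ht => by nlinarith [ht.1, sq_nonneg (y t)]) (fun t _ => le_rfl)
    (fun t ht => hb t (by linarith [ht.1]))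
  refine h1.trans ?_
  rw [div_le_div_iff₀ (by linarith) (by linarith)]
  have : 0 ≤ |α| + 2 * M := by positivity
  nlinarith

/-- The corrected function `y + α/t` is `O(1/t)` and solves the same linear equation with a source
that is also `O(1/t)`, so the interior estimate gains one more factor `1/s`. -/
theorem IsSolution.abs_add_div_le (h : IsSolution α y) :
    ∃ C, ∀ s, 3 ≤ s → |y s + α / s| ≤ C / s ^ 2 := by
  obtain ⟨C, hC0, hC⟩ := h.abs_le_div
  set M := C + |α| with hMd
  set F := 2 * (C ^ 2 + 1) * |α| with hFd
  have hM0 : 0 ≤ M := by positivity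
  have hF0 : 0 ≤ F := by positivity
  refine ⟨4 * (F + 2 * M), fun s hs => ?_⟩
  have ht2 : ∀ t ∈ Icc (s - 1) (s + 1), 2 ≤ t ∧ 1 / t ≤ 2 / s := by
    intro t ht
    have := ht.1
    refine ⟨by linarith, ?_⟩
    rw [div_le_div_iff₀ (by linarith) (by linarith)]
    linarith
  have h1 := abs_le_of_linear_window (w := fun t => y t + α / t)
    (w₁ := fun t => deriv y t + -α / t ^ 2) (p := fun t => t + 2 * y t ^ 2)
    (f := fun t => -2 * y t ^ 2 * α / t + 2 * α / t ^ 3) (s := s) (p₀ := s - 1)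
    (F := F * (2 / s)) (M := M * (2 / s)) (by linarith)
    (fun t ht => by
      have h0 : t ≠ 0 := by linarith [(ht2 t ht).1]
      refine (h.hasDerivAt t).add (((hasDerivAt_const t α).div (hasDerivAt_id t) h0).congr_deriv ?_)
      simp)
    (fun t ht => by
      have h0 : t ≠ 0 := by linarith [(ht2 t ht).1]
      refine ((h.2 t).add ((hasDerivAt_const t (-α)).div (hasDerivAt_pow 2 t)
        (pow_ne_zero 2 h0))).congr_deriv ?_
      field_simp
      ring)
    (fun t ht => by nlinarith [ht.1, sq_nonneg (y t)])
    (fun t ht => by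
      obtain ⟨h2, h3⟩ := ht2 t ht
      have h4 := hC t h2
      have ht0 : 0 < t := by linarith
      have h5 : |y t| ^ 2 ≤ C ^ 2 := by
        apply pow_le_pow_left₀ (abs_nonneg _)
        refine h4.trans (div_le_self hC0 (by linarith))
      have h6 : 1 / t ^ 3 ≤ 1 / t := by
        apply one_div_le_one_div_of_le ht0
        nlinarith [mul_self_nonneg (t - 1)]
      calc |-2 * y t ^ 2 * α / t + 2 * α / t ^ 3|
          ≤ |-2 * y t ^ 2 * α / t| + |2 * α / t ^ 3| := abs_add_le _ _
        _ = 2 * |y t| ^ 2 * |α| * (1 / t) + 2 * |α| * (1 / t ^ 3) := by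
            simp only [abs_div, abs_mul, abs_pow, abs_neg, Nat.abs_ofNat, abs_of_pos ht0]
            ring
        _ ≤ 2 * C ^ 2 * |α| * (1 / t) + 2 * |α| * (1 / t) := by gcongr
        _ = F * (1 / t) := by rw [hFd]; ring
        _ ≤ F * (2 / s) := by gcongr)
    (fun t ht => by
      obtain ⟨h2, h3⟩ := ht2 t ht
      have h4 := hC t h2
      have ht0 : 0 < t := by linarith
      calc |y t + α / t| ≤ |y t| + |α / t| := abs_add_le _ _
        _ ≤ C / t + |α| / t := by rw [abs_div, abs_of_pos ht0]; gcongr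
        _ = M * (1 / t) := by rw [hMd]; ring
        _ ≤ M * (2 / s) := by gcongr)
  refine h1.trans ?_
  have hs1 : 0 < s - 1 := by linarith
  have hs0 : 0 < s := by linarith
  rw [div_le_div_iff₀ hs1 (by positivity)]
  have e : (F * (2 / s) + 2 * (M * (2 / s))) * s ^ 2 = 2 * (F + 2 * M) * s := by
    field_simp
  rw [e]
  have : 0 ≤ F + 2 * M := by positivity
  nlinarith

theorem IsSolution.tendsto_zero (h : IsSolution α y) : Tendsto y atTop (𝓝 0) := by
  obtain ⟨C, _, hC⟩ := h.abs_le_div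
  refine squeeze_zero_norm' (a := fun s => C / s) ?_ (tendsto_const_nhds.div_atTop tendsto_id)
  filter_upwards [eventually_ge_atTop 2] with s hs using hC s hs

theorem IsSolution.boundedAtInfty (h : IsSolution α y) : BoundedAtInfty y := by
  obtain ⟨C, hC0, hC⟩ := h.abs_le_div
  exact ⟨C, 2, fun s hs => (hC s hs).trans (div_le_self hC0 (by linarith))⟩

theorem IsSolution.isEquivalent_atTop (h : IsSolution α y) (hα : α < 0) :
    y ~[atTop] (fun s : ℝ => |α| / s) := by
  obtain ⟨C, hC⟩ := h.abs_add_div_le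
  have hO : (fun s => y s + α / s) =O[atTop] (fun s : ℝ => 1 / s ^ 2) := by
    refine IsBigO.of_bound C ?_
    filter_upwards [eventually_ge_atTop 3] with s hs
    have := hC s hs
    rw [Real.norm_eq_abs, Real.norm_of_nonneg (by positivity : (0 : ℝ) ≤ 1 / s ^ 2), mul_one_div]
    exact this
  have ho : (fun s : ℝ => 1 / s ^ 2) =o[atTop] (fun s : ℝ => |α| / s) := by
    refine (isLittleO_iff_tendsto' ?_).2 ?_
    · filter_upwards [eventually_gt_atTop 0] with s hs h0
      have : 0 < |α| / s := div_pos (abs_pos.2 hα.ne) hs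
      linarith
    · have : Tendsto (fun s : ℝ => |α|⁻¹ / s) atTop (𝓝 0) := tendsto_const_nhds.div_atTop tendsto_id
      refine this.congr' ?_
      filter_upwards [eventually_gt_atTop 0] with s hs
      have : |α| ≠ 0 := (abs_pos.2 hα.ne).ne'
      field_simp
  have := hO.trans_isLittleO ho
  refine this.congr_left fun s => ?_
  rw [abs_of_neg hα]
  simp only [Pi.sub_apply]
  ring

theorem isEquivalent_sqrt_atBot {C : ℝ} (h1 : ∀ᶠ s in atBot, 0 ≤ y s)
    (h2 : ∀ᶠ s in atBot, (-s - C) / 2 ≤ y s ^ 2 ∧ y s ^ 2 ≤ (-s + C) / 2) :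
    y ~[atBot] (fun s : ℝ => √(|s| / 2)) := by
  have hlim : Tendsto (fun s => y s ^ 2 / (|s| / 2)) atBot (𝓝 1) := by
    have hz : Tendsto (fun s : ℝ => C / -s) atBot (𝓝 0) :=
      tendsto_const_nhds.div_atTop tendsto_neg_atBot_atTop
    refine tendsto_of_tendsto_of_tendsto_of_le_of_le' (g := fun s : ℝ => 1 - C / -s)
      (h := fun s : ℝ => 1 + C / -s) ?_ ?_ ?_ ?_
    · simpa using tendsto_const_nhds.sub hz
    · simpa using tendsto_const_nhds.add hz
    · filter_upwards [h2, eventually_lt_atBot 0] with s hs h0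
      rw [abs_of_neg h0, le_div_iff₀ (by linarith)]
      have : C / -s * -s = C := div_mul_cancel₀ _ (by linarith)
      nlinarith [hs.1]
    · filter_upwards [h2, eventually_lt_atBot 0] with s hs h0
      rw [abs_of_neg h0, div_le_iff₀ (by linarith)]
      have : C / -s * -s = C := div_mul_cancel₀ _ (by linarith)
      nlinarith [hs.2]
  refine (isEquivalent_iff_tendsto_one ?_).2 ?_
  · filter_upwards [eventually_lt_atBot 0] with s hs
    have : 0 < |s| := abs_pos.2 hs.ne
    positivity
  · have := hlim.sqrt
    rw [Real.sqrt_one] at this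
    refine this.congr' ?_
    filter_upwards [h1] with s hs
    rw [Real.sqrt_div (sq_nonneg _), Real.sqrt_sq hs]
    rfl

end PainleveII

/-! ### Energy excess, positivity implies minimality, and comparison for minimal solutions. -/

namespace PainleveII

open Set Topology MeasureTheory

variable {α : ℝ} {y : ℝ → ℝ}

/-- The energy density of a perturbation `φ` of a solution `y`, linear terms removed. -/
noncomputable def excessDensity (y φ : ℝ → ℝ) (s : ℝ) : ℝ :=
  1 / 2 * deriv φ s ^ 2 + 1 / 2 * (s + 6 * y s ^ 2) * φ s ^ 2 + 2 * y s * φ s ^ 3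
    + 1 / 2 * φ s ^ 4

theorem IsSolution.continuous_excessDensity (h : IsSolution α y) {φ : ℝ → ℝ}
    (hφ : ContDiff ℝ ∞ φ) : Continuous (excessDensity y φ) := by
  have h1 := h.continuous
  have h2 := hφ.continuous
  have h3 : Continuous (deriv φ) := hφ.continuous_deriv (by simp)
  unfold excessDensity
  fun_prop

theorem excessDensity_eq_zero {φ : ℝ → ℝ} {s : ℝ} (hs : s ∉ tsupport φ) :
    excessDensity y φ s = 0 := by
  have h1 : φ s = 0 := image_eq_zero_of_notMem_tsupport hs
  have h2 : deriv φ s = 0 := by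
    by_contra h
    exact hs (support_deriv_subset h)
  simp [excessDensity, h1, h2]

/-- By the equation, the terms linear in `φ` are the derivative of `y' φ`, which has compact support
and integrates to zero. -/
theorem IsSolution.energy_sub_energy (h : IsSolution α y) {φ : ℝ → ℝ} (hφ : ContDiff ℝ ∞ φ)
    (hc : HasCompactSupport φ) :
    energy α (fun s => y s + φ s) (tsupport φ) - energy α y (tsupport φ)
      = ∫ s, excessDensity y φ s := by
  have hy := h.continuous
  have hy' := h.continuous_deriv
  have hφc := hφ.continuous
  have hφ' : Continuous (deriv φ) := hφ.continuous_deriv (by simp)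
  have hφd : ∀ s, HasDerivAt φ (deriv φ s) s :=
    fun s => (hφ.differentiable (by simp) s).hasDerivAt
  have hd : deriv (fun s => y s + φ s) = fun s => deriv y s + deriv φ s := by
    funext s; exact ((h.hasDerivAt s).add (hφd s)).deriv
  have hcd : HasCompactSupport (deriv φ) := hc.deriv
  set L : ℝ → ℝ := fun s => deriv y s * φ s with hL
  set L' : ℝ → ℝ := fun s => (s * y s + 2 * y s ^ 3 + α) * φ s + deriv y s * deriv φ s with hL'
  have hLd : ∀ s, HasDerivAt L (L' s) s := fun s => (h.2 s).mul (hφd s)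
  have hLi : Integrable L := by
    apply Continuous.integrable_of_hasCompactSupport (by fun_prop)
    exact hc.mul_left
  have hL'i : Integrable L' := by
    apply Continuous.integrable_of_hasCompactSupport (by fun_prop)
    exact hc.mul_left.add hcd.mul_left
  have hL0 := integral_eq_zero_of_hasDerivAt_of_integrable hLd hL'i hLi
  have hQi : Integrable (excessDensity y φ) := by
    apply Continuous.integrable_of_hasCompactSupport (h.continuous_excessDensity hφ)
    exact HasCompactSupport.intro hc fun s hs => excessDensity_eq_zero hs
  have hK : IsCompact (tsupport φ) := hc
  unfold energy
  rw [← integral_sub]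
  · have e : ∀ s, (1 / 2 * deriv (fun s => y s + φ s) s ^ 2 + 1 / 2 * s * (y s + φ s) ^ 2
        + 1 / 2 * (y s + φ s) ^ 4 + α * (y s + φ s)) - (1 / 2 * deriv y s ^ 2
        + 1 / 2 * s * y s ^ 2 + 1 / 2 * y s ^ 4 + α * y s) = L' s + excessDensity y φ s := by
      intro s
      rw [hd]
      simp only [hL', excessDensity]
      ring
    simp_rw [e]
    rw [setIntegral_eq_integral_of_forall_compl_eq_zero, integral_add hL'i hQi, hL0, zero_add]
    intro s hs
    have h1 : φ s = 0 := image_eq_zero_of_notMem_tsupport hs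
    have h2 : deriv φ s = 0 := by
      by_contra h
      exact hs (support_deriv_subset h)
    rw [excessDensity_eq_zero hs]
    simp [hL', h1, h2]
  · rw [hd]
    exact ContinuousOn.integrableOn_compact hK (Continuous.continuousOn (by fun_prop))
  · exact ContinuousOn.integrableOn_compact hK (Continuous.continuousOn (by fun_prop))

theorem isMinimalSolution_iff : IsMinimalSolution α y ↔ IsSolution α y ∧
    ∀ φ : ℝ → ℝ, ContDiff ℝ ∞ φ → HasCompactSupport φ → 0 ≤ ∫ s, excessDensity y φ s := by
  unfold IsMinimalSolution
  refine and_congr_right fun h => forall_congr' fun φ => ?_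
  refine forall_congr' fun hφ => forall_congr' fun hc => ?_
  rw [← h.energy_sub_energy hφ hc, sub_nonneg]

theorem IsMinimalSolution.neg (h : IsMinimalSolution α y) :
    IsMinimalSolution (-α) (fun s => -y s) := by
  rw [isMinimalSolution_iff] at h ⊢
  refine ⟨h.1.neg, fun φ hφ hc => ?_⟩
  have := h.2 (fun s => -φ s) hφ.neg (by simpa [Function.comp_def] using hc.comp_left (g := fun x : ℝ => -x) (by simp))
  convert this using 3 with s
  have e : deriv (fun s => -φ s) s = -deriv φ s := by simp
  simp only [excessDensity, e]
  ring

/-- Picone's identity: the energy is convex in `y²`, so positive solutions are minimal. -/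
theorem IsSolution.isMinimalSolution (h : IsSolution α y) (hα : α ≤ 0) (hpos : ∀ s, 0 < y s) :
    IsMinimalSolution α y := by
  refine isMinimalSolution_iff.2 ⟨h, fun φ hφ hc => ?_⟩
  have hy := h.continuous
  have hy' := h.continuous_deriv
  have hφc := hφ.continuous
  have hφ' : Continuous (deriv φ) := hφ.continuous_deriv (by simp)
  have hφd : ∀ s, HasDerivAt φ (deriv φ s) s :=
    fun s => (hφ.differentiable (by simp) s).hasDerivAt
  have hcd : HasCompactSupport (deriv φ) := hc.deriv
  have hne : ∀ s, y s ≠ 0 := fun s => (hpos s).ne'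
  -- Picone's null Lagrangian `φ² y' / (2 y)`; subtracting its derivative completes the square in
  -- `φ'`.
  set L : ℝ → ℝ := fun s => 1 / 2 * (φ s * (φ s * (deriv y s / y s))) with hL
  set L' : ℝ → ℝ := fun s => 1 / 2 * (deriv φ s * (φ s * (deriv y s / y s)) + φ s *
    (deriv φ s * (deriv y s / y s) + φ s *
      (((s * y s + 2 * y s ^ 3 + α) * y s - deriv y s * deriv y s) / y s ^ 2))) with hL'
  have hLd : ∀ s, HasDerivAt L (L' s) s := fun s =>
    ((hφd s).mul ((hφd s).mul ((h.2 s).div (h.hasDerivAt s) (hne s)))).const_mul _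
  have hcq : Continuous fun s => deriv y s / y s := hy'.div₀ hy hne
  have hcr : Continuous fun s => ((s * y s + 2 * y s ^ 3 + α) * y s - deriv y s * deriv y s)
      / y s ^ 2 := Continuous.div₀ (by fun_prop) (by fun_prop) fun s => pow_ne_zero 2 (hne s)
  have hLi : Integrable L := by
    apply Continuous.integrable_of_hasCompactSupport (by fun_prop)
    refine HasCompactSupport.intro hc fun s hs => ?_
    simp [hL, image_eq_zero_of_notMem_tsupport hs]
  have hL'i : Integrable L' := by
    apply Continuous.integrable_of_hasCompactSupport (by fun_prop)
    refine HasCompactSupport.intro hc fun s hs => ?_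
    simp [hL', image_eq_zero_of_notMem_tsupport hs]
  have hL0 := integral_eq_zero_of_hasDerivAt_of_integrable hLd hL'i hLi
  have hQi : Integrable (excessDensity y φ) := by
    apply Continuous.integrable_of_hasCompactSupport (h.continuous_excessDensity hφ)
    exact HasCompactSupport.intro hc fun s hs => excessDensity_eq_zero hs
  rw [← hL0]
  refine integral_mono hL'i hQi fun s => ?_
  have e : excessDensity y φ s - L' s = 1 / 2 * (deriv φ s - deriv y s * φ s / y s) ^ 2
      + 1 / 2 * φ s ^ 2 * (2 * y s + φ s) ^ 2 + 1 / 2 * (-α) * (φ s ^ 2 / y s) := by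
    have := hne s
    simp only [excessDensity, hL']
    field_simp
    ring
  have h1 : 0 ≤ φ s ^ 2 / y s := div_nonneg (sq_nonneg _) (hpos s).le
  have h2 : 0 ≤ -α := by linarith
  have : 0 ≤ excessDensity y φ s - L' s := by rw [e]; positivity
  linarith

/-- A primitive of a step rising between `1` and `2` stays within `2` of the positive part. Rescaled
by `ε`, it is a smooth approximation of `max x 0` with error `2 ε`, flat for `x ≤ ε`. -/
theorem abs_integral_sub_max_le {χ : ℝ → ℝ} (hχ : Continuous χ) (h0 : ∀ t, t ≤ 1 → χ t = 0)
    (h1 : ∀ t, 2 ≤ t → χ t = 1) (hb : ∀ t, 0 ≤ χ t ∧ χ t ≤ 1) (x : ℝ) :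
    |(∫ t in (0 : ℝ)..x, χ t) - max x 0| ≤ 2 := by
  have hi : ∀ a b : ℝ, IntervalIntegrable χ volume a b := fun a b => hχ.intervalIntegrable a b
  have hle : ∀ b, 0 ≤ b → 0 ≤ (∫ t in (0 : ℝ)..b, χ t) ∧ (∫ t in (0 : ℝ)..b, χ t) ≤ b := by
    intro b hb0
    refine ⟨intervalIntegral.integral_nonneg hb0 fun t _ => (hb t).1, ?_⟩
    have := intervalIntegral.integral_mono_on hb0 (hi 0 b) (intervalIntegrable_const (c := 1))
      fun t _ => (hb t).2
    simpa using this
  rcases le_total x 0 with hx | hx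
  · have : ∫ t in (0 : ℝ)..x, χ t = 0 := by
      rw [intervalIntegral.integral_congr (g := fun _ => 0)]
      · simp
      · intro t ht
        rw [uIcc_of_ge hx] at ht
        exact h0 t (by linarith [ht.2])
    rw [this, max_eq_right hx]; simp
  · rw [max_eq_left hx]
    rcases le_total x 2 with hx2 | hx2
    · have := hle x hx
      rw [abs_le]; constructor <;> linarith
    · have e : ∫ t in (2 : ℝ)..x, χ t = x - 2 := by
        rw [intervalIntegral.integral_congr (g := fun _ => 1)]
        · simp
        · intro t ht
          rw [uIcc_of_le hx2] at ht
          exact h1 t ht.1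
      rw [← intervalIntegral.integral_add_adjacent_intervals (hi 0 2) (hi 2 x), e]
      have := hle 2 (by norm_num)
      rw [abs_le]; constructor <;> linarith

theorem tendsto_scaled_integral {χ : ℝ → ℝ} (hχ : Continuous χ) (h0 : ∀ t, t ≤ 1 → χ t = 0)
    (h1 : ∀ t, 2 ≤ t → χ t = 1) (hb : ∀ t, 0 ≤ χ t ∧ χ t ≤ 1) {ε : ℕ → ℝ} (hε : ∀ n, 0 < ε n)
    (hε0 : Tendsto ε atTop (𝓝 0)) (x : ℝ) :
    Tendsto (fun n => ε n * ∫ t in (0 : ℝ)..x / ε n, χ t) atTop (𝓝 (max x 0)) := by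
  rw [tendsto_iff_norm_sub_tendsto_zero]
  refine squeeze_zero (g := fun n => ε n * 2) (fun n => norm_nonneg _) (fun n => ?_)
    (by simpa using hε0.mul_const 2)
  have e : max x 0 = ε n * max (x / ε n) 0 := by
    rw [mul_max_of_nonneg _ _ (hε n).le, mul_zero, mul_div_cancel₀ _ (hε n).ne']
  rw [e, ← mul_sub, norm_mul, Real.norm_of_nonneg (hε n).le]
  exact mul_le_mul_of_nonneg_left (abs_integral_sub_max_le hχ h0 h1 hb _) (hε n).le

theorem abs_scaled_integral_le {χ : ℝ → ℝ} (hχ : Continuous χ) (h0 : ∀ t, t ≤ 1 → χ t = 0)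
    (h1 : ∀ t, 2 ≤ t → χ t = 1) (hb : ∀ t, 0 ≤ χ t ∧ χ t ≤ 1) {ε : ℝ} (hε : 0 < ε) (hε1 : ε ≤ 1)
    (x : ℝ) : |ε * ∫ t in (0 : ℝ)..x / ε, χ t| ≤ |x| + 2 := by
  have h2 := abs_integral_sub_max_le hχ h0 h1 hb (x / ε)
  have h3 : |∫ t in (0 : ℝ)..x / ε, χ t| ≤ |x / ε| + 2 := by
    have h4 : |max (x / ε) 0| ≤ |x / ε| := by
      rw [abs_of_nonneg (le_max_right _ _)]
      exact max_le (le_abs_self _) (abs_nonneg _)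
    have := abs_sub_abs_le_abs_sub (∫ t in (0 : ℝ)..x / ε, χ t) (max (x / ε) 0)
    linarith
  rw [abs_mul, abs_of_pos hε]
  rw [abs_div, abs_of_pos hε] at h3
  have h5 : ε * (|x| / ε) = |x| := mul_div_cancel₀ _ hε.ne'
  nlinarith

/-- A minimal solution lies above every function which is below it at the end points of an interval
and which is a strict subsolution where it exceeds the solution. -/
theorem IsMinimalSolution.le_of_subsolution (h : IsMinimalSolution α y) {B : ℝ → ℝ}
    (hB : ContDiff ℝ ∞ B) {t₁ t₂ : ℝ} (h1 : B t₁ ≤ y t₁) (h2 : B t₂ ≤ y t₂)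
    (hsub : ∀ s ∈ Ioo t₁ t₂, y s < B s →
      s * B s + 2 * B s ^ 3 + α < deriv (deriv B) s ∧ 0 ≤ B s + y s) :
    ∀ s ∈ Icc t₁ t₂, B s ≤ y s := by
  obtain ⟨hsol, hmin⟩ := isMinimalSolution_iff.1 h
  intro s₀ hs₀
  by_contra! hlt
  have hs₀' : s₀ ∈ Ioo t₁ t₂ := by
    refine ⟨lt_of_le_of_ne hs₀.1 ?_, lt_of_le_of_ne hs₀.2 ?_⟩
    · rintro rfl; linarith
    · rintro rfl; linarith
  have ht : t₁ < t₂ := hs₀'.1.trans hs₀'.2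
  have hy := hsol.continuous
  have hBc := hB.continuous
  have hB1 : ContDiff ℝ ∞ (deriv B) := (contDiff_infty_iff_deriv.1 hB).2
  have hB2 : Continuous (deriv (deriv B)) := hB1.continuous_deriv (by simp)
  have hBd : ∀ s, HasDerivAt B (deriv B s) s :=
    fun s => (hB.differentiable (by simp) s).hasDerivAt
  have hBd2 : ∀ s, HasDerivAt (deriv B) (deriv (deriv B) s) s :=
    fun s => (hB1.differentiable (by simp) s).hasDerivAt
  set w : ℝ → ℝ := fun s => B s - y s with hw
  set w₁ : ℝ → ℝ := fun s => deriv B s - deriv y s with hw₁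
  set w₂ : ℝ → ℝ := fun s => deriv (deriv B) s - (s * y s + 2 * y s ^ 3 + α) with hw₂
  have hwd : ∀ s, HasDerivAt w (w₁ s) s := fun s => (hBd s).sub (hsol.hasDerivAt s)
  have hwd2 : ∀ s, HasDerivAt w₁ (w₂ s) s := fun s => (hBd2 s).sub (hsol.2 s)
  have hwsm : ContDiff ℝ ∞ w := hB.sub hsol.contDiff
  have hwc : Continuous w := hwsm.continuous
  have hw₁c : Continuous w₁ := continuous_iff_continuousAt.2 fun s => (hwd2 s).continuousAt
  have hw₂c : Continuous w₂ := by fun_prop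
  set χ : ℝ → ℝ := fun t => Real.smoothTransition (t - 1) with hχ
  have hχsm : ContDiff ℝ ∞ χ :=
    (Real.smoothTransition.contDiff (n := ⊤)).comp (contDiff_id.sub contDiff_const)
  have hχc : Continuous χ := hχsm.continuous
  have hχ2c : Continuous fun t => χ t ^ 2 := hχc.pow 2
  have hχ0 : ∀ t, t ≤ 1 → χ t = 0 := fun t ht =>
    Real.smoothTransition.zero_of_nonpos (by linarith)
  have hχ1 : ∀ t, 2 ≤ t → χ t = 1 := fun t ht =>
    Real.smoothTransition.one_of_one_le (by linarith)
  have hχb : ∀ t, 0 ≤ χ t ∧ χ t ≤ 1 := fun t =>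
    ⟨Real.smoothTransition.nonneg _, Real.smoothTransition.le_one _⟩
  have hχ20 : ∀ t, t ≤ 1 → χ t ^ 2 = 0 := fun t ht => by simp [hχ0 t ht]
  have hχ21 : ∀ t, 2 ≤ t → χ t ^ 2 = 1 := fun t ht => by simp [hχ1 t ht]
  have hχ2b : ∀ t, 0 ≤ χ t ^ 2 ∧ χ t ^ 2 ≤ 1 := fun t =>
    ⟨sq_nonneg _, pow_le_one₀ (hχb t).1 (hχb t).2⟩
  -- The perturbation will be `ε ρ (w / ε)`, close to the positive part of `w = B - y`. Its squared
  -- derivative is `χ(w/ε)² w'²`. The primitive `R` of `χ²` makes this the derivative of `ε R(w/ε)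
  -- w'` minus `ε R(w/ε) w''`, which trades the gradient term for one in `w''`.
  set ρ : ℝ → ℝ := fun x => ∫ t in (0 : ℝ)..x, χ t with hρ
  set R : ℝ → ℝ := fun x => ∫ t in (0 : ℝ)..x, χ t ^ 2 with hR
  have hρd : ∀ x, HasDerivAt ρ (χ x) x := fun x => hχc.integral_hasStrictDerivAt 0 x |>.hasDerivAt
  have hRd : ∀ x, HasDerivAt R (χ x ^ 2) x :=
    fun x => hχ2c.integral_hasStrictDerivAt 0 x |>.hasDerivAt
  have hρsm : ContDiff ℝ ∞ ρ := by
    refine contDiff_infty_iff_deriv.2 ⟨fun x => (hρd x).differentiableAt, ?_⟩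
    rwa [show deriv ρ = χ from funext fun x => (hρd x).deriv]
  have hvanish : ∀ x, x ≤ 1 → ρ x = 0 ∧ R x = 0 := by
    intro x hx
    have hu : ∀ t ∈ uIcc 0 x, t ≤ 1 := fun t ht => by
      have := ht.2
      exact this.trans (by simp [hx])
    constructor
    · simp only [hρ]
      rw [intervalIntegral.integral_congr (g := fun _ => 0) fun t ht => hχ0 t (hu t ht)]
      simp
    · simp only [hR]
      rw [intervalIntegral.integral_congr (g := fun _ => 0) fun t ht => hχ20 t (hu t ht)]
      simp
  -- the reduced excess of the truncated perturbation
  have key : ∀ ε : ℝ, 0 < ε → 0 ≤ ∫ s in t₁..t₂, (-(1 / 2) * (ε * R (w s / ε)) * w₂ s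
      + 1 / 2 * (s + 6 * y s ^ 2) * (ε * ρ (w s / ε)) ^ 2 + 2 * y s * (ε * ρ (w s / ε)) ^ 3
      + 1 / 2 * (ε * ρ (w s / ε)) ^ 4) := by
    intro ε hε
    set Φ : ℝ → ℝ := fun s => ε * ρ (w s / ε) with hΦ
    have hΦsm : ContDiff ℝ ∞ Φ := contDiff_const.mul (hρsm.comp (hwsm.div_const ε))
    have hΦd : ∀ s, HasDerivAt Φ (χ (w s / ε) * w₁ s) s := by
      intro s
      have h0 : HasDerivAt (fun s => ρ (w s / ε)) (χ (w s / ε) * (w₁ s / ε)) s :=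
        HasDerivAt.comp (h₂ := ρ) (h := fun x => w x / ε) s (hρd (w s / ε)) ((hwd s).div_const ε)
      exact (h0.const_mul ε).congr_deriv (by field_simp)
    have hnear : ∀ t, w t ≤ 0 → ∀ᶠ s in 𝓝 t, Φ s = 0 := by
      intro t ht0
      have : ∀ᶠ s in 𝓝 t, w s < ε := hwc.continuousAt.eventually_lt_const (by linarith)
      filter_upwards [this] with s hs
      simp [hΦ, (hvanish (w s / ε) ((div_le_one hε).2 hs.le)).1]
    -- Cutting off at the end points keeps smoothness: there `w ≤ 0`, and `Φ` vanishes wherever `w <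
    -- ε`.
    set φ : ℝ → ℝ := (Ioo t₁ t₂).indicator Φ with hφ
    have hφin : ∀ s ∈ Ioo t₁ t₂, φ =ᶠ[𝓝 s] Φ := by
      intro s hs
      filter_upwards [isOpen_Ioo.mem_nhds hs] with x hx using indicator_of_mem hx _
    have hφout : ∀ s ∉ Ioo t₁ t₂, φ =ᶠ[𝓝 s] fun _ => 0 := by
      intro s hs
      have hor : (∀ᶠ x in 𝓝 s, x ∉ Ioo t₁ t₂) ∨ s = t₁ ∨ s = t₂ := by
        rw [mem_Ioo, not_and_or, not_lt, not_lt] at hs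
        rcases hs with hs | hs
        · rcases hs.eq_or_lt with hs | hs
          · exact Or.inr (Or.inl hs)
          · left
            filter_upwards [eventually_lt_nhds hs] with x hx hx' using absurd hx'.1 (by linarith)
        · rcases hs.eq_or_lt with hs | hs
          · exact Or.inr (Or.inr hs.symm)
          · left
            filter_upwards [eventually_gt_nhds hs] with x hx hx' using absurd hx'.2 (by linarith)
      have hΦ0 : s = t₁ ∨ s = t₂ → ∀ᶠ x in 𝓝 s, Φ x = 0 := by
        rintro (rfl | rfl)
        · exact hnear s (by simp only [hw]; linarith)
        · exact hnear s (by simp only [hw]; linarith)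
      rcases hor with hs | hs
      · filter_upwards [hs] with x hx using indicator_of_notMem hx _
      · filter_upwards [hΦ0 hs] with x hx
        by_cases hx' : x ∈ Ioo t₁ t₂
        · simp [hφ, indicator_of_mem hx', hx]
        · simp [hφ, indicator_of_notMem hx']
    have hφsm : ContDiff ℝ ∞ φ := by
      rw [contDiff_iff_contDiffAt]
      intro s
      by_cases hs : s ∈ Ioo t₁ t₂
      · exact hΦsm.contDiffAt.congr_of_eventuallyEq (hφin s hs)
      · exact contDiffAt_const.congr_of_eventuallyEq (hφout s hs)
    have hφc : HasCompactSupport φ := by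
      refine HasCompactSupport.intro (isCompact_Icc (a := t₁) (b := t₂)) fun s hs => ?_
      exact indicator_of_notMem (fun h => hs (Ioo_subset_Icc_self h)) _
    have hex := hmin φ hφsm hφc
    have e1 : ∫ s, excessDensity y φ s = ∫ s in t₁..t₂, excessDensity y Φ s := by
      have : excessDensity y φ = (Ioo t₁ t₂).indicator (excessDensity y Φ) := by
        funext s
        by_cases hs : s ∈ Ioo t₁ t₂
        · rw [indicator_of_mem hs]
          simp only [excessDensity, (hφin s hs).deriv_eq, (hφin s hs).eq_of_nhds]
        · rw [indicator_of_notMem hs]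
          simp [excessDensity, (hφout s hs).deriv_eq, (hφout s hs).eq_of_nhds]
      rw [this, integral_indicator measurableSet_Ioo, intervalIntegral.integral_of_le ht.le,
        integral_Ioc_eq_integral_Ioo]
    rw [e1] at hex
    set T : ℝ → ℝ := fun s => 1 / 2 * (ε * R (w s / ε) * w₁ s) with hT
    set T' : ℝ → ℝ := fun s => 1 / 2 * (χ (w s / ε) ^ 2 * w₁ s * w₁ s + ε * R (w s / ε) * w₂ s)
      with hT'
    have hTd : ∀ s, HasDerivAt T (T' s) s := fun s =>
      ((((((hRd (w s / ε)).comp s ((hwd s).div_const ε)).const_mul ε).congr_deriv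
        (by field_simp)).mul (hwd2 s)).const_mul (1 / 2))
    have hRc : Continuous R := continuous_iff_continuousAt.2 fun x => (hRd x).continuousAt
    have hρc : Continuous ρ := hρsm.continuous
    have hT'c : Continuous T' := by fun_prop
    have hTi : ∫ s in t₁..t₂, T' s = 0 := by
      rw [intervalIntegral.integral_eq_sub_of_hasDerivAt (fun s _ => hTd s)
        (hT'c.intervalIntegrable _ _)]
      have hw1 : w t₁ ≤ 0 := by simp only [hw]; linarith
      have hw2 : w t₂ ≤ 0 := by simp only [hw]; linarith
      simp [hT, (hvanish (w t₁ / ε) ((div_nonpos_of_nonpos_of_nonneg hw1 hε.le).trans zero_le_one)).2,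
        (hvanish (w t₂ / ε) ((div_nonpos_of_nonpos_of_nonneg hw2 hε.le).trans zero_le_one)).2]
    have e2 : ∫ s in t₁..t₂, excessDensity y Φ s = ∫ s in t₁..t₂, (excessDensity y Φ s - T' s) := by
      rw [intervalIntegral.integral_sub _ (hT'c.intervalIntegrable _ _), hTi, sub_zero]
      exact (hsol.continuous_excessDensity hΦsm).intervalIntegrable _ _
    rw [e2] at hex
    convert hex using 3 with s
    have e3 : deriv Φ s = χ (w s / ε) * w₁ s := (hΦd s).deriv
    simp only [excessDensity, e3, hT']
    simp only [hΦ]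
    ring
  set G : ℝ → ℝ := fun s => -(1 / 2) * (max (w s) 0) * w₂ s
      + 1 / 2 * (s + 6 * y s ^ 2) * (max (w s) 0) ^ 2 + 2 * y s * (max (w s) 0) ^ 3
      + 1 / 2 * (max (w s) 0) ^ 4 with hG
  have hGc : Continuous G := by fun_prop
  have hGnonneg : 0 ≤ ∫ s in t₁..t₂, G s := by
    set ε : ℕ → ℝ := fun n => 1 / ((n : ℝ) + 1) with hε
    have hεpos : ∀ n, 0 < ε n := fun n => by positivity
    have hεle : ∀ n, ε n ≤ 1 := fun n => by
      simp only [hε]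
      rw [div_le_one (by positivity)]
      linarith [(Nat.cast_nonneg n : (0 : ℝ) ≤ n)]
    have hεlim : Tendsto ε atTop (𝓝 0) := tendsto_one_div_add_atTop_nhds_zero_nat
    have hRc : Continuous R := continuous_iff_continuousAt.2 fun x => (hRd x).continuousAt
    have hρc : Continuous ρ := hρsm.continuous
    refine ge_of_tendsto' (intervalIntegral.tendsto_integral_filter_of_dominated_convergence
      (l := atTop) (F := fun n s => (-(1 / 2) * (ε n * R (w s / ε n)) * w₂ s
      + 1 / 2 * (s + 6 * y s ^ 2) * (ε n * ρ (w s / ε n)) ^ 2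
      + 2 * y s * (ε n * ρ (w s / ε n)) ^ 3 + 1 / 2 * (ε n * ρ (w s / ε n)) ^ 4))
      (fun s => 1 / 2 * (|w s| + 2) * |w₂ s| + 1 / 2 * |s + 6 * y s ^ 2| * (|w s| + 2) ^ 2
        + 2 * |y s| * (|w s| + 2) ^ 3 + 1 / 2 * (|w s| + 2) ^ 4) ?_ ?_ ?_ ?_)
      (fun n => key (ε n) (hεpos n))
    · exact Eventually.of_forall fun n => Continuous.aestronglyMeasurable (by fun_prop)
    · refine Eventually.of_forall fun n => Eventually.of_forall fun s _ => ?_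
      have b1 := abs_scaled_integral_le hχc hχ0 hχ1 hχb (hεpos n) (hεle n) (w s)
      have b2 := abs_scaled_integral_le hχ2c hχ20 hχ21 hχ2b (hεpos n) (hεle n) (w s)
      change |ε n * ρ (w s / ε n)| ≤ _ at b1
      change |ε n * R (w s / ε n)| ≤ _ at b2
      rw [Real.norm_eq_abs]
      refine (abs_add_le _ _).trans (add_le_add ((abs_add_le _ _).trans (add_le_add
        ((abs_add_le _ _).trans (add_le_add ?_ ?_)) ?_)) ?_)
      · rw [abs_mul, abs_mul, abs_neg, abs_of_pos (by norm_num : (0 : ℝ) < 1 / 2)]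
        gcongr
      · rw [abs_mul, abs_mul, abs_of_pos (by norm_num : (0 : ℝ) < 1 / 2), abs_pow]
        gcongr
      · rw [abs_mul, abs_mul, abs_pow, abs_two]
        gcongr
      · rw [abs_mul, abs_pow, abs_of_pos (by norm_num : (0 : ℝ) < 1 / 2)]
        gcongr
    · exact Continuous.intervalIntegrable (by fun_prop) _ _
    · refine Eventually.of_forall fun s _ => ?_
      have l1 := tendsto_scaled_integral hχc hχ0 hχ1 hχb hεpos hεlim (w s)
      have l2 := tendsto_scaled_integral hχ2c hχ20 hχ21 hχ2b hεpos hεlim (w s)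
      exact (((l2.const_mul _).mul_const _).add ((l1.pow 2).const_mul _)).add
        ((l1.pow 3).const_mul _) |>.add ((l1.pow 4).const_mul _)
  have hGneg : ∀ s ∈ Ioo t₁ t₂, 0 < w s → G s < 0 := by
    intro s hs hpos
    obtain ⟨c1, c2⟩ := hsub s hs (by simp only [hw] at hpos; linarith)
    -- Substituting `B = y + w` isolates the subsolution defect; the cubic and quartic remainder is
    -- `w² (B + y)`, whence the sign condition on `B + y`.
    have e : G s = 1 / 2 * w s * ((s * B s + 2 * B s ^ 3 + α - deriv (deriv B) s)
        - w s ^ 2 * (B s + y s)) := by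
      simp only [hG, max_eq_left hpos.le]
      simp only [hw, hw₂]
      ring
    rw [e]
    have : 0 ≤ w s ^ 2 * (B s + y s) := by positivity
    nlinarith
  have hGnp : ∀ s ∈ Icc t₁ t₂, G s ≤ 0 := by
    intro s hs
    by_cases hp : 0 < w s
    · refine (hGneg s ⟨lt_of_le_of_ne hs.1 ?_, lt_of_le_of_ne hs.2 ?_⟩ hp).le
      · rintro rfl; simp only [hw] at hp; linarith
      · rintro rfl; simp only [hw] at hp; linarith
    · simp [hG, max_eq_right (not_lt.1 hp)]
  have := intervalIntegral.integral_lt_integral_of_continuousOn_of_le_of_exists_lt ht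
    hGc.continuousOn (continuousOn_const (c := (0 : ℝ)))
    (fun s hs => hGnp s (Ioc_subset_Icc_self hs))
    ⟨s₀, hs₀, hGneg s₀ hs₀' (by simp only [hw]; linarith)⟩
  simp only [intervalIntegral.integral_zero] at this
  linarith

/-- Nonnegative minimal solutions are bounded below by a bump of the equilibrium height. -/
theorem IsMinimalSolution.le_of_window (h : IsMinimalSolution α y) {s₁ A : ℝ} (hA0 : 0 < A)
    (hα : α < 4 * A) (hA : 2 * A ^ 2 + s₁ + 10 ≤ 0)
    (hpos : ∀ s ∈ Icc (s₁ - 1) (s₁ + 1), 0 ≤ y s) : A ≤ y s₁ := by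
  -- A bump of height `A` vanishing at the ends of the window. Since `2 B² + s ≤ 2 A² + s₁ + 1 ≤
  -- -9`, the zeroth-order term is at most `-9 B`.
  set B : ℝ → ℝ := fun s => A * (1 - (s - s₁) ^ 2) ^ 2 with hB
  have hBsm : ContDiff ℝ ∞ B := by fun_prop
  have hq : ∀ s, HasDerivAt (fun s : ℝ => 1 - (s - s₁) ^ 2) (-(2 * (s - s₁))) s := fun s =>
    ((((hasDerivAt_id s).sub_const s₁).pow 2).const_sub 1).congr_deriv (by simp)
  have hd1 : deriv B = fun s => A * (2 * (1 - (s - s₁) ^ 2) * (-(2 * (s - s₁)))) := by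
    funext s
    exact (((hq s).pow 2).const_mul A |>.congr_deriv (by simp)).deriv
  have hd2 : ∀ s, deriv (deriv B) s = A * (12 * (s - s₁) ^ 2 - 4) := by
    intro s
    rw [hd1]
    have h4 : HasDerivAt (fun s : ℝ => -(2 * (s - s₁))) (-(2 * 1)) s :=
      (((hasDerivAt_id s).sub_const s₁).const_mul 2).neg
    refine ((((hq s).const_mul 2).mul h4).const_mul A |>.congr_deriv ?_).deriv
    ring
  have key := h.le_of_subsolution hBsm (t₁ := s₁ - 1) (t₂ := s₁ + 1)
    (by simpa [hB] using hpos (s₁ - 1) (by constructor <;> linarith))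
    (by simpa [hB] using hpos (s₁ + 1) (by constructor <;> linarith))
    (fun s hs _ => by
      have hys := hpos s (Ioo_subset_Icc_self hs)
      rw [hd2]
      set d := 1 - (s - s₁) ^ 2 with hd
      have hd0 : 0 < d := by nlinarith [hs.1, hs.2]
      have hd1 : d ≤ 1 := by nlinarith [sq_nonneg (s - s₁)]
      have e : B s = A * d ^ 2 := rfl
      have hd2 : d ^ 2 ≤ 1 := by nlinarith
      have hB0 : 0 ≤ B s := by rw [e]; positivity
      have hBA : B s ≤ A := by rw [e]; nlinarith
      refine ⟨?_, by linarith⟩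
      have h1 : s * B s + 2 * B s ^ 3 ≤ -9 * B s := by
        have : s + 2 * B s ^ 2 ≤ -9 := by nlinarith [hs.2]
        nlinarith
      have h2 : (s - s₁) ^ 2 = 1 - d := by rw [hd]; ring
      rw [h2]
      rw [e] at h1 ⊢
      -- What remains is `α < A (9 d² - 12 d + 8) = A ((3 d - 2)² + 4)`, which is where `α < 4 A`
      -- enters.
      nlinarith [mul_nonneg hA0.le (sq_nonneg (3 * d - 2))])
    s₁ (by constructor <;> linarith)
  simpa [hB] using key

/-- `A² = (-s - 10)/2` is the largest height the bump allows; the threshold on `s` makes `A`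
positive and `α < 4 A`. No sign of `α` is needed, so the bound also serves `-y`. -/
theorem IsMinimalSolution.sq_ge (h : IsMinimalSolution α y) {s : ℝ} (hs : s + 12 + α ^ 2 ≤ 0)
    (hpos : ∀ t ∈ Icc (s - 1) (s + 1), 0 ≤ y t) :
    0 < y s ∧ (-s - 10) / 2 ≤ y s ^ 2 := by
  set A := √((-s - 10) / 2) with hA
  have hα := sq_nonneg α
  have e : A ^ 2 = (-s - 10) / 2 := Real.sq_sqrt (by linarith)
  have hA0 : 0 < A := Real.sqrt_pos.2 (by linarith)
  have h1 : α < 4 * A := by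
    by_contra! hc
    nlinarith
  have := h.le_of_window (s₁ := s) hA0 h1 (by linarith) hpos
  refine ⟨by linarith, ?_⟩
  rw [← e]
  gcongr

end PainleveII

/-! ### Existence of a positive solution by monotone iteration. -/

namespace PainleveII

open Set Topology MeasureTheory

theorem continuous_integral_Ioi {g : ℝ → ℝ} (hi : ∀ s, IntegrableOn g (Ioi s)) :
    Continuous fun s => ∫ t in Ioi s, g t := by
  have hii : ∀ a b, IntervalIntegrable g volume a b := fun a b =>
    intervalIntegrable_iff.2 ((hi (min a b)).mono_set Ioc_subset_Ioi_self)
  have e : (fun s => ∫ t in Ioi s, g t) = fun s => (∫ t in Ioi 0, g t) - ∫ t in (0 : ℝ)..s, g t := by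
    funext s
    rw [← intervalIntegral.integral_Ioi_sub_Ioi' (hi 0) (hi s)]
    ring
  rw [e]
  exact continuous_const.sub (intervalIntegral.continuous_primitive hii 0)

theorem hasDerivAt_integral_Ioi {g : ℝ → ℝ} (hg : Continuous g) (hi : ∀ s, IntegrableOn g (Ioi s))
    (s : ℝ) : HasDerivAt (fun s => ∫ t in Ioi s, g t) (-g s) s := by
  have e : (fun s => ∫ t in Ioi s, g t) = fun s => (∫ t in Ioi 0, g t) - ∫ t in (0 : ℝ)..s, g t := by
    funext s
    rw [← intervalIntegral.integral_Ioi_sub_Ioi' (hi 0) (hi s)]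
    ring
  rw [e]
  exact (hg.integral_hasStrictDerivAt 0 s).hasDerivAt.const_sub _

/-- The rate `R (1 + s²)` used to factorise `w'' - (p² + p') w = (D + p) (D - p) w`. -/
def rate (R s : ℝ) : ℝ := R * (1 + s ^ 2)

/-- A primitive of `rate`. -/
noncomputable def rateInt (R s : ℝ) : ℝ := R * (s + s ^ 3 / 3)

theorem rate_neg (R s : ℝ) : rate R (-s) = rate R s := by simp [rate]

theorem hasDerivAt_rateInt (R s : ℝ) : HasDerivAt (rateInt R) (rate R s) s :=
  (((hasDerivAt_id s).add ((hasDerivAt_pow 3 s).div_const 3)).const_mul R).congr_deriv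
    (by simp only [rate]; ring)

theorem hasDerivAt_rate (R s : ℝ) : HasDerivAt (rate R) (R * (2 * s)) s :=
  (((hasDerivAt_pow 2 s).const_add 1).const_mul R).congr_deriv (by simp)

theorem continuous_rateInt (R : ℝ) : Continuous (rateInt R) := by unfold rateInt; fun_prop

theorem continuous_rate (R : ℝ) : Continuous (rate R) := by unfold rate; fun_prop

/-- The bounded inverse of `p - D`. -/
noncomputable def invRight (R : ℝ) (v : ℝ → ℝ) (s : ℝ) : ℝ :=
  Real.exp (rateInt R s) * ∫ t in Ioi s, Real.exp (-rateInt R t) * v t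

/-- The bounded inverse of `p + D`. -/
noncomputable def invLeft (R : ℝ) (f : ℝ → ℝ) (s : ℝ) : ℝ := invRight R (fun t => f (-t)) (-s)

/-- Weighted integrability near `+∞`. -/
def WeightIntegrable (R : ℝ) (v : ℝ → ℝ) : Prop :=
  ∀ s, IntegrableOn (fun t => Real.exp (-rateInt R t) * v t) (Ioi s)

variable {R : ℝ}

theorem WeightIntegrable.mono {v V : ℝ → ℝ} (hV : WeightIntegrable R V) (hv : Measurable v)
    (h0 : ∀ t, 0 ≤ v t) (hle : ∀ t, v t ≤ V t) : WeightIntegrable R v := by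
  intro s
  have hm : Measurable fun t => Real.exp (-rateInt R t) :=
    (Real.continuous_exp.comp (continuous_rateInt R).neg).measurable
  refine Integrable.mono' (hV s) (hm.mul hv).aestronglyMeasurable (Eventually.of_forall fun t => ?_)
  have := Real.exp_pos (-rateInt R t)
  rw [Real.norm_of_nonneg (mul_nonneg this.le (h0 t))]
  exact mul_le_mul_of_nonneg_left (hle t) this.le

theorem WeightIntegrable.continuous_invRight {v : ℝ → ℝ} (hv : WeightIntegrable R v) :
    Continuous (invRight R v) :=
  (Real.continuous_exp.comp (continuous_rateInt R)).mul (continuous_integral_Ioi hv)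

theorem WeightIntegrable.hasDerivAt_invRight {v : ℝ → ℝ} (hv : WeightIntegrable R v)
    (hc : Continuous v) (s : ℝ) :
    HasDerivAt (invRight R v) (rate R s * invRight R v s - v s) s := by
  have hP := continuous_rateInt R
  have h1 := (hasDerivAt_rateInt R s).exp.mul (hasDerivAt_integral_Ioi (by fun_prop) hv s)
  refine h1.congr_deriv ?_
  have : Real.exp (rateInt R s) * Real.exp (-rateInt R s) = 1 := by rw [← Real.exp_add]; simp
  simp only [invRight]
  linear_combination (-v s) * this

theorem invRight_mono {v V : ℝ → ℝ} (hv : WeightIntegrable R v) (hV : WeightIntegrable R V)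
    (hle : ∀ t, v t ≤ V t) (s : ℝ) : invRight R v s ≤ invRight R V s :=
  mul_le_mul_of_nonneg_left (integral_mono (hv s) (hV s)
    fun t => mul_le_mul_of_nonneg_left (hle t) (Real.exp_pos _).le) (Real.exp_pos _).le

theorem tendsto_invRight {v : ℕ → ℝ → ℝ} {u V : ℝ → ℝ} (hV : WeightIntegrable R V)
    (hm : ∀ n, Measurable (v n)) (h0 : ∀ n t, 0 ≤ v n t) (hle : ∀ n t, v n t ≤ V t)
    (hlim : ∀ t, Tendsto (fun n => v n t) atTop (𝓝 (u t))) (s : ℝ) :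
    Tendsto (fun n => invRight R (v n) s) atTop (𝓝 (invRight R u s)) := by
  refine Tendsto.const_mul _ ?_
  have hw : Measurable fun t => Real.exp (-rateInt R t) :=
    (Real.continuous_exp.comp (continuous_rateInt R).neg).measurable
  refine tendsto_integral_of_dominated_convergence _
    (fun n => (hw.mul (hm n)).aestronglyMeasurable) (hV s) (fun n => ?_) ?_
  · refine Eventually.of_forall fun t => ?_
    have := Real.exp_pos (-rateInt R t)
    rw [Real.norm_of_nonneg (mul_nonneg this.le (h0 n t))]
    exact mul_le_mul_of_nonneg_left (hle n t) this.le
  · exact Eventually.of_forall fun t => (hlim t).const_mul _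

/-- The weight turns `p W - W'` into an exact derivative. Nonnegativity makes integrability a
consequence of the limit at infinity, so explicit barriers provide integrable majorants. -/
theorem invRight_eq {W W' : ℝ → ℝ} (hd : ∀ s, HasDerivAt W (W' s) s)
    (hnn : ∀ s, 0 ≤ rate R s * W s - W' s)
    (hlim : Tendsto (fun s => Real.exp (-rateInt R s) * W s) atTop (𝓝 0)) :
    WeightIntegrable R (fun s => rate R s * W s - W' s) ∧
      ∀ s, invRight R (fun s => rate R s * W s - W' s) s = W s := by
  have hd' : ∀ s, HasDerivAt (fun s => -(Real.exp (-rateInt R s) * W s))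
      (Real.exp (-rateInt R s) * (rate R s * W s - W' s)) s := fun s =>
    ((hasDerivAt_rateInt R s).neg.exp.mul (hd s)).neg.congr_deriv (by simp only [Pi.neg_apply]; ring)
  have hnn' : ∀ s, 0 ≤ Real.exp (-rateInt R s) * (rate R s * W s - W' s) := fun s =>
    mul_nonneg (Real.exp_pos _).le (hnn s)
  have hlim' : Tendsto (fun s => -(Real.exp (-rateInt R s) * W s)) atTop (𝓝 0) := by
    simpa using hlim.neg
  refine ⟨fun s => integrableOn_Ioi_deriv_of_nonneg' (fun x _ => hd' x) (fun x _ => hnn' x) hlim',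
    fun s => ?_⟩
  unfold invRight
  rw [integral_Ioi_of_hasDerivAt_of_nonneg' (fun x _ => hd' x) (fun x _ => hnn' x) hlim']
  have : Real.exp (rateInt R s) * Real.exp (-rateInt R s) = 1 := by rw [← Real.exp_add]; simp
  linear_combination W s * this

theorem tendsto_exp_neg_rateInt_mul (hR : 1 ≤ R) {v : ℝ → ℝ} {c : ℝ}
    (hv : ∀ t, |v t| ≤ c * (1 + t ^ 2) ^ 2) :
    Tendsto (fun s => Real.exp (-rateInt R s) * v s) atTop (𝓝 0) := by
  have h : Tendsto (fun t : ℝ => c * (t ^ 0 * Real.exp (-t) + 2 * (t ^ 2 * Real.exp (-t))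
      + t ^ 4 * Real.exp (-t))) atTop (𝓝 (c * (0 + 2 * 0 + 0))) :=
    (((Real.tendsto_pow_mul_exp_neg_atTop_nhds_zero 0).add
      ((Real.tendsto_pow_mul_exp_neg_atTop_nhds_zero 2).const_mul 2)).add
      (Real.tendsto_pow_mul_exp_neg_atTop_nhds_zero 4)).const_mul c
  simp only [mul_zero, add_zero] at h
  refine squeeze_zero_norm' ?_ h
  filter_upwards [eventually_ge_atTop 0] with t ht
  rw [norm_mul, Real.norm_of_nonneg (Real.exp_pos _).le, Real.norm_eq_abs]
  have h1 : Real.exp (-rateInt R t) ≤ Real.exp (-t) := by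
    apply Real.exp_le_exp.2
    have : 0 ≤ t ^ 3 / 3 := by positivity
    simp only [rateInt]
    nlinarith
  calc Real.exp (-rateInt R t) * |v t| ≤ Real.exp (-t) * (c * (1 + t ^ 2) ^ 2) := by
        gcongr
        exact hv t
    _ = _ := by ring

/-- Functions with controlled growth are recovered from `K W - W''`. -/
theorem invRight_invLeft_eq (hR : 1 ≤ R) {W W' W'' : ℝ → ℝ} {c c' : ℝ}
    (hd : ∀ s, HasDerivAt W (W' s) s) (hd' : ∀ s, HasDerivAt W' (W'' s) s)
    (hnn : ∀ s, 0 ≤ rate R s * W s - W' s)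
    (hnn' : ∀ s, 0 ≤ (rate R s ^ 2 + R * (2 * s)) * W s - W'' s)
    (hb : ∀ t, |W t| ≤ c * (1 + t ^ 2) ^ 2)
    (hb' : ∀ t, |rate R t * W t - W' t| ≤ c' * (1 + t ^ 2) ^ 2) :
    WeightIntegrable R (fun s => rate R s * W s - W' s) ∧
    WeightIntegrable R (fun s => (rate R (-s) ^ 2 + R * (2 * -s)) * W (-s) - W'' (-s)) ∧
    (∀ s, invLeft R (fun s => (rate R s ^ 2 + R * (2 * s)) * W s - W'' s) s
      = rate R s * W s - W' s) ∧
    ∀ s, invRight R (fun s => rate R s * W s - W' s) s = W s := by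
  obtain ⟨h1, h2⟩ := invRight_eq hd hnn (tendsto_exp_neg_rateInt_mul hR hb)
  have hdl : ∀ s, HasDerivAt (fun s => rate R (-s) * W (-s) - W' (-s))
      (-(R * (2 * -s) * W (-s) + rate R (-s) * W' (-s) - W'' (-s))) s := fun s => by
    have := (((hasDerivAt_rate R (-s)).mul (hd (-s))).sub (hd' (-s))).comp s (hasDerivAt_neg s)
    exact this.congr_deriv (by ring)
  have e : (fun s => rate R s * (rate R (-s) * W (-s) - W' (-s))
      - -(R * (2 * -s) * W (-s) + rate R (-s) * W' (-s) - W'' (-s)))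
      = fun s => (rate R (-s) ^ 2 + R * (2 * -s)) * W (-s) - W'' (-s) := by
    funext s; rw [rate_neg]; ring
  obtain ⟨h3, h4⟩ := invRight_eq (R := R) hdl
    (fun s => by
      have := congrFun e s
      exact this ▸ hnn' (-s))
    (tendsto_exp_neg_rateInt_mul hR (c := c') fun t => by simpa using hb' (-t))
  rw [e] at h3 h4
  refine ⟨h1, h3, fun s => ?_, h2⟩
  unfold invLeft
  rw [h4]
  simp

/-- Monotone iteration: existence of a positive solution between the subsolution
`exp (-(s + 2)² / 2) / 2` and the supersolution `(2 - α) (1 + s²)`. -/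
theorem exists_pos_isSolution {α : ℝ} (hα : α ≤ 0) :
    ∃ y : ℝ → ℝ, IsSolution α y ∧ ∀ s, 0 < y s := by
  set C := 2 - α with hC
  have hC2 : 2 ≤ C := by linarith
  -- With this rate `K = p² + p'` is at least `30 C² (1 + s²)²`, which exceeds `s + 6 Z²`, a bound
  -- for the slope of the nonlinearity between `0` and `Z`.
  set R := 6 * C with hR
  have hR1 : 1 ≤ R := by linarith
  set Z : ℝ → ℝ := fun s => C * (1 + s ^ 2) with hZ
  set Z' : ℝ → ℝ := fun s => C * (2 * s) with hZ'
  set Z'' : ℝ → ℝ := fun _ => C * (2 * 1) with hZ''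
  set φ : ℝ → ℝ := fun s => Real.exp (-((s + 2) ^ 2 / 2)) / 2 with hφ
  set φ' : ℝ → ℝ := fun s => -(s + 2) * φ s with hφ'
  set φ'' : ℝ → ℝ := fun s => ((s + 2) ^ 2 - 1) * φ s with hφ''
  have hZd : ∀ s, HasDerivAt Z (Z' s) s := fun s =>
    (((hasDerivAt_pow 2 s).const_add 1).const_mul C).congr_deriv (by simp [hZ'])
  have hZd' : ∀ s, HasDerivAt Z' (Z'' s) s := fun s =>
    ((hasDerivAt_id s).const_mul 2).const_mul C
  have hφd : ∀ s, HasDerivAt φ (φ' s) s := fun s => by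
    have h1 : HasDerivAt (fun s : ℝ => -((s + 2) ^ 2 / 2)) (-(s + 2)) s :=
      (((((hasDerivAt_id s).add_const 2).pow 2).div_const 2).neg).congr_deriv (by simp)
    exact (h1.exp.div_const 2).congr_deriv (by simp only [hφ', hφ]; ring)
  have hφd' : ∀ s, HasDerivAt φ' (φ'' s) s := fun s =>
    ((((hasDerivAt_id s).add_const 2).neg).mul (hφd s)).congr_deriv
      (by simp only [hφ'', hφ', Pi.neg_apply, id]; ring)
  have hφ0 : ∀ s, 0 < φ s := fun s => by positivity
  have hφ1 : ∀ s, φ s ≤ 1 / 2 := fun s => by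
    have : Real.exp (-((s + 2) ^ 2 / 2)) ≤ 1 := by
      apply Real.exp_le_one_iff.2
      have := sq_nonneg (s + 2)
      linarith
    simp only [hφ]; linarith
  have hX : ∀ s : ℝ, 2 * |s| ≤ 1 + s ^ 2 ∧ 1 ≤ 1 + s ^ 2 := fun s => by
    rw [← sq_abs s]
    constructor <;> nlinarith [sq_nonneg (|s| - 1), sq_nonneg |s|]
  have hφZ : ∀ s, φ s ≤ Z s := fun s => by
    have := hφ1 s
    have := (hX s).2
    simp only [hZ]; nlinarith
  set K : ℝ → ℝ := fun s => rate R s ^ 2 + R * (2 * s) with hKdef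
  have hK : ∀ s, (30 * C ^ 2) * (1 + s ^ 2) ^ 2 ≤ K s := fun s => by
    have h1 := hX s
    have h2 := neg_abs_le s
    simp only [hKdef, rate, hR]
    set X := 1 + s ^ 2
    have h3 : 6 * C * (2 * s) ≥ -(6 * C * X) := by nlinarith
    have h4 : 6 * C * X ≤ C ^ 2 * X ^ 2 * 3 := by
      have : X ≤ X ^ 2 := by nlinarith
      nlinarith [mul_nonneg (by linarith : 0 ≤ C) (sq_nonneg X)]
    nlinarith [sq_nonneg (C * X)]
  have hK1 : ∀ s, 120 * (1 + s ^ 2) ^ 2 ≤ K s := fun s => by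
    refine le_trans ?_ (hK s)
    have : 4 ≤ C ^ 2 := by nlinarith
    nlinarith [sq_nonneg (1 + s ^ 2)]
  have hvφ : ∀ s, 0 ≤ rate R s * φ s - φ' s := fun s => by
    have e : rate R s * φ s - φ' s = (6 * C * (1 + s ^ 2) + (s + 2)) * φ s := by
      simp only [rate, hφ', hR]; ring
    rw [e]
    have := neg_abs_le s
    have := hX s
    apply mul_nonneg _ (hφ0 s).le
    nlinarith
  have hFφ : ∀ s, 0 ≤ K s * φ s - φ'' s := fun s => by
    have e : K s * φ s - φ'' s = (K s - ((s + 2) ^ 2 - 1)) * φ s := by simp only [hφ'']; ring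
    rw [e]
    have := hK1 s
    apply mul_nonneg _ (hφ0 s).le
    nlinarith [sq_nonneg s, sq_nonneg (s - 2), sq_nonneg (s ^ 2)]
  have hvZ : ∀ s, 0 ≤ rate R s * Z s - Z' s := fun s => by
    have e : rate R s * Z s - Z' s = C * (6 * C * (1 + s ^ 2) ^ 2 - 2 * s) := by
      simp only [rate, hZ, hZ', hR]; ring
    rw [e]
    have := le_abs_self s
    have := hX s
    apply mul_nonneg (by linarith)
    nlinarith [sq_nonneg (s ^ 2)]
  have hFZ : ∀ s, 0 ≤ K s * Z s - Z'' s := fun s => by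
    have e : K s * Z s - Z'' s = C * (K s * (1 + s ^ 2) - 2) := by simp only [hZ, hZ'']; ring
    rw [e]
    have h1 := hK1 s
    have h2 := (hX s).2
    apply mul_nonneg (by linarith)
    have : 120 ≤ K s := by nlinarith
    nlinarith
  obtain ⟨iφ1, iφ2, eφ1, eφ2⟩ := invRight_invLeft_eq hR1 (c := 1) (c' := 6 * C + 3) hφd hφd' hvφ hFφ
    (fun t => by
      rw [abs_of_pos (hφ0 t)]
      nlinarith [hφ1 t, sq_nonneg t, sq_nonneg (t ^ 2)])
    (fun t => by
      rw [abs_of_nonneg (hvφ t)]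
      have e : rate R t * φ t - φ' t = (6 * C * (1 + t ^ 2) + (t + 2)) * φ t := by
        simp only [rate, hφ', hR]; ring
      rw [e]
      have h1 := le_abs_self t
      have h2 := hX t
      have h3 := neg_abs_le t
      have h4 : (6 * C * (1 + t ^ 2) + (t + 2)) * φ t ≤ (6 * C * (1 + t ^ 2) + (t + 2)) * 1 := by
        apply mul_le_mul_of_nonneg_left _ (by nlinarith)
        linarith [hφ1 t]
      have h5 : (1 + t ^ 2) ≤ (1 + t ^ 2) ^ 2 := by nlinarith
      nlinarith)
  obtain ⟨iZ1, iZ2, eZ1, eZ2⟩ := invRight_invLeft_eq hR1 (c := C) (c' := 6 * C ^ 2 + C) hZd hZd' hvZ hFZ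
    (fun t => by
      have h2 := (hX t).2
      have e : Z t = C * (1 + t ^ 2) := rfl
      rw [abs_of_nonneg (by rw [e]; positivity), e]
      have h5 : (1 + t ^ 2) ≤ (1 + t ^ 2) ^ 2 := by nlinarith
      nlinarith)
    (fun t => by
      rw [abs_of_nonneg (hvZ t)]
      have e : rate R t * Z t - Z' t = C * (6 * C * (1 + t ^ 2) ^ 2 - 2 * t) := by
        simp only [rate, hZ, hZ', hR]; ring
      rw [e]
      have h1 := neg_abs_le t
      have h2 := hX t
      have h5 : (1 + t ^ 2) ≤ (1 + t ^ 2) ^ 2 := by nlinarith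
      have h6 : -(2 * t) ≤ (1 + t ^ 2) ^ 2 := by linarith
      nlinarith)
  -- The equation becomes `(p + D)(p - D) y = K y - y'' = G (s, y)`, with `G` increasing in `u` on
  -- `[0, Z]`.
  set G : ℝ → ℝ → ℝ := fun s u => K s * u - (s * u + 2 * u ^ 3 + α) with hG
  have hKc : Continuous K := by
    have := continuous_rate R
    fun_prop
  have hGmono : ∀ s u v, 0 ≤ u → u ≤ v → v ≤ Z s → G s u ≤ G s v := fun s u v hu huv hv => by
    have e : G s v - G s u = (v - u) * (K s - s - 2 * (u ^ 2 + u * v + v ^ 2)) := by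
      simp only [hG]; ring
    have h1 : u ^ 2 + u * v + v ^ 2 ≤ 3 * Z s ^ 2 := by nlinarith
    have h2 : Z s ^ 2 = C ^ 2 * (1 + s ^ 2) ^ 2 := by simp only [hZ]; ring
    have h3 := hK s
    have h4 := le_abs_self s
    have h5 := hX s
    have h6 : s ≤ C ^ 2 * (1 + s ^ 2) ^ 2 := by
      have : 1 ≤ C ^ 2 := by nlinarith
      nlinarith
    have h7 : 0 ≤ C ^ 2 * (1 + s ^ 2) ^ 2 := by positivity
    have : 0 ≤ G s v - G s u := by
      rw [e]
      apply mul_nonneg (by linarith)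
      linarith
    linarith
  have hGφ : ∀ s, K s * φ s - φ'' s ≤ G s (φ s) := fun s => by
    have h1 := hφ0 s
    have h2 := hφ1 s
    have : s * φ s + 2 * φ s ^ 3 ≤ φ'' s := by
      -- Subsolution property: `s² + 3 s + 3 ≥ 3/4`, while `2 φ² ≤ 1/2`.
      have e : φ'' s - (s * φ s + 2 * φ s ^ 3) = (s ^ 2 + 3 * s + 3 - 2 * φ s ^ 2) * φ s := by
        simp only [hφ'']; ring
      have : 0 ≤ (s ^ 2 + 3 * s + 3 - 2 * φ s ^ 2) * φ s := by
        apply mul_nonneg _ h1.le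
        nlinarith [sq_nonneg (2 * s + 3)]
      linarith
    simp only [hG]
    linarith
  have hGZ : ∀ s, G s (Z s) ≤ K s * Z s - Z'' s := fun s => by
    have h1 := neg_abs_le s
    have h2 := hX s
    have : Z'' s ≤ s * Z s + 2 * Z s ^ 3 + α := by
      simp only [hZ, hZ'']
      set X := 1 + s ^ 2
      have h3 : s * (C * X) ≥ -(C * X ^ 2) := by
        have : 0 ≤ C * X := by nlinarith
        nlinarith
      have h4 : C * X ^ 2 ≤ C * X ^ 3 := by
        have : X ^ 2 ≤ X ^ 3 := pow_le_pow_right₀ h2.2 (by norm_num)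
        nlinarith
      have h5 : 1 ≤ X ^ 3 := one_le_pow₀ h2.2
      have h6 : 8 * (C * X ^ 3) ≤ 2 * (C * X) ^ 3 := by
        have : 4 * C ≤ C ^ 3 := by nlinarith [sq_nonneg (C - 2), sq_nonneg C]
        have : 4 * C * X ^ 3 ≤ C ^ 3 * X ^ 3 := mul_le_mul_of_nonneg_right this (by linarith)
        nlinarith
      have h7 : C ≤ C * X ^ 3 := by nlinarith
      linarith
    simp only [hG]
    linarith
  -- Both inverses have positive kernels, so `T` is monotone between the barriers and maps the
  -- interval `[φ, Z]` to itself.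
  set T : (ℝ → ℝ) → ℝ → ℝ := fun u => invRight R (invLeft R fun s => G s (u s)) with hT
  have hmeas : ∀ u : ℝ → ℝ, Measurable u → Measurable fun s => G s (u s) := fun u hu => by
    have := hKc.measurable
    simp only [hG]
    fun_prop
  have hbd : ∀ u : ℝ → ℝ, (∀ s, φ s ≤ u s ∧ u s ≤ Z s) → ∀ s, 0 ≤ G s (u s) ∧
      K s * φ s - φ'' s ≤ G s (u s) ∧ G s (u s) ≤ K s * Z s - Z'' s := fun u hu s => by
    have h1 := (hGφ s).trans (hGmono s _ _ (hφ0 s).le (hu s).1 (hu s).2)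
    refine ⟨(hFφ s).trans h1, h1, ?_⟩
    exact (hGmono s _ _ ((hφ0 s).le.trans (hu s).1) (hu s).2 le_rfl).trans (hGZ s)
  have hWf : ∀ u : ℝ → ℝ, Measurable u → (∀ s, φ s ≤ u s ∧ u s ≤ Z s) →
      WeightIntegrable R fun s => G (-s) (u (-s)) := fun u hum hu =>
    iZ2.mono ((hmeas u hum).comp measurable_neg) (fun t => (hbd u hu (-t)).1)
      fun t => (hbd u hu (-t)).2.2
  have hLc : ∀ u : ℝ → ℝ, Measurable u → (∀ s, φ s ≤ u s ∧ u s ≤ Z s) →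
      Continuous (invLeft R fun s => G s (u s)) := fun u hum hu =>
    (hWf u hum hu).continuous_invRight.comp continuous_neg
  have hLb : ∀ u : ℝ → ℝ, Measurable u → (∀ s, φ s ≤ u s ∧ u s ≤ Z s) → ∀ s,
      rate R s * φ s - φ' s ≤ invLeft R (fun s => G s (u s)) s ∧
      invLeft R (fun s => G s (u s)) s ≤ rate R s * Z s - Z' s := fun u hum hu s => by
    rw [← eφ1, ← eZ1]
    exact ⟨invRight_mono iφ2 (hWf u hum hu) (fun t => (hbd u hu (-t)).2.1) (-s),
      invRight_mono (hWf u hum hu) iZ2 (fun t => (hbd u hu (-t)).2.2) (-s)⟩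
  have hWL : ∀ u : ℝ → ℝ, Measurable u → (∀ s, φ s ≤ u s ∧ u s ≤ Z s) →
      WeightIntegrable R (invLeft R fun s => G s (u s)) := fun u hum hu =>
    iZ1.mono (hLc u hum hu).measurable (fun t => (hvφ t).trans (hLb u hum hu t).1)
      fun t => (hLb u hum hu t).2
  have hTb : ∀ u : ℝ → ℝ, Measurable u → (∀ s, φ s ≤ u s ∧ u s ≤ Z s) →
      ∀ s, φ s ≤ T u s ∧ T u s ≤ Z s := fun u hum hu s => by
    conv_lhs => rw [← eφ2 s]
    conv_rhs => rw [← eZ2 s]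
    exact ⟨invRight_mono iφ1 (hWL u hum hu) (fun t => (hLb u hum hu t).1) s,
      invRight_mono (hWL u hum hu) iZ1 (fun t => (hLb u hum hu t).2) s⟩
  have hTm : ∀ u v : ℝ → ℝ, Measurable u → Measurable v → (∀ s, φ s ≤ u s ∧ u s ≤ Z s) →
      (∀ s, φ s ≤ v s ∧ v s ≤ Z s) → (∀ s, u s ≤ v s) → ∀ s, T u s ≤ T v s :=
    fun u v hum hvm hu hv huv s =>
      invRight_mono (hWL u hum hu) (hWL v hvm hv) (fun t => invRight_mono (hWf u hum hu)
        (hWf v hvm hv) (fun r => hGmono _ _ _ ((hφ0 (-r)).le.trans (hu (-r)).1) (huv (-r))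
          (hv (-r)).2) (-t)) s
  set U : ℕ → ℝ → ℝ := fun n => T^[n] Z with hU
  have hUs : ∀ n, U (n + 1) = T (U n) := fun n => Function.iterate_succ_apply' T n Z
  have hZm : Measurable Z := Continuous.measurable (by fun_prop)
  have hUb : ∀ n, Measurable (U n) ∧ ∀ s, φ s ≤ U n s ∧ U n s ≤ Z s := fun n => by
    induction n with
    | zero => exact ⟨hZm, fun s => ⟨hφZ s, le_rfl⟩⟩
    | succ n ih =>
      rw [hUs]
      exact ⟨(hWL _ ih.1 ih.2).continuous_invRight.measurable, hTb _ ih.1 ih.2⟩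
  -- Starting from the supersolution, the iterates decrease; being bounded below by `φ`, they
  -- converge pointwise.
  have hUd : ∀ n s, U (n + 1) s ≤ U n s := fun n => by
    induction n with
    | zero => exact fun s => ((hUb 1).2 s).2
    | succ n ih =>
      rw [hUs (n + 1)]
      conv => intro s; rhs; rw [hUs n]
      exact hTm _ _ (hUb _).1 (hUb _).1 (hUb _).2 (hUb _).2 ih
  have hlim : ∀ s, ∃ l, Tendsto (fun n => U n s) atTop (𝓝 l) := fun s =>
    ⟨_, tendsto_atTop_ciInf (antitone_nat_of_succ_le fun n => hUd n s)
      ⟨φ s, by rintro _ ⟨n, rfl⟩; exact ((hUb n).2 s).1⟩⟩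
  choose y hy using hlim
  have hym : Measurable y := measurable_of_tendsto_metrizable (fun n => (hUb n).1)
    (tendsto_pi_nhds.2 hy)
  have hyb : ∀ s, φ s ≤ y s ∧ y s ≤ Z s := fun s =>
    ⟨ge_of_tendsto' (hy s) fun n => ((hUb n).2 s).1, le_of_tendsto' (hy s) fun n => ((hUb n).2 s).2⟩
  have hLlim : ∀ s, Tendsto (fun n => invLeft R (fun s => G s (U n s)) s) atTop
      (𝓝 (invLeft R (fun s => G s (y s)) s)) := fun s =>
    tendsto_invRight iZ2 (fun n => (hmeas _ (hUb n).1).comp measurable_neg)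
      (fun n t => (hbd _ (hUb n).2 (-t)).1) (fun n t => (hbd _ (hUb n).2 (-t)).2.2)
      (fun t => ((hy (-t)).const_mul _).sub ((((hy (-t)).const_mul _).add
        (((hy (-t)).pow 3).const_mul 2)).add_const α)) (-s)
  have hfix : ∀ s, y s = T y s := fun s => by
    have h1 : Tendsto (fun n => T (U n) s) atTop (𝓝 (T y s)) :=
      tendsto_invRight iZ1 (fun n => (hLc _ (hUb n).1 (hUb n).2).measurable)
        (fun n t => (hvφ t).trans (hLb _ (hUb n).1 (hUb n).2 t).1)
        (fun n t => (hLb _ (hUb n).1 (hUb n).2 t).2) hLlim s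
    have h2 : Tendsto (fun n => T (U n) s) atTop (𝓝 (y s)) := by
      have := (tendsto_add_atTop_iff_nat 1).2 (hy s)
      simpa only [hUs] using this
    exact tendsto_nhds_unique h2 h1
  set v := invLeft R fun s => G s (y s) with hv
  have hyT : y = invRight R v := funext hfix
  have hWv : WeightIntegrable R v := hWL y hym hyb
  -- The limit is known only to be measurable; the fixed point identity now makes it differentiable,
  -- and then solves the second first-order factor.
  have hyd : ∀ s, HasDerivAt y (rate R s * y s - v s) s := fun s => by
    have := hWv.hasDerivAt_invRight (hLc y hym hyb) s
    rwa [← hyT] at this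
  have hyc : Continuous y := continuous_iff_continuousAt.2 fun s => (hyd s).continuousAt
  have hGc : Continuous fun s => G (-s) (y (-s)) := by
    simp only [hG]
    fun_prop
  have hvd : ∀ s, HasDerivAt v (G s (y s) - rate R s * v s) s := fun s => by
    have := ((hWf y hym hyb).hasDerivAt_invRight hGc (-s)).comp s (hasDerivAt_neg s)
    refine this.congr_deriv ?_
    rw [rate_neg, neg_neg]
    simp only [hv, invLeft]
    ring
  refine ⟨y, isSolution_of_hasDerivAt hyd fun s => ?_, fun s => (hφ0 s).trans_le (hyb s).1⟩
  refine (((hasDerivAt_rate R s).mul (hyd s)).sub (hvd s)).congr_deriv ?_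
  simp only [hG, hKdef]
  ring

end PainleveII

/-! ### Comparison, uniqueness, monotonicity, and minimal solutions with a zero. -/

namespace PainleveII

open Set Topology

variable {α : ℝ} {y z : ℝ → ℝ}

theorem eventually_sq_bounds (h : IsMinimalSolution α y) (hpos : ∀ᶠ s in atBot, 0 ≤ y s) :
    ∃ C, ∀ᶠ s in atBot, (-s - C) / 2 ≤ y s ^ 2 ∧ y s ^ 2 ≤ (-s + C) / 2 := by
  obtain ⟨s₀, hs₀⟩ := eventually_atBot.1 hpos
  refine ⟨10 + |α|, ?_⟩
  filter_upwards [eventually_le_atBot (s₀ - 1), eventually_le_atBot (-(12 + α ^ 2))] with s h1 h2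
  have ha := abs_nonneg α
  have hs : s ≤ 0 := by linarith [sq_nonneg α]
  constructor
  · refine le_trans ?_ (h.sq_ge (s := s) (by linarith) fun t ht => hs₀ t (by linarith [ht.2])).2
    linarith
  · refine (h.1.sq_le s).trans ?_
    rw [max_eq_left (by linarith)]
    linarith

theorem eventually_le_mul_of_sq_bounds {C r : ℝ} (hr : 1 < r)
    (hy : ∀ᶠ s in atBot, 0 ≤ y s) (h1 : ∀ᶠ s in atBot, (-s - C) / 2 ≤ y s ^ 2)
    (h2 : ∀ᶠ s in atBot, z s ^ 2 ≤ (-s + C) / 2) : ∀ᶠ s in atBot, z s ≤ r * y s := by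
  have hr2 : 0 < r ^ 2 - 1 := by nlinarith
  filter_upwards [hy, h1, h2, eventually_le_atBot (-(C * (r ^ 2 + 1) / (r ^ 2 - 1)))]
    with s h0 h1 h2 h3
  have h4 : C * (r ^ 2 + 1) ≤ -s * (r ^ 2 - 1) := by
    rw [← div_le_iff₀ hr2]; linarith
  refine abs_le_of_sq_le_sq' ?_ (by positivity) |>.2
  rw [mul_pow]
  have : r ^ 2 * ((-s - C) / 2) ≤ r ^ 2 * y s ^ 2 := by gcongr
  nlinarith

/-- Comparison on the whole line of a positive solution and a subsolution: look at the maximum of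
their ratio. -/
theorem IsSolution.le_of_subsolution (hα : α ≤ 0) (hy : IsSolution α y) (hpos : ∀ s, 0 < y s)
    {z₁ c : ℝ → ℝ} (hz : ∀ s, HasDerivAt z (z₁ s) s) (hz₁ : ∀ s, HasDerivAt z₁ (c s) s)
    (hc : ∀ s, s * z s + 2 * z s ^ 3 + α ≤ c s) (hz0 : Tendsto z atTop (𝓝 0))
    (hbot : ∀ r, 1 < r → ∀ᶠ s in atBot, z s ≤ r * y s) (s : ℝ) : z s ≤ y s := by
  by_contra! hlt
  have hyc := hy.continuous
  have hzc : Continuous z := continuous_iff_continuousAt.2 fun s => (hz s).continuousAt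
  set ρ : ℝ → ℝ := fun s => z s / y s with hρ
  have hρc : Continuous ρ := hzc.div₀ hyc fun s => (hpos s).ne'
  have hρs : 1 < ρ s := (one_lt_div (hpos s)).2 hlt
  -- The level `(1 + ρ s)/2` lies strictly between `1` and `ρ s`, so far to the left the ratio
  -- cannot compete with its value at `s`.
  obtain ⟨s₀, hs₀⟩ := eventually_atBot.1 (hbot ((1 + ρ s) / 2) (by linarith))
  obtain ⟨m, hm, hmax⟩ := (isCompact_Icc (a := min s₀ s) (b := max 0 s)).exists_isMaxOn
    ⟨s, min_le_right _ _, le_max_right _ _⟩ hρc.continuousOn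
  set r := ρ m with hr
  have hrs : ρ s ≤ r := hmax (show s ∈ Icc _ _ from ⟨min_le_right _ _, le_max_right _ _⟩)
  have hr1 : 1 < r := by linarith
  have hleft : ∀ t, t ≤ max 0 s → z t ≤ r * y t := by
    intro t ht
    rcases le_total t (min s₀ s) with h | h
    · refine (hs₀ t (h.trans (min_le_left _ _))).trans ?_
      have := hpos t
      gcongr
      linarith
    · exact (div_le_iff₀ (hpos t)).1 (hmax (show t ∈ Icc _ _ from ⟨h, ht⟩))
  set H : ℝ → ℝ := fun t => z t - r * y t with hH
  have hd1 : ∀ t, HasDerivAt H (z₁ t - r * deriv y t) t := fun t =>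
    (hz t).sub ((hy.hasDerivAt t).const_mul r)
  have hd2 : ∀ t, HasDerivAt (fun t => z₁ t - r * deriv y t)
      (c t - r * (t * y t + 2 * y t ^ 3 + α)) t := fun t => (hz₁ t).sub ((hy.2 t).const_mul r)
  have hHc : Continuous H := by fun_prop
  -- Superlinearity of the cube: where `z ≥ r y` with `r > 1`, one has `z³ ≥ r³ y³ > r y³`. This
  -- strict gain contradicts `H'' ≤ 0` at a maximum.
  have hcube : ∀ t, 0 ≤ H t → r * y t ^ 3 < z t ^ 3 := fun t ht => by
    have h0 := hpos t
    have h1 : r * y t ≤ z t := by simp only [hH] at ht; linarith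
    calc r * y t ^ 3 < r ^ 3 * y t ^ 3 := by
          have : 0 < y t ^ 3 := by positivity
          have : r < r ^ 3 := lt_self_pow₀ hr1 (by norm_num)
          gcongr
      _ = (r * y t) ^ 3 := by ring
      _ ≤ z t ^ 3 := by gcongr
  -- The ratio is not controlled at `+∞`, so there the maximum principle is applied to `H` itself,
  -- which tends to zero and has a nonnegative linear coefficient for `t ≥ 0`.
  have hright : ∀ t, z t ≤ r * y t := by
    intro t
    rcases le_total t (max 0 s) with h | h
    · exact hleft t h
    by_contra! hcon
    have hHt : 0 < H t := by simp only [hH]; linarith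
    have hlim : Tendsto H atTop (𝓝 0) := by
      simpa using hz0.sub (hy.tendsto_zero.const_mul r)
    obtain ⟨T, hT⟩ := eventually_atTop.1 (hlim.eventually_lt_const hHt)
    have htT : t < T := by
      by_contra! hle
      exact lt_irrefl _ (hT t hle)
    obtain ⟨x, hx, hxmax⟩ := (isCompact_Icc (a := max 0 s) (b := T)).exists_isMaxOn
      ⟨t, h, htT.le⟩ hHc.continuousOn
    have hHx : H t ≤ H x := hxmax (show t ∈ Icc _ _ from ⟨h, htT.le⟩)
    have hx1 : max 0 s < x := by
      refine lt_of_le_of_ne hx.1 ?_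
      rintro rfl
      have := hleft _ le_rfl
      simp only [hH] at hHx hHt
      linarith
    have hx2 : x < T := by
      refine lt_of_le_of_ne hx.2 ?_
      rintro rfl
      linarith [hT x le_rfl]
    have := nonpos_of_isLocalMax (hxmax.isLocalMax (Icc_mem_nhds hx1 hx2))
      (Eventually.of_forall hd1) (hd2 x)
    have h3 := hcube x (by linarith)
    have h4 := hc x
    have h5 : 0 < x := (le_max_left _ _).trans_lt hx1
    have h6 : 0 ≤ x * H x := mul_nonneg h5.le (by linarith)
    simp only [hH] at h6
    nlinarith
  have hHm : H m = 0 := by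
    simp only [hH, hr, hρ]
    rw [div_mul_cancel₀ _ (hpos m).ne', sub_self]
  have hloc : IsLocalMax H m := Eventually.of_forall fun t => by
    rw [hHm]; simp only [hH]; linarith [hright t]
  have h1 := nonpos_of_isLocalMax hloc (Eventually.of_forall hd1) (hd2 m)
  have h3 := hcube m hHm.ge
  have h4 := hc m
  have h6 : m * H m = 0 := by rw [hHm, mul_zero]
  simp only [hH] at h6
  nlinarith

/-- Positive solutions are minimal, so both squares are `-s/2 + O(1)` on the left; this is what the
ratio comparison requires there. -/
theorem IsSolution.le_of_pos (hα : α ≤ 0) (hy : IsSolution α y) (hz : IsSolution α z)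
    (hypos : ∀ s, 0 < y s) (hzpos : ∀ s, 0 < z s) (s : ℝ) : z s ≤ y s := by
  obtain ⟨C, hC⟩ := eventually_sq_bounds (hy.isMinimalSolution hα hypos)
    (Eventually.of_forall fun s => (hypos s).le)
  obtain ⟨C', hC'⟩ := eventually_sq_bounds (hz.isMinimalSolution hα hzpos)
    (Eventually.of_forall fun s => (hzpos s).le)
  refine hy.le_of_subsolution hα hypos hz.hasDerivAt hz.2 (fun _ => le_rfl) hz.tendsto_zero
    (fun r hr => eventually_le_mul_of_sq_bounds (C := max C C') hr
      (Eventually.of_forall fun s => (hypos s).le) ?_ ?_) s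
  · filter_upwards [hC] with s hs
    linarith [hs.1, le_max_left C C']
  · filter_upwards [hC'] with s hs
    linarith [hs.2, le_max_right C C']

theorem IsSolution.eq_of_pos (hα : α ≤ 0) (hy : IsSolution α y) (hz : IsSolution α z)
    (hypos : ∀ s, 0 < y s) (hzpos : ∀ s, 0 < z s) : z = y :=
  funext fun s => le_antisymm (hy.le_of_pos hα hz hypos hzpos s) (hz.le_of_pos hα hy hzpos hypos s)

/-- For `t ≥ 0` the translate `y(· + t)` satisfies the equation with `x + t` in place of `x`, and is
therefore a subsolution lying below `y`. -/
theorem IsSolution.antitone_of_pos (hα : α ≤ 0) (hy : IsSolution α y) (hypos : ∀ s, 0 < y s) :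
    Antitone y := by
  intro s s' hss
  obtain ⟨C, hC⟩ := eventually_sq_bounds (hy.isMinimalSolution hα hypos)
    (Eventually.of_forall fun s => (hypos s).le)
  set t := s' - s with ht
  have ht0 : 0 ≤ t := by linarith
  have hv : ∀ x, HasDerivAt (fun x => deriv y (x + t)) ((x + t) * y (x + t) + 2 * y (x + t) ^ 3 + α)
      x := fun x => (hy.2 (x + t)).comp_add_const x t
  have key := hy.le_of_subsolution (z := fun x => y (x + t)) hα hypos (hy.hasDerivAt_shift t) hv
    (fun x => by nlinarith [hypos (x + t)])
    (hy.tendsto_zero.comp (tendsto_atTop_add_const_right _ t tendsto_id))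
    (fun r hr => eventually_le_mul_of_sq_bounds (C := C) hr
      (Eventually.of_forall fun s => (hypos s).le) (hC.mono fun s hs => hs.1) ?_) s
  · simpa [ht] using key
  · have := (tendsto_atBot_add_const_right atBot t tendsto_id).eventually hC
    filter_upwards [this] with x hx
    refine hx.2.trans ?_
    simp only [id]
    linarith

/-- A zero of `y' ≤ 0` would be a maximum of `y'`, but differentiating the equation there gives
second derivative `y > 0`. -/
theorem IsSolution.deriv_neg_of_pos (hα : α ≤ 0) (hy : IsSolution α y) (hypos : ∀ s, 0 < y s)
    (s : ℝ) : deriv y s < 0 := by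
  have hle : ∀ t, deriv y t ≤ 0 := fun t => (hy.antitone_of_pos hα hypos).deriv_nonpos
  refine lt_of_le_of_ne (hle s) fun h0 => ?_
  have hloc : IsLocalMax (deriv y) s := Eventually.of_forall fun t => by rw [h0]; exact hle t
  have h2 : HasDerivAt (fun s => s * y s + 2 * y s ^ 3 + α)
      (1 * y s + s * deriv y s + 2 * (3 * y s ^ 2 * deriv y s)) s := by
    refine (((hasDerivAt_id s).mul (hy.hasDerivAt s)).add
      (((hy.hasDerivAt s).pow 3).const_mul 2)).add_const α |>.congr_deriv ?_
    simp
  have := nonpos_of_isLocalMax hloc (Eventually.of_forall hy.2) h2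
  rw [h0] at this
  linarith [hypos s]

/-- A zero of a nonnegative solution is double, so Grönwall applied to `y² + y'²` forces `y = 0`
identically. The lower bound for minimal solutions excludes this at `s = -12`, the first point it
covers when `α = 0`. -/
theorem IsMinimalSolution.pos_of_nonneg (h : IsMinimalSolution 0 y) (hnn : ∀ s, 0 ≤ y s) (s : ℝ) :
    0 < y s := by
  refine lt_of_le_of_ne (hnn s) fun h0 => ?_
  have hsol := h.1
  have hloc : IsLocalMin y s := Eventually.of_forall fun t => h0 ▸ hnn t
  have hd0 : deriv y s = 0 := hloc.deriv_eq_zero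
  have hy := hsol.continuous
  set N : ℝ → ℝ := fun t => y t ^ 2 + deriv y t ^ 2 with hN
  have hNd : ∀ t, HasDerivAt N (2 * y t * deriv y t + 2 * deriv y t *
      (t * y t + 2 * y t ^ 3 + 0)) t := fun t =>
    (((hsol.hasDerivAt t).pow 2).add ((hsol.2 t).pow 2)).congr_deriv (by simp)
  have key := eq_zero_of_forall_abs_deriv_le s (N := N) (by simp [hN, ← h0, hd0])
    (fun t => by positivity) hNd (fun a b => by
      obtain ⟨M, hM⟩ := (isCompact_Icc (a := a) (b := b)).exists_bound_of_continuousOn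
        (f := fun t => 1 + t + 2 * y t ^ 2) (by fun_prop)
      refine ⟨M, fun t ht => ?_⟩
      have h1 := hM t ht
      rw [Real.norm_eq_abs] at h1
      have e : 2 * y t * deriv y t + 2 * deriv y t * (t * y t + 2 * y t ^ 3 + 0)
          = (1 + t + 2 * y t ^ 2) * (2 * y t * deriv y t) := by ring
      rw [e, abs_mul]
      have h2 : |2 * y t * deriv y t| ≤ N t := by
        rw [abs_le]
        simp only [hN]
        constructor <;> nlinarith [sq_nonneg (y t + deriv y t), sq_nonneg (y t - deriv y t)]
      exact mul_le_mul h1 h2 (abs_nonneg _) ((abs_nonneg _).trans h1)) (-12)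
  have h1 := (h.sq_ge (s := -12) (by norm_num) fun t _ => hnn t).1
  simp only [hN] at key
  nlinarith [sq_nonneg (deriv y (-12))]

theorem IsMinimalSolution.isEquivalent_atBot (h : IsMinimalSolution α y)
    (hpos : ∀ᶠ s in atBot, 0 ≤ y s) : y ~[atBot] (fun s : ℝ => √(|s| / 2)) := by
  obtain ⟨C, hC⟩ := eventually_sq_bounds h hpos
  exact isEquivalent_sqrt_atBot hpos hC

theorem IsSolution.eventually_pos (h : IsSolution α y) (hα : α < 0) : ∀ᶠ s in atTop, 0 < y s := by
  obtain ⟨C, hC⟩ := h.abs_add_div_le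
  filter_upwards [eventually_ge_atTop 3, eventually_gt_atTop (C / -α)] with s h3 h4
  have h1 := (abs_le.1 (hC s h3)).1
  have hs0 : 0 < s := by linarith
  rw [div_lt_iff₀ (by linarith)] at h4
  have e : -(C / s ^ 2) - α / s = (s * -α - C) / s ^ 2 := by
    field_simp
    ring
  have : 0 < (s * -α - C) / s ^ 2 := div_pos (by linarith) (by positivity)
  linarith

/-- Flipping the sign on an interval of negativity would lower the energy. -/
theorem IsMinimalSolution.nonneg_of_mem_Icc (h : IsMinimalSolution α y) (hα : α < 0) {t₁ t₂ : ℝ}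
    (h1 : 0 ≤ y t₁) (h2 : 0 ≤ y t₂) : ∀ s ∈ Icc t₁ t₂, 0 ≤ y s := by
  have hd : deriv (fun s => -y s) = fun s => -deriv y s := by funext s; simp
  intro s hs
  have := h.le_of_subsolution (B := fun s => -y s) h.1.contDiff.neg (by linarith) (by linarith)
    (fun s _ _ => by
      have e : deriv (fun s => -deriv y s) s = -(s * y s + 2 * y s ^ 3 + α) := (h.1.2 s).neg.deriv
      rw [hd, e]
      constructor <;> linarith) s hs
  linarith

/-- Since `y > 0` far to the right, a nonnegative value left of the zero would make `y ≥ 0` on both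
sides. The zero would then be a local minimum, where `y'' = α < 0`. -/
theorem IsMinimalSolution.neg_of_lt_zero (h : IsMinimalSolution α y) (hα : α < 0) {s₁ : ℝ}
    (h0 : y s₁ = 0) {s : ℝ} (hs : s < s₁) : y s < 0 := by
  by_contra! hc
  obtain ⟨T, hT1, hT2⟩ := ((h.1.eventually_pos hα).and (eventually_gt_atTop s₁)).exists
  have hnn := h.nonneg_of_mem_Icc hα hc hT1.le
  have hloc : IsLocalMax (fun s => -y s) s₁ := by
    filter_upwards [Icc_mem_nhds hs hT2] with t ht
    rw [h0, neg_zero, neg_nonpos]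
    exact hnn t ht
  have := nonpos_of_isLocalMax hloc (Eventually.of_forall fun s => (h.1.hasDerivAt s).neg)
    (h.1.2 s₁).neg
  rw [h0] at this
  linarith

theorem IsMinimalSolution.isEquivalent_atBot_of_zero (h : IsMinimalSolution α y) (hα : α < 0)
    {s₁ : ℝ} (h0 : y s₁ = 0) : y ~[atBot] (fun s : ℝ => -√(|s| / 2)) := by
  have hpos : ∀ᶠ s in atBot, 0 ≤ -y s := by
    filter_upwards [eventually_lt_atBot s₁] with s hs
    linarith [h.neg_of_lt_zero hα h0 hs]
  simpa [Pi.neg_def] using (h.neg.isEquivalent_atBot hpos).neg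

end PainleveII

/-! ### The Airy integral: differential equation, change of contour, Laplace transform. -/

namespace PainleveII

open Set Topology MeasureTheory

/-- The integrand of the Airy function on the line `Im ζ = η`. -/
noncomputable def airyKernel (η s t : ℝ) : ℂ :=
  Complex.exp (Complex.I * (((t : ℂ) + η * Complex.I) ^ 3 / 3 + s * ((t : ℂ) + η * Complex.I)))

/-- The Airy integral on the line `Im ζ = η`. -/
noncomputable def airyLine (η s : ℝ) : ℂ := ∫ t : ℝ, airyKernel η s t

theorem norm_airyKernel (η s t : ℝ) :
    ‖airyKernel η s t‖ = Real.exp (η ^ 3 / 3 - s * η) * Real.exp (-η * t ^ 2) := by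
  rw [airyKernel, Complex.norm_exp, ← Real.exp_add]
  congr 1
  have : Complex.I * (((t : ℂ) + η * Complex.I) ^ 3 / 3 + s * ((t : ℂ) + η * Complex.I))
      = ((η ^ 3 / 3 - s * η + -η * t ^ 2 : ℝ) : ℂ)
        + ((t ^ 3 / 3 - t * η ^ 2 + s * t : ℝ) : ℂ) * Complex.I := by
    have h2 : Complex.I ^ 2 = -1 := Complex.I_sq
    have h3 : Complex.I ^ 3 = -Complex.I := Complex.I_pow_three
    have h4 : Complex.I ^ 4 = 1 := Complex.I_pow_four
    push_cast
    ring_nf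
    rw [h2, h3, h4]
    ring
  rw [this]
  simp only [Complex.add_re, Complex.ofReal_re, Complex.re_ofReal_mul, Complex.I_re, mul_zero,
    add_zero]

theorem continuous_airyKernel (η s : ℝ) : Continuous (airyKernel η s) := by
  unfold airyKernel; fun_prop

/-- Half of the Gaussian decay absorbs quadratic factors, and the rate is uniform for `η ≥ a`; this
is the dominating function for differentiation under the integral. -/
theorem norm_mul_airyKernel_le {a η s t A : ℝ} {q : ℂ} (ha : 0 < a) (hη : a ≤ η) (hA : 0 ≤ A)
    (hq : ‖q‖ ≤ A * (1 + t ^ 2)) :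
    ‖q * airyKernel η s t‖
      ≤ A * Real.exp (η ^ 3 / 3 - s * η) * (1 + 2 / a) * Real.exp (-(a / 2) * t ^ 2) := by
  rw [norm_mul, norm_airyKernel]
  have h1 : 1 + t ^ 2 ≤ (1 + 2 / a) * Real.exp (a / 2 * t ^ 2) := by
    have h2 := Real.add_one_le_exp (a / 2 * t ^ 2)
    have h3 : 1 + t ^ 2 ≤ (1 + 2 / a) * (a / 2 * t ^ 2 + 1) := by
      have e : (1 + 2 / a) * (a / 2 * t ^ 2 + 1) = 1 + t ^ 2 + (a / 2 * t ^ 2 + 2 / a) := by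
        field_simp
        ring
      rw [e]
      have : 0 ≤ a / 2 * t ^ 2 + 2 / a := by positivity
      linarith
    exact h3.trans (mul_le_mul_of_nonneg_left h2 (by positivity))
  have h4 : Real.exp (-η * t ^ 2) ≤ Real.exp (-a * t ^ 2) := by
    apply Real.exp_le_exp.2
    nlinarith [sq_nonneg t]
  have h5 : Real.exp (a / 2 * t ^ 2) * Real.exp (-a * t ^ 2) = Real.exp (-(a / 2) * t ^ 2) := by
    rw [← Real.exp_add]; ring_nf
  calc ‖q‖ * (Real.exp (η ^ 3 / 3 - s * η) * Real.exp (-η * t ^ 2))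
      ≤ (A * ((1 + 2 / a) * Real.exp (a / 2 * t ^ 2))) *
        (Real.exp (η ^ 3 / 3 - s * η) * Real.exp (-a * t ^ 2)) := by
        gcongr
        exact hq.trans (mul_le_mul_of_nonneg_left h1 hA)
    _ = A * Real.exp (η ^ 3 / 3 - s * η) * (1 + 2 / a) *
        (Real.exp (a / 2 * t ^ 2) * Real.exp (-a * t ^ 2)) := by ring
    _ = _ := by rw [h5]

theorem norm_line_le (η t : ℝ) : ‖(t : ℂ) + η * Complex.I‖ ≤ (1 + |η|) * (1 + t ^ 2) := by
  have h1 : ‖(t : ℂ) + η * Complex.I‖ ≤ |t| + |η| := by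
    refine (norm_add_le _ _).trans ?_
    simp
  have h2 : |t| ≤ 1 + t ^ 2 := by
    rw [← sq_abs t]; nlinarith [sq_nonneg (|t| - 1)]
  have := abs_nonneg η
  nlinarith [sq_nonneg t]

theorem norm_line_sq_add_le (η s t : ℝ) :
    ‖((t : ℂ) + η * Complex.I) ^ 2 + s‖ ≤ (2 + 2 * η ^ 2 + |s|) * (1 + t ^ 2) := by
  have h1 : ‖(t : ℂ) + η * Complex.I‖ ^ 2 = t ^ 2 + η ^ 2 := by
    rw [Complex.sq_norm, Complex.normSq_apply]
    simp
    ring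
  have h2 : ‖((t : ℂ) + η * Complex.I) ^ 2 + s‖ ≤ t ^ 2 + η ^ 2 + |s| := by
    refine (norm_add_le _ _).trans ?_
    rw [norm_pow, h1]
    simp
  have := abs_nonneg s
  nlinarith [sq_nonneg t, sq_nonneg η]

theorem integrable_mul_airyKernel {η s A : ℝ} {q : ℝ → ℂ} (hη : 0 < η) (hq : Continuous q)
    (hA : 0 ≤ A) (hb : ∀ t, ‖q t‖ ≤ A * (1 + t ^ 2)) :
    Integrable fun t => q t * airyKernel η s t := by
  refine Integrable.mono' ((integrable_exp_neg_mul_sq (b := η / 2) (by linarith)).const_mul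
    (A * Real.exp (η ^ 3 / 3 - s * η) * (1 + 2 / η)))
    (hq.mul (continuous_airyKernel η s)).aestronglyMeasurable (Eventually.of_forall fun t => ?_)
  exact norm_mul_airyKernel_le hη le_rfl hA (hb t)

theorem integrable_airyKernel {η : ℝ} (hη : 0 < η) (s : ℝ) : Integrable (airyKernel η s) := by
  simpa using integrable_mul_airyKernel (s := s) (q := fun _ => 1) (A := 1) hη continuous_const zero_le_one
    (fun t => by rw [norm_one]; nlinarith [sq_nonneg t])

theorem hasDerivAt_airyKernel (η s t : ℝ) : HasDerivAt (airyKernel η s)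
    (Complex.I * ((((t : ℂ) + η * Complex.I) ^ 2 + s) * airyKernel η s t)) t := by
  have h1 : HasDerivAt (fun t : ℝ => (t : ℂ) + η * Complex.I) 1 t :=
    (Complex.ofRealCLM.hasDerivAt (x := t)).add_const _
  have h2 := ((((h1.pow 3).div_const 3).add (h1.const_mul (s : ℂ))).const_mul Complex.I).cexp
  refine h2.congr_deriv ?_
  simp only [airyKernel, Pi.add_apply, Pi.pow_apply]
  push_cast
  ring

theorem hasDerivAt_airyKernel_height (η s t : ℝ) : HasDerivAt (fun η => airyKernel η s t)
    (-((((t : ℂ) + η * Complex.I) ^ 2 + s) * airyKernel η s t)) η := by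
  have h1 : HasDerivAt (fun η : ℝ => (t : ℂ) + η * Complex.I) Complex.I η := by
    simpa using ((Complex.ofRealCLM.hasDerivAt (x := η)).mul_const Complex.I).const_add (t : ℂ)
  have h2 := ((((h1.pow 3).div_const 3).add (h1.const_mul (s : ℂ))).const_mul Complex.I).cexp
  refine h2.congr_deriv ?_
  simp only [airyKernel, Pi.add_apply, Pi.pow_apply]
  push_cast
  linear_combination ((((t : ℂ) + η * Complex.I) ^ 2 + s) * Complex.exp (Complex.I *
    (((t : ℂ) + η * Complex.I) ^ 3 / 3 + s * ((t : ℂ) + η * Complex.I)))) * Complex.I_sq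

theorem hasDerivAt_airyKernel_param (η s t : ℝ) : HasDerivAt (fun s => airyKernel η s t)
    (Complex.I * (((t : ℂ) + η * Complex.I) * airyKernel η s t)) s := by
  have h1 : HasDerivAt (fun s : ℝ => (s : ℂ) * ((t : ℂ) + η * Complex.I))
      ((t : ℂ) + η * Complex.I) s := by
    simpa using (Complex.ofRealCLM.hasDerivAt (x := s)).mul_const ((t : ℂ) + η * Complex.I)
  have h2 := ((h1.const_add (((t : ℂ) + η * Complex.I) ^ 3 / 3)).const_mul Complex.I).cexp
  refine h2.congr_deriv ?_
  simp only [airyKernel]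
  ring

/-- Up to a factor `i`, the integrand is the `t`-derivative of the kernel. Both the Airy equation
and the independence of the height follow from this. -/
theorem integral_line_sq_add_mul {η : ℝ} (hη : 0 < η) (s : ℝ) :
    ∫ t : ℝ, (((t : ℂ) + η * Complex.I) ^ 2 + s) * airyKernel η s t = 0 := by
  have hi := integrable_mul_airyKernel (s := s) (q := fun t => ((t : ℂ) + η * Complex.I) ^ 2 + s)
    hη (by fun_prop) (by positivity) (norm_line_sq_add_le η s)
  have := integral_eq_zero_of_hasDerivAt_of_integrable (hasDerivAt_airyKernel η s)
    (hi.const_mul Complex.I) (integrable_airyKernel hη s)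
  rw [integral_const_mul] at this
  simpa using this

/-- In place of Cauchy's theorem: the derivative with respect to the height is minus the vanishing
integral above. -/
theorem airyLine_eq {η η' : ℝ} (hη : 0 < η) (hη' : 0 < η') (s : ℝ) :
    airyLine η s = airyLine η' s := by
  have hd : ∀ x ∈ Ioi (0 : ℝ), HasDerivAt (fun η => airyLine η s) 0 x := by
    intro x hx
    have hx0 : (0 : ℝ) < x := hx
    have h := hasDerivAt_integral_of_dominated_loc_of_deriv_le (μ := volume)
      (F := fun η t => airyKernel η s t)
      (F' := fun η t => -((((t : ℂ) + η * Complex.I) ^ 2 + s) * airyKernel η s t))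
      (x₀ := x) (s := Icc (x / 2) (x + 1))
      (bound := fun t => (2 + 2 * (x + 1) ^ 2 + |s|) * Real.exp ((x + 1) ^ 3 / 3 + |s| * (x + 1))
        * (1 + 2 / (x / 2)) * Real.exp (-(x / 2 / 2) * t ^ 2))
      (Icc_mem_nhds (by linarith) (by linarith))
      (Eventually.of_forall fun η => (continuous_airyKernel η s).aestronglyMeasurable)
      (integrable_airyKernel hx0 s)
      (by
        have := continuous_airyKernel x s
        exact Continuous.aestronglyMeasurable (by fun_prop))
      (Eventually.of_forall fun t η hη => ?_)
      ((integrable_exp_neg_mul_sq (by linarith)).const_mul _)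
      (Eventually.of_forall fun t η _ => hasDerivAt_airyKernel_height η s t)
    · have h2 := h.2
      rw [integral_neg, integral_line_sq_add_mul hx0, neg_zero] at h2
      exact h2
    · have h0 : 0 < η := by linarith [hη.1]
      rw [norm_neg]
      refine (norm_mul_airyKernel_le (a := x / 2) (by linarith) hη.1 (by positivity)
        (norm_line_sq_add_le η s t)).trans ?_
      have h1 : -s * η ≤ |s| * (x + 1) := by
        have := neg_abs_le s
        have := abs_nonneg s
        nlinarith [hη.2]
      have h3 : Real.exp (η ^ 3 / 3 - s * η) ≤ Real.exp ((x + 1) ^ 3 / 3 + |s| * (x + 1)) := by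
        apply Real.exp_le_exp.2
        have : η ^ 3 ≤ (x + 1) ^ 3 := pow_le_pow_left₀ h0.le hη.2 3
        linarith
      have h4 : 2 + 2 * η ^ 2 + |s| ≤ 2 + 2 * (x + 1) ^ 2 + |s| := by
        have : η ^ 2 ≤ (x + 1) ^ 2 := pow_le_pow_left₀ h0.le hη.2 2
        linarith
      gcongr
  exact isOpen_Ioi.is_const_of_deriv_eq_zero isPreconnected_Ioi
    (fun x hx => (hd x hx).differentiableAt.differentiableWithinAt)
    (fun x hx => (hd x hx).deriv) hη hη'

theorem hasDerivAt_integral_mul_airyKernel {η A : ℝ} {q : ℝ → ℂ} (hη : 0 < η) (hq : Continuous q)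
    (hA : 0 ≤ A) (hb : ∀ t, ‖q t‖ ≤ A * (1 + t ^ 2))
    (hb' : ∀ t, ‖q t * ((t : ℂ) + η * Complex.I)‖ ≤ A * (1 + t ^ 2)) (s : ℝ) :
    HasDerivAt (fun s => ∫ t : ℝ, q t * airyKernel η s t)
      (∫ t : ℝ, Complex.I * (q t * ((t : ℂ) + η * Complex.I) * airyKernel η s t)) s := by
  refine (hasDerivAt_integral_of_dominated_loc_of_deriv_le (μ := volume)
    (F := fun s t => q t * airyKernel η s t)
    (F' := fun s t => Complex.I * (q t * ((t : ℂ) + η * Complex.I) * airyKernel η s t))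
    (x₀ := s) (s := Icc (s - 1) (s + 1))
    (bound := fun t => A * Real.exp (η ^ 3 / 3 - (s - 1) * η) * (1 + 2 / η)
      * Real.exp (-(η / 2) * t ^ 2))
    (Icc_mem_nhds (by linarith) (by linarith))
    (Eventually.of_forall fun s => (hq.mul (continuous_airyKernel η s)).aestronglyMeasurable)
    (integrable_mul_airyKernel hη hq hA hb)
    (by
      have := continuous_airyKernel η s
      exact Continuous.aestronglyMeasurable (by fun_prop))
    (Eventually.of_forall fun t s' hs' => ?_)
    ((integrable_exp_neg_mul_sq (by linarith)).const_mul _)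
    (Eventually.of_forall fun t s' _ => ?_)).2
  · rw [norm_mul, Complex.norm_I, one_mul]
    refine (norm_mul_airyKernel_le hη le_rfl hA (hb' t)).trans ?_
    have h3 : Real.exp (η ^ 3 / 3 - s' * η) ≤ Real.exp (η ^ 3 / 3 - (s - 1) * η) := by
      apply Real.exp_le_exp.2
      nlinarith [hs'.1]
    gcongr
  · exact ((hasDerivAt_airyKernel_param η s' t).const_mul (q t)).congr_deriv (by ring)

/-- The derivative of the Airy integral. -/
noncomputable def airyLineDeriv (s : ℝ) : ℂ :=
  Complex.I * ∫ t : ℝ, ((t : ℂ) + (1 : ℝ) * Complex.I) * airyKernel 1 s t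

theorem hasDerivAt_airyLine (s : ℝ) : HasDerivAt (airyLine 1) (airyLineDeriv s) s := by
  have := hasDerivAt_integral_mul_airyKernel (η := 1) (A := 2) (q := fun _ => 1) one_pos
    continuous_const (by norm_num) (fun t => by rw [norm_one]; nlinarith [sq_nonneg t])
    (fun t => by
      rw [one_mul]
      refine (norm_line_le 1 t).trans_eq ?_
      norm_num) s
  simp only [one_mul] at this
  rw [integral_const_mul] at this
  exact this

theorem hasDerivAt_airyLineDeriv (s : ℝ) : HasDerivAt airyLineDeriv (s * airyLine 1 s) s := by
  have hb : ∀ t : ℝ, ‖((t : ℂ) + (1 : ℝ) * Complex.I) * ((t : ℂ) + (1 : ℝ) * Complex.I)‖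
      ≤ 4 * (1 + t ^ 2) := fun t => by
    have := norm_line_sq_add_le 1 0 t
    rw [← sq]
    simpa [show (2 : ℝ) + 2 = 4 by norm_num] using this
  have := (hasDerivAt_integral_mul_airyKernel (η := 1) (A := 4)
    (q := fun t => (t : ℂ) + (1 : ℝ) * Complex.I) one_pos
    (by fun_prop) (by norm_num) (fun t => (norm_line_le 1 t).trans (by
      rw [abs_one]; nlinarith [sq_nonneg t])) hb s).const_mul Complex.I
  refine this.congr_deriv ?_
  rw [integral_const_mul, ← mul_assoc, Complex.I_mul_I]
  have h0 := integral_line_sq_add_mul one_pos s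
  have e : ∀ t : ℝ, (((t : ℂ) + (1 : ℝ) * Complex.I) ^ 2 + s) * airyKernel 1 s t
      = ((t : ℂ) + (1 : ℝ) * Complex.I) * ((t : ℂ) + (1 : ℝ) * Complex.I) * airyKernel 1 s t
        + s * airyKernel 1 s t := fun t => by ring
  simp_rw [e] at h0
  rw [integral_add (integrable_mul_airyKernel one_pos (by fun_prop) (by norm_num) hb)
    ((integrable_airyKernel one_pos s).const_mul _), integral_const_mul] at h0
  rw [airyLine]
  linear_combination (-1 : ℂ) * h0

/-- Evaluating on the line of height `η` produces the factor `exp (-η s)`, for any `η > 0`. -/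
theorem norm_airyLine_le {η : ℝ} (hη : 0 < η) : ∃ C, 0 ≤ C ∧ ∀ s,
    ‖airyLine 1 s‖ ≤ C * Real.exp (-(η * s)) := by
  refine ⟨Real.exp (η ^ 3 / 3) * ∫ t : ℝ, Real.exp (-η * t ^ 2),
    mul_nonneg (Real.exp_pos _).le (integral_nonneg fun t => (Real.exp_pos _).le), fun s => ?_⟩
  rw [airyLine_eq one_pos hη]
  refine (norm_integral_le_integral_norm _).trans_eq ?_
  simp_rw [norm_airyKernel]
  rw [integral_const_mul, sub_eq_add_neg, Real.exp_add, mul_comm η s]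
  ring

theorem norm_airyLineDeriv_le : ∃ C, 0 ≤ C ∧ ∀ s, ‖airyLineDeriv s‖ ≤ C * Real.exp (-s) := by
  refine ⟨∫ t : ℝ, 2 * Real.exp (1 ^ 3 / 3) * (1 + 2 / 1) * Real.exp (-(1 / 2) * t ^ 2),
    integral_nonneg fun t => by positivity, fun s => ?_⟩
  rw [airyLineDeriv, norm_mul, Complex.norm_I, one_mul, ← integral_mul_const]
  refine norm_integral_le_of_norm_le ?_ (Eventually.of_forall fun t => ?_)
  · exact ((integrable_exp_neg_mul_sq (by norm_num)).const_mul _).mul_const _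
  · refine (norm_mul_airyKernel_le (a := 1) one_pos le_rfl (A := 2) (by norm_num) ?_).trans_eq ?_
    · refine (norm_line_le 1 t).trans_eq ?_
      norm_num
    · rw [sub_eq_add_neg, Real.exp_add, mul_one]
      ring

/-- The quantity `A² + A'²/(-s)` has derivative `A'²/s²`, so it increases towards `s = -1`. Airy
solutions are thus bounded on the left. -/
theorem sq_le_of_airy {A A₁ : ℝ → ℝ} (h1 : ∀ s, HasDerivAt A (A₁ s) s)
    (h2 : ∀ s, HasDerivAt A₁ (s * A s) s) {s : ℝ} (hs : s ≤ -1) :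
    A s ^ 2 ≤ A₁ (-1) ^ 2 + A (-1) ^ 2 := by
  have key := le_of_hasDerivAt_nonneg (f := fun s => (A₁ s ^ 2 - s * A s ^ 2) / -s)
    (f' := fun s => A₁ s ^ 2 / s ^ 2) hs
    (fun x hx => by
      have hx0 : x ≠ 0 := by linarith [hx.2]
      refine ((((h2 x).pow 2).sub ((hasDerivAt_id x).mul ((h1 x).pow 2))).div
        (hasDerivAt_neg x) (neg_ne_zero.2 hx0)).congr_deriv ?_
      simp
      field_simp
      ring)
    (fun x _ => by positivity)
  have h3 : A s ^ 2 ≤ (A₁ s ^ 2 - s * A s ^ 2) / -s := by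
    rw [le_div_iff₀ (by linarith)]
    nlinarith [sq_nonneg (A₁ s)]
  have h4 : (A₁ (-1) ^ 2 - (-1) * A (-1) ^ 2) / -(-1) = A₁ (-1) ^ 2 + A (-1) ^ 2 := by ring
  rw [h4] at key
  linarith

theorem integrable_exp_mul_airyLine {η : ℝ} (hη : 0 < η) :
    Integrable fun s : ℝ => (Real.exp (η * s) : ℂ) * airyLine 1 s := by
  have hc : Continuous fun s : ℝ => (Real.exp (η * s) : ℂ) * airyLine 1 s := by
    have : Continuous (airyLine 1) :=
      continuous_iff_continuousAt.2 fun s => (hasDerivAt_airyLine s).continuousAt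
    fun_prop
  have hre : ∀ s, HasDerivAt (fun s => (airyLine 1 s).re) (airyLineDeriv s).re s := fun s =>
    (Complex.reCLM.hasFDerivAt.comp_hasDerivAt s (hasDerivAt_airyLine s))
  have hre' : ∀ s, HasDerivAt (fun s => (airyLineDeriv s).re) (s * (airyLine 1 s).re) s := fun s => by
    exact (Complex.reCLM.hasFDerivAt.comp_hasDerivAt s (hasDerivAt_airyLineDeriv s)).congr_deriv
      (by simp)
  have him : ∀ s, HasDerivAt (fun s => (airyLine 1 s).im) (airyLineDeriv s).im s := fun s =>
    (Complex.imCLM.hasFDerivAt.comp_hasDerivAt s (hasDerivAt_airyLine s))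
  have him' : ∀ s, HasDerivAt (fun s => (airyLineDeriv s).im) (s * (airyLine 1 s).im) s := fun s => by
    exact (Complex.imCLM.hasFDerivAt.comp_hasDerivAt s (hasDerivAt_airyLineDeriv s)).congr_deriv
      (by simp)
  obtain ⟨M, hM⟩ : ∃ M, ∀ s, s ≤ -1 → ‖airyLine 1 s‖ ≤ M := by
    refine ⟨√(((airyLineDeriv (-1)).re ^ 2 + (airyLine 1 (-1)).re ^ 2) +
      ((airyLineDeriv (-1)).im ^ 2 + (airyLine 1 (-1)).im ^ 2)),
      fun s hs => Real.le_sqrt_of_sq_le ?_⟩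
    rw [Complex.sq_norm, Complex.normSq_apply, ← sq, ← sq]
    exact add_le_add (sq_le_of_airy hre hre' hs) (sq_le_of_airy him him' hs)
  obtain ⟨C, hC0, hC⟩ := norm_airyLine_le (η := η + 1) (by linarith)
  rw [← integrableOn_univ, ← Iic_union_Ioi (a := (-1 : ℝ))]
  refine IntegrableOn.union ?_ ?_
  · refine Integrable.mono' (((integrableOn_exp_mul_Iic hη (-1))).const_mul M)
      hc.aestronglyMeasurable ((ae_restrict_iff' measurableSet_Iic).2
        (Eventually.of_forall fun s hs => ?_))
    rw [norm_mul, Complex.norm_real, Real.norm_of_nonneg (Real.exp_pos _).le, mul_comm]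
    exact mul_le_mul_of_nonneg_right (hM s hs) (Real.exp_pos _).le
  · refine Integrable.mono' ((integrableOn_exp_mul_Ioi (a := -1) (by norm_num) (-1)).const_mul C)
      hc.aestronglyMeasurable (Eventually.of_forall fun s => ?_)
    rw [norm_mul, Complex.norm_real, Real.norm_of_nonneg (Real.exp_pos _).le]
    refine (mul_le_mul_of_nonneg_left (hC s) (Real.exp_pos _).le).trans_eq ?_
    rw [mul_left_comm, ← Real.exp_add]
    ring_nf

open scoped FourierTransform in
-- After rescaling, `exp (η s)` times the Airy integral is the Fourier transform of the kernel at
-- height `η` and parameter `0`. Fourier inversion at the origin returns the kernel's value `exp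
-- (η³/3)`.
theorem integral_exp_mul_airyLine {η : ℝ} (hη : 0 < η) :
    ∫ s : ℝ, (Real.exp (η * s) : ℂ) * airyLine 1 s = 2 * Real.pi * Real.exp (η ^ 3 / 3) := by
  set f : ℝ → ℂ := airyKernel η 0 with hf
  set g : ℝ → ℂ := fun s => (Real.exp (η * s) : ℂ) * airyLine 1 s with hg
  have hF : ∀ w : ℝ, 𝓕 f w = g (-(2 * Real.pi) * w) := by
    intro w
    rw [Real.fourier_real_eq_integral_exp_smul]
    simp only [hg]
    rw [airyLine_eq one_pos hη, airyLine, ← integral_const_mul]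
    congr 1
    funext t
    simp only [hf, airyKernel, smul_eq_mul]
    push_cast
    rw [← Complex.exp_add, ← Complex.exp_add]
    congr 1
    linear_combination (2 * Real.pi * w * η : ℂ) * Complex.I_sq
  have hFi : Integrable (𝓕 f) := by
    have : 𝓕 f = fun w => g (-(2 * Real.pi) * w) := funext hF
    rw [this]
    exact (integrable_comp_mul_left_iff g (by simp [Real.pi_ne_zero])).2
      (integrable_exp_mul_airyLine hη)
  have hinv := (integrable_airyKernel hη 0).fourierInv_fourier_eq hFi
    (continuous_airyKernel η 0).continuousAt (v := 0)
  rw [Real.fourierInv_eq'] at hinv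
  simp only [inner_zero_right, mul_zero, Complex.ofReal_zero, zero_mul, Complex.exp_zero,
    one_smul] at hinv
  change ∫ w, 𝓕 f w = _ at hinv
  simp_rw [hF] at hinv
  rw [Measure.integral_comp_mul_left] at hinv
  have h0 : airyKernel η 0 0 = Real.exp (η ^ 3 / 3) := by
    rw [airyKernel]
    push_cast
    congr 1
    have h4 : Complex.I ^ 4 = 1 := Complex.I_pow_four
    linear_combination (η : ℂ) ^ 3 / 3 * h4
  rw [h0] at hinv
  rw [← hinv, abs_inv, abs_neg, abs_of_pos Real.two_pi_pos, Complex.real_smul]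
  push_cast
  have : (2 * Real.pi : ℂ) ≠ 0 := by simp [Real.pi_ne_zero]
  field_simp

end PainleveII

/-! ### The real Airy function and the Airy coefficient of a positive solution. -/

namespace PainleveII

open Set Topology MeasureTheory

/-- The derivative of the Airy function. -/
noncomputable def airyAiDeriv (s : ℝ) : ℝ := 1 / (2 * Real.pi) * (airyLineDeriv s).re

theorem airyAi_eq (s : ℝ) : airyAi s = 1 / (2 * Real.pi) * (airyLine 1 s).re := by
  simp only [airyAi, airyLine, airyKernel, Complex.ofReal_one, one_mul]

theorem hasDerivAt_airyAi (s : ℝ) : HasDerivAt airyAi (airyAiDeriv s) s := by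
  have e : airyAi = fun s => 1 / (2 * Real.pi) * (airyLine 1 s).re := funext airyAi_eq
  rw [e]
  exact (Complex.reCLM.hasFDerivAt.comp_hasDerivAt s (hasDerivAt_airyLine s)).const_mul _

theorem hasDerivAt_airyAiDeriv (s : ℝ) : HasDerivAt airyAiDeriv (s * airyAi s) s := by
  refine ((Complex.reCLM.hasFDerivAt.comp_hasDerivAt s
    (hasDerivAt_airyLineDeriv s)).const_mul (1 / (2 * Real.pi))).congr_deriv ?_
  rw [airyAi_eq]
  simp only [Complex.reCLM_apply, Complex.re_ofReal_mul]
  ring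

theorem continuous_airyAi : Continuous airyAi :=
  continuous_iff_continuousAt.2 fun s => (hasDerivAt_airyAi s).continuousAt

theorem abs_airyAi_le {η : ℝ} (hη : 0 < η) : ∃ C, 0 ≤ C ∧ ∀ s,
    |airyAi s| ≤ C * Real.exp (-(η * s)) := by
  obtain ⟨C, hC0, hC⟩ := norm_airyLine_le hη
  have hp : 0 < 1 / (2 * Real.pi) := by positivity
  refine ⟨1 / (2 * Real.pi) * C, by positivity, fun s => ?_⟩
  rw [airyAi_eq, abs_mul, abs_of_pos hp, mul_assoc]
  exact mul_le_mul_of_nonneg_left ((Complex.abs_re_le_norm _).trans (hC s)) hp.le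

theorem abs_airyAiDeriv_le : ∃ C, 0 ≤ C ∧ ∀ s, |airyAiDeriv s| ≤ C * Real.exp (-s) := by
  obtain ⟨C, hC0, hC⟩ := norm_airyLineDeriv_le
  have hp : 0 < 1 / (2 * Real.pi) := by positivity
  refine ⟨1 / (2 * Real.pi) * C, by positivity, fun s => ?_⟩
  rw [airyAiDeriv, abs_mul, abs_of_pos hp, mul_assoc]
  exact mul_le_mul_of_nonneg_left ((Complex.abs_re_le_norm _).trans (hC s)) hp.le

theorem integrable_exp_mul_airyAi {x : ℝ} (hx : 0 < x) :
    Integrable fun t => Real.exp (x * t) * airyAi t := by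
  have := ((integrable_exp_mul_airyLine hx).re).const_mul (1 / (2 * Real.pi))
  refine this.congr (Eventually.of_forall fun t => ?_)
  simp only [airyAi_eq, RCLike.re_eq_complex_re, Complex.re_ofReal_mul]
  ring

theorem integral_exp_mul_airyAi {x : ℝ} (hx : 0 < x) :
    ∫ t, Real.exp (x * t) * airyAi t = Real.exp (x ^ 3 / 3) := by
  have h1 := congrArg Complex.re (integral_exp_mul_airyLine hx)
  have h2 : ∫ t, ((Real.exp (x * t) : ℂ) * airyLine 1 t).re
      = (∫ t, (Real.exp (x * t) : ℂ) * airyLine 1 t).re :=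
    integral_re (integrable_exp_mul_airyLine hx)
  have e : ∀ t, Real.exp (x * t) * airyAi t
      = 1 / (2 * Real.pi) * ((Real.exp (x * t) : ℂ) * airyLine 1 t).re := fun t => by
    simp only [airyAi_eq, Complex.re_ofReal_mul]
    ring
  simp_rw [e]
  rw [integral_const_mul, h2, h1]
  have h3 : (2 * Real.pi * Real.exp (x ^ 3 / 3) : ℂ)
      = ((2 * Real.pi * Real.exp (x ^ 3 / 3) : ℝ) : ℂ) := by push_cast; rfl
  rw [h3, Complex.ofReal_re]
  have := Real.pi_pos
  field_simp

theorem tendsto_exp_neg_cube (T : ℝ) :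
    Tendsto (fun x : ℝ => Real.exp (-(x ^ 3 / 3)) * Real.exp (x * T)) atTop (𝓝 0) := by
  have h : Tendsto (fun x : ℝ => -(x ^ 3 / 3) + x * T) atTop atBot := by
    refine tendsto_atBot_mono' _ ?_ tendsto_neg_atTop_atBot
    filter_upwards [eventually_ge_atTop 1, eventually_ge_atTop (3 * (T + 1))] with x h1 h2
    have h3 : 3 * (T + 1) ≤ x ^ 2 := by nlinarith
    nlinarith
  refine (Real.tendsto_exp_atBot.comp h).congr fun x => ?_
  simp only [Function.comp_apply, Real.exp_add]

/-- The full Laplace integral equals `exp (x³/3)`, while the part left of `T` grows only like `exp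
(x T)`. -/
theorem tendsto_integral_Ioi_airyAi (T : ℝ) :
    Tendsto (fun x : ℝ => Real.exp (-(x ^ 3 / 3)) * ∫ t in Ioi T, Real.exp (x * t) * airyAi t)
      atTop (𝓝 1) := by
  have hsmall : Tendsto (fun x : ℝ => Real.exp (-(x ^ 3 / 3)) *
      ∫ t in Iic T, Real.exp (x * t) * airyAi t) atTop (𝓝 0) := by
    set M := ∫ t in Iic T, |Real.exp (1 * t) * airyAi t| with hM
    have hlim := ((tendsto_exp_neg_cube T).mul_const (Real.exp (-T))).mul_const M
    simp only [zero_mul] at hlim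
    refine squeeze_zero_norm' ?_ hlim
    filter_upwards [eventually_ge_atTop 1] with x hx
    rw [norm_mul, Real.norm_of_nonneg (Real.exp_pos _).le, mul_assoc, mul_assoc]
    refine mul_le_mul_of_nonneg_left ?_ (Real.exp_pos _).le
    rw [← mul_assoc, ← integral_const_mul]
    refine norm_integral_le_of_norm_le
      ((integrable_exp_mul_airyAi one_pos).abs.integrableOn.const_mul _)
      ((ae_restrict_iff' measurableSet_Iic).2 (Eventually.of_forall fun t ht => ?_))
    have ht' : t ≤ T := ht
    rw [norm_mul, abs_mul, ← mul_assoc, Real.norm_eq_abs, Real.norm_eq_abs, Real.abs_exp,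
      Real.abs_exp, ← Real.exp_add, ← Real.exp_add]
    refine mul_le_mul_of_nonneg_right (Real.exp_le_exp.2 ?_) (abs_nonneg _)
    nlinarith
  have h1 : Tendsto (fun x : ℝ => 1 - Real.exp (-(x ^ 3 / 3)) *
      ∫ t in Iic T, Real.exp (x * t) * airyAi t) atTop (𝓝 (1 - 0)) := hsmall.const_sub 1
  rw [sub_zero] at h1
  refine h1.congr' ?_
  filter_upwards [eventually_gt_atTop 0] with x hx
  have h2 := integral_exp_mul_airyAi hx
  have hi := integrable_exp_mul_airyAi hx
  rw [← setIntegral_univ, ← Iic_union_Ioi (a := T), setIntegral_union (Iic_disjoint_Ioi le_rfl)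
    measurableSet_Ioi hi.integrableOn hi.integrableOn] at h2
  have h3 : Real.exp (-(x ^ 3 / 3)) * Real.exp (x ^ 3 / 3) = 1 := by rw [← Real.exp_add]; simp
  rw [← h2] at h3
  linarith

theorem tendsto_airyAi : Tendsto airyAi atTop (𝓝 0) := by
  obtain ⟨C, _, hC⟩ := abs_airyAi_le one_pos
  refine squeeze_zero_norm hC ?_
  simpa using (Real.tendsto_exp_neg_atTop_nhds_zero.const_mul C)

theorem tendsto_airyAiDeriv : Tendsto airyAiDeriv atTop (𝓝 0) := by
  obtain ⟨C, _, hC⟩ := abs_airyAiDeriv_le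
  refine squeeze_zero_norm hC ?_
  simpa using (Real.tendsto_exp_neg_atTop_nhds_zero.const_mul C)

/-- If `Ai(s) ≤ 0` with `s > 0`, the maximum principle and decay keep `Ai ≤ 0` on the whole
half-line, against the positive limit of its normalised Laplace integral. -/
theorem airyAi_pos {s : ℝ} (hs : 0 < s) : 0 < airyAi s := by
  by_contra! h0
  have hle : ∀ t ∈ Ioi s, airyAi t ≤ 0 := by
    intro t ht
    have ht' : s < t := ht
    by_contra! hpos
    obtain ⟨T, hT⟩ := eventually_atTop.1 (tendsto_airyAi.eventually_lt_const hpos)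
    have htT : t < T := by
      by_contra! hle
      exact lt_irrefl _ (hT t hle)
    obtain ⟨x, hx, hmax⟩ := (isCompact_Icc (a := s) (b := T)).exists_isMaxOn
      ⟨t, ht'.le, htT.le⟩ continuous_airyAi.continuousOn
    have hx0 : airyAi t ≤ airyAi x := hmax (show t ∈ Icc s T from ⟨ht'.le, htT.le⟩)
    have hx1 : s < x := by
      refine lt_of_le_of_ne hx.1 ?_
      rintro rfl
      linarith
    have hx2 : x < T := by
      refine lt_of_le_of_ne hx.2 ?_
      rintro rfl
      linarith [hT x le_rfl]
    have := nonpos_of_isLocalMax (hmax.isLocalMax (Icc_mem_nhds hx1 hx2))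
      (Eventually.of_forall hasDerivAt_airyAi) (hasDerivAt_airyAiDeriv x)
    have : 0 < x * airyAi x := mul_pos (hs.trans hx1) (hpos.trans_le hx0)
    linarith
  have hlim := tendsto_integral_Ioi_airyAi s
  have : (1 : ℝ) ≤ 0 := by
    refine le_of_tendsto' hlim fun x => ?_
    refine mul_nonpos_of_nonneg_of_nonpos (Real.exp_pos _).le ?_
    refine setIntegral_nonpos measurableSet_Ioi fun t ht => ?_
    exact mul_nonpos_of_nonneg_of_nonpos (Real.exp_pos _).le (hle t ht)
  linarith

variable {u : ℝ → ℝ}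

/-- On `s ≥ 0` a positive solution is convex and decreasing, so its slope is controlled by the
secant over the preceding unit interval. -/
theorem IsSolution.abs_deriv_le (hu : IsSolution 0 u) (hpos : ∀ s, 0 < u s) {s : ℝ} (hs : 1 ≤ s) :
    |deriv u s| ≤ u (s - 1) := by
  rw [abs_of_neg (hu.deriv_neg_of_pos le_rfl hpos s)]
  have h1 : ∀ t ∈ Icc (s - 1) s, deriv u t ≤ deriv u s := fun t ht =>
    le_of_hasDerivAt_nonneg ht.2 (fun x _ => hu.2 x) fun x hx => by
      have : 0 ≤ x := by linarith [hx.1, ht.1]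
      have := hpos x
      positivity
  have h2 := le_of_hasDerivAt_nonneg (f := fun t => deriv u s * t - u t) (a := s - 1) (b := s)
    (by linarith) (fun t _ => ((hasDerivAt_id t).const_mul (deriv u s)).sub (hu.hasDerivAt t))
    (fun t ht => by linarith [h1 t ht])
  linarith [hpos s]

/-- The Wronskian `u' Ai - u Ai'` has derivative `2 u³ Ai > 0` on the right and tends to zero, so it
is nonpositive and the quotient decreases. -/
theorem IsSolution.exists_tendsto_div_airyAi (hu : IsSolution 0 u) (hpos : ∀ s, 0 < u s) :
    AntitoneOn (fun s => u s / airyAi s) (Ici 1) ∧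
      ∃ k, Tendsto (fun s => u s / airyAi s) atTop (𝓝 k) := by
  have hA : ∀ s, 1 ≤ s → 0 < airyAi s := fun s hs => airyAi_pos (by linarith)
  set V : ℝ → ℝ := fun s => deriv u s * airyAi s - u s * airyAiDeriv s with hV
  have hVd : ∀ s, HasDerivAt V (2 * u s ^ 3 * airyAi s) s := fun s =>
    (((hu.2 s).mul (hasDerivAt_airyAi s)).sub
      ((hu.hasDerivAt s).mul (hasDerivAt_airyAiDeriv s))).congr_deriv (by ring)
  have hdu : Tendsto (deriv u) atTop (𝓝 0) := by
    have hl : Tendsto (fun s => u (s - 1)) atTop (𝓝 0) :=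
      hu.tendsto_zero.comp (tendsto_atTop_add_const_right _ (-1) tendsto_id)
    refine squeeze_zero_norm' ?_ hl
    filter_upwards [eventually_ge_atTop 1] with s hs using hu.abs_deriv_le hpos hs
  have hV0 : Tendsto V atTop (𝓝 0) := by
    simpa using (hdu.mul tendsto_airyAi).sub (hu.tendsto_zero.mul tendsto_airyAiDeriv)
  have hVle : ∀ s, 1 ≤ s → V s ≤ 0 := fun s hs => by
    refine ge_of_tendsto hV0 ?_
    filter_upwards [eventually_ge_atTop s] with t ht
    exact le_of_hasDerivAt_nonneg ht (fun x _ => hVd x) fun x hx => by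
      have := hpos x
      have := hA x (hs.trans hx.1)
      positivity
  have hanti : AntitoneOn (fun s => u s / airyAi s) (Ici 1) := by
    intro a ha b hb hab
    have ha' : (1 : ℝ) ≤ a := ha
    have := le_of_hasDerivAt_nonneg (f := fun s => -(u s / airyAi s))
      (f' := fun s => -(V s / airyAi s ^ 2)) hab
      (fun x hx => ((hu.hasDerivAt x).div (hasDerivAt_airyAi x)
        (hA x (ha'.trans hx.1)).ne').neg)
      (fun x hx => by
        have := hVle x (ha'.trans hx.1)
        have : V x / airyAi x ^ 2 ≤ 0 := div_nonpos_of_nonpos_of_nonneg this (sq_nonneg _)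
        linarith)
    simpa using this
  refine ⟨hanti, ?_⟩
  have hanti' : Antitone fun s => u (max 1 s) / airyAi (max 1 s) := fun a b hab =>
    hanti (show (1 : ℝ) ≤ max 1 a from le_max_left _ _) (show (1 : ℝ) ≤ max 1 b from le_max_left _ _)
      (max_le_max le_rfl hab)
  refine ⟨_, (tendsto_atTop_ciInf hanti' ⟨0, ?_⟩).congr' ?_⟩
  · rintro _ ⟨s, rfl⟩
    exact div_nonneg (hpos _).le (hA _ (le_max_left _ _)).le
  · filter_upwards [eventually_ge_atTop 1] with s hs
    simp [max_eq_right hs]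

theorem IsSolution.le_exp (hu : IsSolution 0 u) (hpos : ∀ s, 0 < u s) {c : ℝ} (hc : 0 < c) :
    ∃ C, 0 ≤ C ∧ ∀ s, 2 ≤ s → u s ≤ C * Real.exp (-(c * s)) ∧
      |deriv u s| ≤ C * Real.exp (-(c * s)) := by
  obtain ⟨C, hC0, hC⟩ := abs_airyAi_le hc
  obtain ⟨hanti, -⟩ := hu.exists_tendsto_div_airyAi hpos
  set q := u 1 / airyAi 1 with hq
  have hq0 : 0 ≤ q := div_nonneg (hpos 1).le (airyAi_pos one_pos).le
  have h1 : ∀ s, 1 ≤ s → u s ≤ q * C * Real.exp (-(c * s)) := fun s hs => by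
    have hA : 0 < airyAi s := airyAi_pos (by linarith)
    have h2 : u s / airyAi s ≤ q := hanti (by simp) hs hs
    rw [div_le_iff₀ hA] at h2
    refine h2.trans ?_
    rw [mul_assoc]
    exact mul_le_mul_of_nonneg_left ((le_abs_self _).trans (hC s)) hq0
  have hE : 1 ≤ Real.exp c := Real.one_le_exp hc.le
  refine ⟨q * C * Real.exp c, by positivity, fun s hs => ⟨?_, ?_⟩⟩
  · refine (h1 s (by linarith)).trans ?_
    have : 0 ≤ q * C := by positivity
    have : q * C ≤ q * C * Real.exp c := le_mul_of_one_le_right this hE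
    gcongr
  · refine (hu.abs_deriv_le hpos (by linarith)).trans ((h1 (s - 1) (by linarith)).trans_eq ?_)
    rw [mul_assoc _ (Real.exp c), ← Real.exp_add]
    ring_nf

theorem IsSolution.integrableOn_exp_mul (hu : IsSolution 0 u) (hpos : ∀ s, 0 < u s) (x s : ℝ) :
    IntegrableOn (fun t => Real.exp (x * t) * u t) (Ioi s) := by
  have hc := hu.continuous
  obtain ⟨C, hC0, hC⟩ := hu.le_exp hpos (c := |x| + 1) (by positivity)
  have hcont : Continuous fun t => Real.exp (x * t) * u t := by fun_prop
  have h1 : IntegrableOn (fun t => Real.exp (x * t) * u t) (Ioi (max s 2)) := by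
    refine Integrable.mono' ((integrableOn_exp_mul_Ioi (a := -1) (by norm_num) (max s 2)).const_mul C)
      hcont.aestronglyMeasurable ((ae_restrict_iff' measurableSet_Ioi).2
        (Eventually.of_forall fun t ht => ?_))
    have ht' : 2 ≤ t := (le_max_right s 2).trans (le_of_lt ht)
    rw [Real.norm_of_nonneg (mul_nonneg (Real.exp_pos _).le (hpos t).le)]
    refine (mul_le_mul_of_nonneg_left (hC t ht').1 (Real.exp_pos _).le).trans ?_
    rw [mul_left_comm, ← Real.exp_add]
    refine mul_le_mul_of_nonneg_left (Real.exp_le_exp.2 ?_) hC0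
    have := le_abs_self x
    nlinarith
  have h2 : IntegrableOn (fun t => Real.exp (x * t) * u t) (Ioc s (max s 2)) :=
    (hcont.integrableOn_Icc).mono_set Ioc_subset_Icc_self
  rw [← Ioc_union_Ioi_eq_Ioi (le_max_left s 2)]
  exact h2.union h1

/-- The Laplace transform recovers the Airy coefficient. -/
theorem IsSolution.tendsto_laplace (hu : IsSolution 0 u) (hpos : ∀ s, 0 < u s) {k : ℝ}
    (hk : Tendsto (fun s => u s / airyAi s) atTop (𝓝 k)) (s : ℝ) :
    Tendsto (fun x : ℝ => Real.exp (-(x ^ 3 / 3)) * ∫ t in Ioi s, Real.exp (x * t) * u t)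
      atTop (𝓝 k) := by
  have hc := hu.continuous
  have hAc := continuous_airyAi
  have hA := (tendsto_integral_Ioi_airyAi s).const_mul k
  rw [mul_one] at hA
  suffices h : Tendsto (fun x : ℝ => (Real.exp (-(x ^ 3 / 3)) * ∫ t in Ioi s, Real.exp (x * t) * u t)
      - k * (Real.exp (-(x ^ 3 / 3)) * ∫ t in Ioi s, Real.exp (x * t) * airyAi t)) atTop (𝓝 0) by
    simpa using h.add hA
  rw [Metric.tendsto_atTop']
  intro ε hε
  have hε3 : 0 < ε / 4 := by linarith
  obtain ⟨T₀, hT₀⟩ := Metric.tendsto_atTop.1 hk (ε / 4) hε3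
  -- Beyond `T` the integrand is within `ε/4` of `k Ai` relative to `Ai`, whose normalised integral
  -- is eventually below `2`; the piece up to `T` is negligible. The total is `ε/4 + ε/2`.
  set T := max (max T₀ 1) s with hT
  have hTs : s ≤ T := le_max_right _ _
  set M := ∫ t in Ioc s T, |u t - k * airyAi t| with hM
  have hA1 := (tendsto_integral_Ioi_airyAi T).eventually_lt_const (show (1 : ℝ) < 2 by norm_num)
  have hlim := (tendsto_exp_neg_cube T).mul_const M
  rw [zero_mul] at hlim
  have hl1 := hlim.eventually_lt_const hε3
  obtain ⟨N, hN⟩ := eventually_atTop.1 ((hA1.and hl1).and (eventually_gt_atTop 0))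
  refine ⟨N, fun x hx => ?_⟩
  obtain ⟨⟨h1, h2⟩, hx0⟩ := hN x (le_of_lt hx)
  have hE := Real.exp_pos (-(x ^ 3 / 3))
  have iu := hu.integrableOn_exp_mul hpos x
  have iA : ∀ s, IntegrableOn (fun t => Real.exp (x * t) * airyAi t) (Ioi s) := fun s =>
    (integrable_exp_mul_airyAi hx0).integrableOn
  have iw : ∀ s, IntegrableOn (fun t => Real.exp (x * t) * (u t - k * airyAi t)) (Ioi s) :=
    fun s => ((iu s).sub ((iA s).const_mul k)).congr (Eventually.of_forall fun t => by
      simp only [Pi.sub_apply]; ring)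
  have e : (Real.exp (-(x ^ 3 / 3)) * ∫ t in Ioi s, Real.exp (x * t) * u t)
      - k * (Real.exp (-(x ^ 3 / 3)) * ∫ t in Ioi s, Real.exp (x * t) * airyAi t)
      = Real.exp (-(x ^ 3 / 3)) * ∫ t in Ioi s, Real.exp (x * t) * (u t - k * airyAi t) := by
    have h3 : ∫ t in Ioi s, Real.exp (x * t) * (u t - k * airyAi t)
        = (∫ t in Ioi s, Real.exp (x * t) * u t) - k * ∫ t in Ioi s, Real.exp (x * t) * airyAi t := by
      rw [← integral_const_mul, ← integral_sub (iu s) ((iA s).const_mul k)]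
      congr 1
      funext t
      ring
    rw [h3]
    ring
  have hsplit : ∫ t in Ioi s, Real.exp (x * t) * (u t - k * airyAi t)
      = (∫ t in Ioc s T, Real.exp (x * t) * (u t - k * airyAi t))
        + ∫ t in Ioi T, Real.exp (x * t) * (u t - k * airyAi t) := by
    rw [← Ioc_union_Ioi_eq_Ioi hTs, setIntegral_union Ioc_disjoint_Ioi_same measurableSet_Ioi
      ((iw s).mono_set Ioc_subset_Ioi_self) (iw T)]
  have b1 : ‖∫ t in Ioc s T, Real.exp (x * t) * (u t - k * airyAi t)‖ ≤ Real.exp (x * T) * M := by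
    rw [hM, ← integral_const_mul]
    have hcw : Continuous fun t => |u t - k * airyAi t| := by fun_prop
    refine norm_integral_le_of_norm_le
      ((hcw.integrableOn_Icc.mono_set Ioc_subset_Icc_self).const_mul _)
      ((ae_restrict_iff' measurableSet_Ioc).2 (Eventually.of_forall fun t ht => ?_))
    rw [norm_mul, Real.norm_of_nonneg (Real.exp_pos _).le, Real.norm_eq_abs]
    have := ht.2
    gcongr
  have b2 : ‖∫ t in Ioi T, Real.exp (x * t) * (u t - k * airyAi t)‖
      ≤ ε / 4 * ∫ t in Ioi T, Real.exp (x * t) * airyAi t := by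
    rw [← integral_const_mul]
    refine norm_integral_le_of_norm_le ((iA T).const_mul _)
      ((ae_restrict_iff' measurableSet_Ioi).2 (Eventually.of_forall fun t ht => ?_))
    have ht' : T < t := ht
    have hA0 : 0 < airyAi t := airyAi_pos (by
      linarith [(le_max_right T₀ 1).trans (le_max_left (max T₀ 1) s)])
    have h4 := hT₀ t (((le_max_left T₀ 1).trans (le_max_left (max T₀ 1) s)).trans ht'.le)
    rw [Real.dist_eq] at h4
    have h5 : u t - k * airyAi t = (u t / airyAi t - k) * airyAi t := by
      field_simp
    rw [norm_mul, Real.norm_of_nonneg (Real.exp_pos _).le, Real.norm_eq_abs, h5, abs_mul,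
      abs_of_pos hA0, mul_left_comm]
    have := Real.exp_pos (x * t)
    gcongr
  rw [e, hsplit, Real.dist_eq, sub_zero, abs_mul, abs_of_pos hE]
  rw [Real.norm_eq_abs] at b1 b2
  have b3 := abs_add_le (∫ t in Ioc s T, Real.exp (x * t) * (u t - k * airyAi t))
    (∫ t in Ioi T, Real.exp (x * t) * (u t - k * airyAi t))
  calc Real.exp (-(x ^ 3 / 3)) * |(∫ t in Ioc s T, Real.exp (x * t) * (u t - k * airyAi t))
        + ∫ t in Ioi T, Real.exp (x * t) * (u t - k * airyAi t)|
      ≤ Real.exp (-(x ^ 3 / 3)) * (Real.exp (x * T) * M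
        + ε / 4 * ∫ t in Ioi T, Real.exp (x * t) * airyAi t) := by
        apply mul_le_mul_of_nonneg_left _ hE.le
        linarith
    _ = Real.exp (-(x ^ 3 / 3)) * Real.exp (x * T) * M
        + ε / 4 * (Real.exp (-(x ^ 3 / 3)) * ∫ t in Ioi T, Real.exp (x * t) * airyAi t) := by ring
    _ < ε / 4 + ε / 4 * 2 := by
        apply add_lt_add h2
        apply mul_lt_mul_of_pos_left h1 hε3
    _ ≤ ε := by linarith

end PainleveII

/-! ### Joint solutions of the Lax pair as power series in the spectral parameter. -/

namespace PainleveII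

open Set Topology

/-- Coefficients that decay faster than every geometric sequence. -/
def SuperGeometric (a : ℕ → ℝ) : Prop := ∀ r : ℝ, 0 < r → ∃ C, ∀ n, |a n| ≤ C * r ^ n

theorem SuperGeometric.summable {a : ℕ → ℝ} (h : SuperGeometric a) (x : ℝ) :
    Summable fun n => a n * x ^ n := by
  obtain ⟨C, hC⟩ := h (1 / (2 * (|x| + 1))) (by positivity)
  refine Summable.of_norm_bounded (g := fun n => C * (1 / 2) ^ n)
    ((summable_geometric_of_lt_one (by norm_num) (by norm_num)).mul_left C) fun n => ?_
  have hC0 : 0 ≤ C := by simpa using (abs_nonneg _).trans (hC 0)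
  rw [norm_mul, norm_pow, Real.norm_eq_abs, Real.norm_eq_abs]
  calc |a n| * |x| ^ n ≤ C * (1 / (2 * (|x| + 1))) ^ n * (|x| + 1) ^ n := by
        gcongr
        · exact hC n
        · linarith
    _ = C * (1 / 2) ^ n := by
        rw [mul_assoc, ← mul_pow]
        congr 2
        have : |x| + 1 ≠ 0 := by positivity
        field_simp

theorem SuperGeometric.shift {a : ℕ → ℝ} (h : SuperGeometric a) (k : ℕ) :
    SuperGeometric fun n => a (n + k) := by
  intro r hr
  obtain ⟨C, hC⟩ := h r hr
  exact ⟨C * r ^ k, fun n => (hC (n + k)).trans_eq (by ring)⟩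

theorem SuperGeometric.natCast_mul {a : ℕ → ℝ} (h : SuperGeometric a) :
    SuperGeometric fun n => (n : ℝ) * a n := by
  intro r hr
  obtain ⟨C, hC⟩ := h (r / 2) (by linarith)
  refine ⟨C, fun n => ?_⟩
  rw [abs_mul, Nat.abs_cast]
  have h1 : (n : ℝ) ≤ 2 ^ n := by exact_mod_cast n.lt_two_pow_self.le
  calc (n : ℝ) * |a n| ≤ 2 ^ n * (C * (r / 2) ^ n) :=
        mul_le_mul h1 (hC n) (abs_nonneg _) (by positivity)
    _ = C * r ^ n := by
        rw [mul_left_comm, ← mul_pow]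
        congr 2
        ring

theorem SuperGeometric.mono {a b : ℕ → ℝ} (h : SuperGeometric b) (hab : ∀ n, |a n| ≤ b n) :
    SuperGeometric a := fun r hr => by
  obtain ⟨C, hC⟩ := h r hr
  exact ⟨C, fun n => (hab n).trans ((le_abs_self _).trans (hC n))⟩

theorem SuperGeometric.hasDerivAt_tsum {a : ℕ → ℝ} (h : SuperGeometric a) (x : ℝ) :
    HasDerivAt (fun x => ∑' n, a n * x ^ n) (∑' n : ℕ, ((n : ℝ) + 1) * a (n + 1) * x ^ n) x := by
  set R := |x| + 1 with hR
  have hR1 : 1 ≤ R := by simp [hR]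
  have hsum : Summable fun n : ℕ => |(n : ℝ) * a n| * R ^ n := by
    have h2 : SuperGeometric fun n : ℕ => |(n : ℝ) * a n| := fun r hr => by
      obtain ⟨C, hC⟩ := h.natCast_mul r hr
      exact ⟨C, fun n => by rw [abs_abs]; exact hC n⟩
    exact h2.summable R
  have hb : ∀ (n : ℕ) (z : ℝ), z ∈ Metric.ball (0 : ℝ) R →
      ‖a n * ((n : ℝ) * z ^ (n - 1))‖ ≤ |(n : ℝ) * a n| * R ^ n := fun n z hz => by
    rw [mem_ball_zero_iff, Real.norm_eq_abs] at hz
    rw [← mul_assoc, norm_mul, norm_pow, Real.norm_eq_abs, Real.norm_eq_abs, mul_comm (a n)]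
    have : |z| ^ (n - 1) ≤ R ^ n :=
      (pow_le_pow_left₀ (abs_nonneg _) hz.le _).trans (pow_le_pow_right₀ hR1 (Nat.sub_le n 1))
    gcongr
  have hx : x ∈ Metric.ball (0 : ℝ) R := by
    rw [mem_ball_zero_iff, Real.norm_eq_abs, hR]; linarith
  have key := hasDerivAt_tsum_of_isPreconnected hsum Metric.isOpen_ball
    (convex_ball (0 : ℝ) R).isPreconnected
    (g := fun n z => a n * z ^ n) (g' := fun n z => a n * ((n : ℝ) * z ^ (n - 1)))
    (fun n z _ => (hasDerivAt_pow n z).const_mul (a n)) hb hx (h.summable x) hx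
  refine key.congr_deriv ?_
  have hs : Summable fun n : ℕ => a n * ((n : ℝ) * x ^ (n - 1)) :=
    Summable.of_norm_bounded hsum fun n => hb n x hx
  rw [hs.tsum_eq_zero_add]
  simp only [Nat.cast_zero, zero_mul, mul_zero, zero_add, Nat.cast_add, Nat.cast_one,
    Nat.add_sub_cancel]
  exact tsum_congr fun n => by ring

/-- A scalar majorant for the coefficients of the Lax solutions. -/
noncomputable def laxMajorant (K E : ℝ) : ℕ → ℝ
  | 0 => 0
  | 1 => 0
  | 2 => 0
  | 3 => E
  | n + 4 => K / ((n : ℝ) + 1) *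
      (laxMajorant K E (n + 3) + laxMajorant K E (n + 2) + laxMajorant K E (n + 1))

theorem laxMajorant_nonneg {K E : ℝ} (hK : 0 ≤ K) (hE : 0 ≤ E) (n : ℕ) :
    0 ≤ laxMajorant K E n := by
  induction n using Nat.strong_induction_on with
  | _ n ih =>
    match n, ih with
    | 0, _ => simp [laxMajorant]
    | 1, _ => simp [laxMajorant]
    | 2, _ => simp [laxMajorant]
    | 3, _ => simpa [laxMajorant] using hE
    | n + 4, ih =>
      rw [laxMajorant]
      have := ih (n + 3) (by omega)
      have := ih (n + 2) (by omega)
      have := ih (n + 1) (by omega)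
      positivity

/-- Once `n` passes `N`, the factor `K/(n + 1)` makes the bound `C r ^ n` self-propagating; `C` is
chosen to cover the initial terms. -/
theorem superGeometric_laxMajorant {K E : ℝ} (hK : 0 ≤ K) (hE : 0 ≤ E) :
    SuperGeometric (laxMajorant K E) := by
  intro r hr
  set Q := K * (r ^ 2 + r + 1) / r ^ 3 with hQ
  obtain ⟨N, hN⟩ := exists_nat_ge Q
  set C := ∑ i ∈ Finset.range (N + 4), laxMajorant K E i / r ^ i with hC
  have hnn := laxMajorant_nonneg hK hE
  have hterm : ∀ i, 0 ≤ laxMajorant K E i / r ^ i := fun i => div_nonneg (hnn i) (by positivity)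
  have hC0 : 0 ≤ C := Finset.sum_nonneg fun i _ => hterm i
  refine ⟨C, fun n => ?_⟩
  rw [abs_of_nonneg (hnn n)]
  induction n using Nat.strong_induction_on with
  | _ n ih =>
    rcases lt_or_ge n (N + 4) with hn | hn
    · rw [← div_le_iff₀ (by positivity)]
      exact Finset.single_le_sum (f := fun i => laxMajorant K E i / r ^ i) (fun i _ => hterm i)
        (Finset.mem_range.2 hn)
    · obtain ⟨m, rfl⟩ : ∃ m, n = m + 4 := ⟨n - 4, by omega⟩
      have hm : (N : ℝ) ≤ m := by exact_mod_cast (by omega : N ≤ m)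
      rw [laxMajorant]
      have h1 := ih (m + 3) (by omega)
      have h2 := ih (m + 2) (by omega)
      have h3 := ih (m + 1) (by omega)
      have h4 : K * (r ^ 2 + r + 1) ≤ ((m : ℝ) + 1) * r ^ 3 := by
        rw [← div_le_iff₀ (by positivity)]
        linarith
      calc K / ((m : ℝ) + 1) *
            (laxMajorant K E (m + 3) + laxMajorant K E (m + 2) + laxMajorant K E (m + 1))
          ≤ K / ((m : ℝ) + 1) * (C * r ^ (m + 3) + C * r ^ (m + 2) + C * r ^ (m + 1)) := by
            gcongr
        _ = C * r ^ (m + 1) * (K * (r ^ 2 + r + 1)) / ((m : ℝ) + 1) := by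
            field_simp
            ring
        _ ≤ C * r ^ (m + 1) * (((m : ℝ) + 1) * r ^ 3) / ((m : ℝ) + 1) := by
            gcongr
        _ = C * r ^ (m + 4) := by
            field_simp
            ring

/-- Taylor coefficients in the spectral parameter (shifted by three) of solutions of the Lax pair
of the second Painlevé equation. -/
noncomputable def laxCoeff (u p q : ℝ → ℝ) (s : ℝ) : ℕ → ℝ × ℝ
  | 0 => 0
  | 1 => 0
  | 2 => 0
  | 3 => (p s, q s)
  | n + 4 =>
    (1 / ((n : ℝ) + 1) * ((s + 2 * u s ^ 2) * (laxCoeff u p q s (n + 3)).1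
        - 2 * deriv u s * (laxCoeff u p q s (n + 3)).2 - 4 * u s * (laxCoeff u p q s (n + 2)).2
        - 4 * (laxCoeff u p q s (n + 1)).1),
      1 / ((n : ℝ) + 1) * (-(s + 2 * u s ^ 2) * (laxCoeff u p q s (n + 3)).2
        + 2 * deriv u s * (laxCoeff u p q s (n + 3)).1 - 4 * u s * (laxCoeff u p q s (n + 2)).1
        + 4 * (laxCoeff u p q s (n + 1)).2))

variable {u p q : ℝ → ℝ}

theorem succ_mul_laxCoeff (s : ℝ) (n : ℕ) :
    ((n : ℝ) + 1) * (laxCoeff u p q s (n + 4)).1 = (s + 2 * u s ^ 2) * (laxCoeff u p q s (n + 3)).1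
        - 2 * deriv u s * (laxCoeff u p q s (n + 3)).2 - 4 * u s * (laxCoeff u p q s (n + 2)).2
        - 4 * (laxCoeff u p q s (n + 1)).1 ∧
    ((n : ℝ) + 1) * (laxCoeff u p q s (n + 4)).2 = -(s + 2 * u s ^ 2) * (laxCoeff u p q s (n + 3)).2
        + 2 * deriv u s * (laxCoeff u p q s (n + 3)).1 - 4 * u s * (laxCoeff u p q s (n + 2)).1
        + 4 * (laxCoeff u p q s (n + 1)).2 := by
  have h : (n : ℝ) + 1 ≠ 0 := by positivity
  constructor <;> · rw [laxCoeff]; field_simp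

/-- The three leading zeros make the recursion hold at order zero too, so multiplication by `μ` or
`μ²` is a plain index shift with no boundary terms. -/
theorem mul_laxCoeff (s : ℝ) (n : ℕ) :
    (n : ℝ) * (laxCoeff u p q s (n + 3)).1 = (s + 2 * u s ^ 2) * (laxCoeff u p q s (n + 2)).1
        - 2 * deriv u s * (laxCoeff u p q s (n + 2)).2 - 4 * u s * (laxCoeff u p q s (n + 1)).2
        - 4 * (laxCoeff u p q s n).1 ∧
    (n : ℝ) * (laxCoeff u p q s (n + 3)).2 = -(s + 2 * u s ^ 2) * (laxCoeff u p q s (n + 2)).2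
        + 2 * deriv u s * (laxCoeff u p q s (n + 2)).1 - 4 * u s * (laxCoeff u p q s (n + 1)).1
        + 4 * (laxCoeff u p q s n).2 := by
  cases n with
  | zero => simp [laxCoeff]
  | succ n =>
    push_cast
    exact succ_mul_laxCoeff s n

/-- Compatibility of the Lax pair, coefficient by coefficient: since `u` solves Painlevé II, the
spectral recursion carries the spatial equation from order zero upwards. The defect cancels by the
recursion at the previous order for one component and at the same order for the other. -/
theorem hasDerivAt_laxCoeff (hu : IsSolution 0 u) (hp : ∀ s, HasDerivAt p (u s * q s) s)
    (hq : ∀ s, HasDerivAt q (u s * p s) s) (n : ℕ) (s : ℝ) :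
    HasDerivAt (fun s => (laxCoeff u p q s (n + 1)).1)
      ((laxCoeff u p q s n).1 + u s * (laxCoeff u p q s (n + 1)).2) s ∧
    HasDerivAt (fun s => (laxCoeff u p q s (n + 1)).2)
      (-(laxCoeff u p q s n).2 + u s * (laxCoeff u p q s (n + 1)).1) s := by
  induction n using Nat.strong_induction_on with
  | _ n ih =>
    match n, ih with
    | 0, _ => simp [laxCoeff, hasDerivAt_const]
    | 1, _ => simp [laxCoeff, hasDerivAt_const]
    | 2, _ => simpa [laxCoeff] using ⟨hp s, hq s⟩
    | n + 3, ih =>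
      obtain ⟨a1, b1⟩ := ih (n + 2) (by omega)
      obtain ⟨a2, b2⟩ := ih (n + 1) (by omega)
      obtain ⟨a3, b3⟩ := ih n (by omega)
      obtain ⟨e1, e2⟩ := mul_laxCoeff (u := u) (p := p) (q := q) s n
      obtain ⟨e3, e4⟩ := succ_mul_laxCoeff (u := u) (p := p) (q := q) s n
      have hn : (n : ℝ) + 1 ≠ 0 := by positivity
      have hu1 := hu.hasDerivAt s
      have hu2 := hu.2 s
      have hw : HasDerivAt (fun s => s + 2 * u s ^ 2) (1 + 4 * u s * deriv u s) s :=
        ((hasDerivAt_id s).add ((hu1.pow 2).const_mul 2)).congr_deriv (by simp; ring)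
      have f1 : (fun s => (laxCoeff u p q s (n + 3 + 1)).1) = fun s => 1 / ((n : ℝ) + 1) *
          ((s + 2 * u s ^ 2) * (laxCoeff u p q s (n + 3)).1
          - 2 * deriv u s * (laxCoeff u p q s (n + 3)).2 - 4 * u s * (laxCoeff u p q s (n + 2)).2
          - 4 * (laxCoeff u p q s (n + 1)).1) := by
        funext s; rw [laxCoeff]
      have f2 : (fun s => (laxCoeff u p q s (n + 3 + 1)).2) = fun s => 1 / ((n : ℝ) + 1) *
          (-(s + 2 * u s ^ 2) * (laxCoeff u p q s (n + 3)).2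
          + 2 * deriv u s * (laxCoeff u p q s (n + 3)).1 - 4 * u s * (laxCoeff u p q s (n + 2)).1
          + 4 * (laxCoeff u p q s (n + 1)).2) := by
        funext s; rw [laxCoeff]
      constructor
      · rw [f1]
        refine (((((hw.mul a1).sub ((hu2.const_mul 2).mul b1)).sub
          ((hu1.const_mul 4).mul b2)).sub (a3.const_mul 4)).const_mul (1 / ((n : ℝ) + 1))).congr_deriv ?_
        rw [one_div, inv_mul_eq_iff_eq_mul₀ hn]
        linear_combination (-1 : ℝ) * e1 - u s * e4
      · rw [f2]
        refine (((((hw.neg.mul b1).add ((hu2.const_mul 2).mul a1)).sub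
          ((hu1.const_mul 4).mul a2)).add (b3.const_mul 4)).const_mul (1 / ((n : ℝ) + 1))).congr_deriv ?_
        rw [one_div, inv_mul_eq_iff_eq_mul₀ hn]
        simp only [Pi.neg_apply]
        linear_combination e2 - u s * e3

theorem abs_laxCoeff_le {s K E : ℝ} (hE : |p s| + |q s| ≤ E)
    (hK : |s + 2 * u s ^ 2| + 2 * |deriv u s| + 4 * |u s| + 4 ≤ K) (n : ℕ) :
    |(laxCoeff u p q s n).1| + |(laxCoeff u p q s n).2| ≤ laxMajorant K E n := by
  induction n using Nat.strong_induction_on with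
  | _ n ih =>
    match n, ih with
    | 0, _ => simp [laxCoeff, laxMajorant]
    | 1, _ => simp [laxCoeff, laxMajorant]
    | 2, _ => simp [laxCoeff, laxMajorant]
    | 3, _ => simpa [laxCoeff, laxMajorant] using hE
    | n + 4, ih =>
      have h1 := ih (n + 3) (by omega)
      have h2 := ih (n + 2) (by omega)
      have h3 := ih (n + 1) (by omega)
      rw [laxCoeff, laxMajorant]
      set P3 := (laxCoeff u p q s (n + 3)).1
      set Q3 := (laxCoeff u p q s (n + 3)).2
      set P2 := (laxCoeff u p q s (n + 2)).1
      set Q2 := (laxCoeff u p q s (n + 2)).2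
      set P1 := (laxCoeff u p q s (n + 1)).1
      set Q1 := (laxCoeff u p q s (n + 1)).2
      have hn : 0 < 1 / ((n : ℝ) + 1) := by positivity
      have ha : |(s + 2 * u s ^ 2) * P3 - 2 * deriv u s * Q3 - 4 * u s * Q2 - 4 * P1|
          ≤ |s + 2 * u s ^ 2| * |P3| + 2 * |deriv u s| * |Q3| + 4 * |u s| * |Q2| + 4 * |P1| := by
        refine (abs_sub _ _).trans (add_le_add ((abs_sub _ _).trans (add_le_add
          ((abs_sub _ _).trans (add_le_add ?_ ?_)) ?_)) ?_) <;> simp [abs_mul]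
      have hb : |-(s + 2 * u s ^ 2) * Q3 + 2 * deriv u s * P3 - 4 * u s * P2 + 4 * Q1|
          ≤ |s + 2 * u s ^ 2| * |Q3| + 2 * |deriv u s| * |P3| + 4 * |u s| * |P2| + 4 * |Q1| := by
        have e1 : |-(s + 2 * u s ^ 2) * Q3| = |s + 2 * u s ^ 2| * |Q3| := by rw [abs_mul, abs_neg]
        have e2 : |2 * deriv u s * P3| = 2 * |deriv u s| * |P3| := by simp [abs_mul]
        have e3 : |4 * u s * P2| = 4 * |u s| * |P2| := by simp [abs_mul]
        have e4 : |4 * Q1| = 4 * |Q1| := by simp [abs_mul]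
        rw [← e1, ← e2, ← e3, ← e4]
        exact (abs_add_le _ _).trans (add_le_add_left ((abs_sub _ _).trans
          (add_le_add_left (abs_add_le _ _) _)) _)
      rw [abs_mul, abs_mul (1 / ((n : ℝ) + 1)), abs_of_pos hn, ← mul_add]
      have hw := abs_nonneg (s + 2 * u s ^ 2)
      have hd := abs_nonneg (deriv u s)
      have hu := abs_nonneg (u s)
      have m3 : 0 ≤ |P3| + |Q3| := by positivity
      have m2 : 0 ≤ |P2| + |Q2| := by positivity
      have m1 : 0 ≤ |P1| + |Q1| := by positivity
      have c3 : (|s + 2 * u s ^ 2| + 2 * |deriv u s|) * (|P3| + |Q3|)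
          ≤ K * laxMajorant K E (n + 3) :=
        mul_le_mul (by linarith) h1 m3 (by linarith)
      have c2 : 4 * |u s| * (|P2| + |Q2|) ≤ K * laxMajorant K E (n + 2) :=
        mul_le_mul (by linarith) h2 m2 (by linarith)
      have c1 : 4 * (|P1| + |Q1|) ≤ K * laxMajorant K E (n + 1) :=
        mul_le_mul (by linarith) h3 m1 (by linarith)
      refine (mul_le_mul_of_nonneg_left (b := _) (c := K * (laxMajorant K E (n + 3)
        + laxMajorant K E (n + 2) + laxMajorant K E (n + 1))) ?_ hn.le).trans_eq (by ring)
      linarith [ha, hb, c1, c2, c3]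

/-- A majorant uniform for `s` in a neighbourhood is what termwise differentiation in `s` needs. -/
theorem exists_laxMajorant (hu : IsSolution 0 u) (hp : Continuous p) (hq : Continuous q) (S : ℝ) :
    ∃ K E : ℝ, 0 ≤ K ∧ 0 ≤ E ∧ ∀ s ∈ Icc (S - 1) (S + 1), |u s| ≤ K ∧ ∀ n,
      |(laxCoeff u p q s n).1| ≤ laxMajorant K E n ∧ |(laxCoeff u p q s n).2| ≤ laxMajorant K E n := by
  have hc := hu.continuous
  have hc' := hu.continuous_deriv
  obtain ⟨K, hK⟩ := (isCompact_Icc (a := S - 1) (b := S + 1)).exists_bound_of_continuousOn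
    (f := fun s => |s + 2 * u s ^ 2| + 2 * |deriv u s| + 4 * |u s| + 4) (by fun_prop)
  obtain ⟨E, hE⟩ := (isCompact_Icc (a := S - 1) (b := S + 1)).exists_bound_of_continuousOn
    (f := fun s => |p s| + |q s|) (by fun_prop)
  have hS : S ∈ Icc (S - 1) (S + 1) := by constructor <;> linarith
  refine ⟨K, E, (norm_nonneg _).trans (hK S hS), (norm_nonneg _).trans (hE S hS), fun s hs => ?_⟩
  have h1 := (le_abs_self _).trans (hK s hs)
  have h2 := (le_abs_self _).trans (hE s hs)
  have a1 := abs_nonneg (s + 2 * u s ^ 2)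
  have a2 := abs_nonneg (deriv u s)
  have a3 := abs_nonneg (u s)
  refine ⟨by linarith, fun n => ?_⟩
  have h3 := abs_laxCoeff_le h2 h1 n
  have := abs_nonneg (laxCoeff u p q s n).1
  have := abs_nonneg (laxCoeff u p q s n).2
  constructor <;> linarith

/-- Every solution at zero spectral parameter extends to a joint solution of the Lax pair. -/
theorem exists_lax_solution (hu : IsSolution 0 u) (hp : ∀ s, HasDerivAt p (u s * q s) s)
    (hq : ∀ s, HasDerivAt q (u s * p s) s) :
    ∃ f g : ℝ → ℝ → ℝ, (∀ s, f 0 s = p s) ∧ (∀ s, g 0 s = q s) ∧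
      (∀ μ s, HasDerivAt (f μ) (μ * f μ s + u s * g μ s) s) ∧
      (∀ μ s, HasDerivAt (g μ) (-μ * g μ s + u s * f μ s) s) ∧
      (∀ μ s, HasDerivAt (fun μ => f μ s) ((s + 2 * u s ^ 2 - 4 * μ ^ 2) * f μ s
        - (4 * μ * u s + 2 * deriv u s) * g μ s) μ) ∧
      (∀ μ s, HasDerivAt (fun μ => g μ s) (-(s + 2 * u s ^ 2 - 4 * μ ^ 2) * g μ s
        - (4 * μ * u s - 2 * deriv u s) * f μ s) μ) := by
  have hpc : Continuous p := continuous_iff_continuousAt.2 fun s => (hp s).continuousAt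
  have hqc : Continuous q := continuous_iff_continuousAt.2 fun s => (hq s).continuousAt
  set P : ℕ → ℝ → ℝ := fun n s => (laxCoeff u p q s n).1 with hP
  set Q : ℕ → ℝ → ℝ := fun n s => (laxCoeff u p q s n).2 with hQ
  have hsg : ∀ s, SuperGeometric (fun n => P n s) ∧ SuperGeometric (fun n => Q n s) := fun s => by
    obtain ⟨K, E, hK0, hE0, hb⟩ := exists_laxMajorant hu hpc hqc s
    have h1 := (hb s (by constructor <;> linarith)).2
    exact ⟨(superGeometric_laxMajorant hK0 hE0).mono fun n => (h1 n).1,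
      (superGeometric_laxMajorant hK0 hE0).mono fun n => (h1 n).2⟩
  set f : ℝ → ℝ → ℝ := fun μ s => ∑' n, P (n + 3) s * μ ^ n with hf
  set g : ℝ → ℝ → ℝ := fun μ s => ∑' n, Q (n + 3) s * μ ^ n with hg
  have shiftP : ∀ k μ s, P k s = 0 → ∑' n, P (n + k) s * μ ^ n
      = μ * ∑' n, P (n + (k + 1)) s * μ ^ n := fun k μ s h0 => by
    rw [(((hsg s).1.shift k).summable μ).tsum_eq_zero_add, ← tsum_mul_left]
    simp only [zero_add, h0, zero_mul]
    refine tsum_congr fun n => ?_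
    rw [show n + 1 + k = n + (k + 1) by omega]
    ring
  have shiftQ : ∀ k μ s, Q k s = 0 → ∑' n, Q (n + k) s * μ ^ n
      = μ * ∑' n, Q (n + (k + 1)) s * μ ^ n := fun k μ s h0 => by
    rw [(((hsg s).2.shift k).summable μ).tsum_eq_zero_add, ← tsum_mul_left]
    simp only [zero_add, h0, zero_mul]
    refine tsum_congr fun n => ?_
    rw [show n + 1 + k = n + (k + 1) by omega]
    ring
  have P2 : ∀ μ s, ∑' n, P (n + 2) s * μ ^ n = μ * f μ s := fun μ s =>
    shiftP 2 μ s (by simp [hP, laxCoeff])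
  have Q2 : ∀ μ s, ∑' n, Q (n + 2) s * μ ^ n = μ * g μ s := fun μ s =>
    shiftQ 2 μ s (by simp [hQ, laxCoeff])
  have P1 : ∀ μ s, ∑' n, P (n + 1) s * μ ^ n = μ * (μ * f μ s) := fun μ s => by
    rw [shiftP 1 μ s (by simp [hP, laxCoeff]), P2]
  have Q1 : ∀ μ s, ∑' n, Q (n + 1) s * μ ^ n = μ * (μ * g μ s) := fun μ s => by
    rw [shiftQ 1 μ s (by simp [hQ, laxCoeff]), Q2]
  have sP : ∀ k μ s, Summable fun n => P (n + k) s * μ ^ n := fun k μ s =>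
    ((hsg s).1.shift k).summable μ
  have sQ : ∀ k μ s, Summable fun n => Q (n + k) s * μ ^ n := fun k μ s =>
    ((hsg s).2.shift k).summable μ
  have hs : ∀ μ s, HasDerivAt (f μ) (μ * f μ s + u s * g μ s) s ∧
      HasDerivAt (g μ) (-μ * g μ s + u s * f μ s) s := fun μ s => by
    obtain ⟨K, E, hK0, hE0, hb⟩ := exists_laxMajorant hu hpc hqc s
    have hm := superGeometric_laxMajorant hK0 hE0
    have hsum : Summable fun n => laxMajorant K E (n + 2) * |μ| ^ n
        + K * (laxMajorant K E (n + 3) * |μ| ^ n) :=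
      ((hm.shift 2).summable |μ|).add (((hm.shift 3).summable |μ|).mul_left K)
    have hmem : s ∈ Ioo (s - 1) (s + 1) := by constructor <;> linarith
    constructor
    · have key := hasDerivAt_tsum_of_isPreconnected hsum isOpen_Ioo isPreconnected_Ioo
        (g := fun n s => P (n + 3) s * μ ^ n)
        (g' := fun n s => (P (n + 2) s + u s * Q (n + 3) s) * μ ^ n)
        (t := Ioo (s - 1) (s + 1))
        (fun n z _ => (hasDerivAt_laxCoeff hu hp hq (n + 2) z).1.mul_const _)
        (fun n z hz => by
          obtain ⟨h1, h2⟩ := hb z (Ioo_subset_Icc_self hz)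
          rw [norm_mul, norm_pow, Real.norm_eq_abs, Real.norm_eq_abs, ← mul_assoc, ← add_mul]
          refine mul_le_mul_of_nonneg_right ((abs_add_le _ _).trans ?_) (by positivity)
          rw [abs_mul]
          exact add_le_add (h2 (n + 2)).1 (mul_le_mul h1 (h2 (n + 3)).2 (abs_nonneg _) hK0))
        hmem (sP 3 μ s) hmem
      refine key.congr_deriv ?_
      rw [← P2, hg]
      simp only
      rw [← tsum_mul_left, ← (sP 2 μ s).tsum_add ((sQ 3 μ s).mul_left _)]
      exact tsum_congr fun n => by ring
    · have key := hasDerivAt_tsum_of_isPreconnected hsum isOpen_Ioo isPreconnected_Ioo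
        (g := fun n s => Q (n + 3) s * μ ^ n)
        (g' := fun n s => (-Q (n + 2) s + u s * P (n + 3) s) * μ ^ n)
        (t := Ioo (s - 1) (s + 1))
        (fun n z _ => (hasDerivAt_laxCoeff hu hp hq (n + 2) z).2.mul_const _)
        (fun n z hz => by
          obtain ⟨h1, h2⟩ := hb z (Ioo_subset_Icc_self hz)
          rw [norm_mul, norm_pow, Real.norm_eq_abs, Real.norm_eq_abs, ← mul_assoc, ← add_mul]
          refine mul_le_mul_of_nonneg_right ((abs_add_le _ _).trans ?_) (by positivity)
          rw [abs_mul, abs_neg]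
          exact add_le_add (h2 (n + 2)).2 (mul_le_mul h1 (h2 (n + 3)).1 (abs_nonneg _) hK0))
        hmem (sQ 3 μ s) hmem
      refine key.congr_deriv ?_
      rw [neg_mul, ← Q2, hf]
      simp only
      rw [← tsum_neg, ← tsum_mul_left, ← (sQ 2 μ s).neg.tsum_add ((sP 3 μ s).mul_left _)]
      exact tsum_congr fun n => by ring
  refine ⟨f, g, fun s => ?_, fun s => ?_, fun μ s => (hs μ s).1, fun μ s => (hs μ s).2,
    fun μ s => ?_, fun μ s => ?_⟩
  · simp only [hf]
    rw [tsum_eq_single 0 fun n hn => by simp [hn]]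
    simp [hP, laxCoeff]
  · simp only [hg]
    rw [tsum_eq_single 0 fun n hn => by simp [hn]]
    simp [hQ, laxCoeff]
  · refine (((hsg s).1.shift 3).hasDerivAt_tsum μ).congr_deriv ?_
    have e : (s + 2 * u s ^ 2 - 4 * μ ^ 2) * f μ s - (4 * μ * u s + 2 * deriv u s) * g μ s
        = (s + 2 * u s ^ 2) * f μ s - 2 * deriv u s * g μ s - 4 * u s * (μ * g μ s)
          - 4 * (μ * (μ * f μ s)) := by ring
    rw [e, ← Q2, ← P1, hf, hg]
    simp only
    rw [← tsum_mul_left, ← tsum_mul_left, ← tsum_mul_left, ← tsum_mul_left,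
      ← ((sP 3 μ s).mul_left _).tsum_sub ((sQ 3 μ s).mul_left _),
      ← (((sP 3 μ s).mul_left _).sub ((sQ 3 μ s).mul_left _)).tsum_sub ((sQ 2 μ s).mul_left _),
      ← ((((sP 3 μ s).mul_left _).sub ((sQ 3 μ s).mul_left _)).sub
        ((sQ 2 μ s).mul_left _)).tsum_sub ((sP 1 μ s).mul_left _)]
    refine tsum_congr fun n => ?_
    linear_combination μ ^ n * (succ_mul_laxCoeff (u := u) (p := p) (q := q) s n).1
  · refine (((hsg s).2.shift 3).hasDerivAt_tsum μ).congr_deriv ?_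
    have e : -(s + 2 * u s ^ 2 - 4 * μ ^ 2) * g μ s - (4 * μ * u s - 2 * deriv u s) * f μ s
        = -(s + 2 * u s ^ 2) * g μ s + 2 * deriv u s * f μ s - 4 * u s * (μ * f μ s)
          + 4 * (μ * (μ * g μ s)) := by ring
    rw [e, ← P2, ← Q1, hf, hg]
    simp only
    rw [← tsum_mul_left, ← tsum_mul_left, ← tsum_mul_left, ← tsum_mul_left,
      ← ((sQ 3 μ s).mul_left _).tsum_add ((sP 3 μ s).mul_left _),
      ← (((sQ 3 μ s).mul_left _).add ((sP 3 μ s).mul_left _)).tsum_sub ((sP 2 μ s).mul_left _),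
      ← ((((sQ 3 μ s).mul_left _).add ((sP 3 μ s).mul_left _)).sub
        ((sP 2 μ s).mul_left _)).tsum_add ((sQ 1 μ s).mul_left _)]
    refine tsum_congr fun n => ?_
    linear_combination μ ^ n * (succ_mul_laxCoeff (u := u) (p := p) (q := q) s n).2

end PainleveII

/-! ### Normalised Lax solutions near `s = +∞`. -/

namespace PainleveII

open Set Topology MeasureTheory

theorem tendsto_integral_Ioi_zero {g : ℝ → ℝ} (hi : ∀ s, IntegrableOn g (Ioi s)) :
    Tendsto (fun s => ∫ t in Ioi s, g t) atTop (𝓝 0) := by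
  have h1 := (intervalIntegral_tendsto_integral_Ioi 0 (hi 0) tendsto_id).const_sub
    (∫ t in Ioi 0, g t)
  rw [sub_self] at h1
  refine h1.congr fun s => ?_
  rw [id, ← intervalIntegral.integral_Ioi_sub_Ioi' (hi 0) (hi s)]
  ring

/-- Grönwall bounds `X² + Y²`; then `|X| + |Y| ≤ X² + Y² + 1` turns the derivative bound into a mean
value estimate. -/
theorem abs_sub_le_of_linear_system {X Y X' Y' : ℝ → ℝ} {M ε : ℝ} (hM : 0 ≤ M) (hε : 0 ≤ ε)
    (hX : ∀ t ∈ Icc 0 M, HasDerivAt X (X' t) t) (hY : ∀ t ∈ Icc 0 M, HasDerivAt Y (Y' t) t)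
    (hX' : ∀ t ∈ Icc 0 M, |X' t| ≤ ε * (|X t| + |Y t|))
    (hY' : ∀ t ∈ Icc 0 M, |Y' t| ≤ ε * (|X t| + |Y t|)) :
    |X M - X 0| ≤ ε * ((X 0 ^ 2 + Y 0 ^ 2) * Real.exp (4 * ε * M) + 1) * M := by
  have hN : ∀ t ∈ Icc 0 M, X t ^ 2 + Y t ^ 2 ≤ (X 0 ^ 2 + Y 0 ^ 2) * Real.exp (4 * ε * M) := by
    intro t ht
    have hsub : ∀ x ∈ Icc 0 t, x ∈ Icc 0 M := fun x hx => ⟨hx.1, hx.2.trans ht.2⟩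
    have hd : ∀ x ∈ Icc 0 t, HasDerivAt (fun x => X x ^ 2 + Y x ^ 2)
        (2 * X x * X' x + 2 * Y x * Y' x) x := fun x hx =>
      (((hX x (hsub x hx)).pow 2).add ((hY x (hsub x hx)).pow 2)).congr_deriv (by simp)
    have h := gronwall_scalar (C := 4 * ε) ht.1 hd fun x hx => by
      have h1 : X x * X' x ≤ |X x| * |X' x| := (le_abs_self _).trans (abs_mul _ _).le
      have h2 : Y x * Y' x ≤ |Y x| * |Y' x| := (le_abs_self _).trans (abs_mul _ _).le
      have h3 := mul_le_mul_of_nonneg_left (hX' x (hsub x hx)) (abs_nonneg (X x))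
      have h4 := mul_le_mul_of_nonneg_left (hY' x (hsub x hx)) (abs_nonneg (Y x))
      have h5 := mul_nonneg hε (sq_nonneg (|X x| - |Y x|))
      rw [← sq_abs (X x), ← sq_abs (Y x)]
      nlinarith
    refine h.trans (mul_le_mul_of_nonneg_left (Real.exp_le_exp.2 ?_) (by positivity))
    rw [sub_zero]
    exact mul_le_mul_of_nonneg_left ht.2 (by positivity)
  have key := Convex.norm_image_sub_le_of_norm_hasDerivWithin_le (f := X) (f' := X')
    (C := ε * ((X 0 ^ 2 + Y 0 ^ 2) * Real.exp (4 * ε * M) + 1)) (s := Icc 0 M) (x := 0) (y := M)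
    (fun t ht => (hX t ht).hasDerivWithinAt) (fun t ht => by
      refine (hX' t ht).trans (mul_le_mul_of_nonneg_left ?_ hε)
      have h1 := hN t ht
      rw [← sq_abs (X t), ← sq_abs (Y t)] at h1
      nlinarith [sq_nonneg (|X t| - 1), sq_nonneg (|Y t| - 1)])
    (convex_Icc 0 M) ⟨le_rfl, hM⟩ ⟨hM, le_rfl⟩
  simpa [Real.norm_eq_abs, abs_of_nonneg hM] using key

/-- A joint solution, in the spatial variable `s` and the spectral variable `μ`, of the Lax pair
of the second Painlevé equation with potential `u`. -/
structure IsLaxSolution (u : ℝ → ℝ) (f g : ℝ → ℝ → ℝ) : Prop where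
  space_fst : ∀ μ s, HasDerivAt (f μ) (μ * f μ s + u s * g μ s) s
  space_snd : ∀ μ s, HasDerivAt (g μ) (-μ * g μ s + u s * f μ s) s
  spectral_fst : ∀ μ s, HasDerivAt (fun μ => f μ s) ((s + 2 * u s ^ 2 - 4 * μ ^ 2) * f μ s
    - (4 * μ * u s + 2 * deriv u s) * g μ s) μ
  spectral_snd : ∀ μ s, HasDerivAt (fun μ => g μ s) (-(s + 2 * u s ^ 2 - 4 * μ ^ 2) * g μ s
    - (4 * μ * u s - 2 * deriv u s) * f μ s) μ

variable {u : ℝ → ℝ} {f g : ℝ → ℝ → ℝ}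

/-- The phase of the Lax pair. -/
noncomputable def laxPhase (μ s : ℝ) : ℝ := -μ * s + 4 * μ ^ 3 / 3

theorem hasDerivAt_laxPhase (μ s : ℝ) : HasDerivAt (laxPhase μ) (-μ) s := by
  have h : HasDerivAt (fun s : ℝ => -μ * s + 4 * μ ^ 3 / 3) (-μ * 1) s :=
    ((hasDerivAt_id s).const_mul (-μ)).add_const _
  rwa [mul_one] at h

theorem hasDerivAt_laxPhase_spectral (μ s : ℝ) :
    HasDerivAt (fun μ => laxPhase μ s) (-s + 4 * μ ^ 2) μ := by
  have h : HasDerivAt (fun μ : ℝ => -μ * s + 4 * μ ^ 3 / 3) _ μ :=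
    ((hasDerivAt_id μ).neg.mul_const s).add ((((hasDerivAt_id μ).pow 3).const_mul 4).div_const 3)
  refine h.congr_deriv ?_
  simp only [id]
  push_cast
  ring

/-- The exponential normalisation removes the diagonal term and leaves only a coupling carrying `exp
(2 θ)`, with `θ` the phase; in the spectral equations the small diagonal `±2 u²` also survives. -/
theorem IsLaxSolution.fst_normalized_space (h : IsLaxSolution u f g) (μ s : ℝ) :
    HasDerivAt (fun s => f μ s * Real.exp (laxPhase μ s))
      (u s * (g μ s * Real.exp (-laxPhase μ s)) * Real.exp (2 * laxPhase μ s)) s := by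
  refine ((h.space_fst μ s).mul (hasDerivAt_laxPhase μ s).exp).congr_deriv ?_
  have e : Real.exp (-laxPhase μ s) * Real.exp (2 * laxPhase μ s) = Real.exp (laxPhase μ s) := by
    rw [← Real.exp_add]; ring_nf
  linear_combination (-(u s * g μ s)) * e

theorem IsLaxSolution.snd_normalized_space (h : IsLaxSolution u f g) (μ s : ℝ) :
    HasDerivAt (fun s => g μ s * Real.exp (-laxPhase μ s))
      (u s * (f μ s * Real.exp (laxPhase μ s)) * Real.exp (-(2 * laxPhase μ s))) s := by
  have h1 : HasDerivAt (fun s => -laxPhase μ s) (-(-μ)) s := (hasDerivAt_laxPhase μ s).neg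
  refine ((h.space_snd μ s).mul h1.exp).congr_deriv ?_
  have e : Real.exp (laxPhase μ s) * Real.exp (-(2 * laxPhase μ s))
      = Real.exp (-laxPhase μ s) := by
    rw [← Real.exp_add]; ring_nf
  linear_combination (-(u s * f μ s)) * e

theorem IsLaxSolution.fst_normalized_spectral (h : IsLaxSolution u f g) (μ s : ℝ) :
    HasDerivAt (fun μ => f μ s * Real.exp (laxPhase μ s))
      (2 * u s ^ 2 * (f μ s * Real.exp (laxPhase μ s)) - (4 * μ * u s + 2 * deriv u s) *
        (g μ s * Real.exp (-laxPhase μ s)) * Real.exp (2 * laxPhase μ s)) μ := by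
  refine ((h.spectral_fst μ s).mul (hasDerivAt_laxPhase_spectral μ s).exp).congr_deriv ?_
  have e : Real.exp (-laxPhase μ s) * Real.exp (2 * laxPhase μ s) = Real.exp (laxPhase μ s) := by
    rw [← Real.exp_add]; ring_nf
  linear_combination ((4 * μ * u s + 2 * deriv u s) * g μ s) * e

theorem IsLaxSolution.snd_normalized_spectral (h : IsLaxSolution u f g) (μ s : ℝ) :
    HasDerivAt (fun μ => g μ s * Real.exp (-laxPhase μ s))
      (-(2 * u s ^ 2) * (g μ s * Real.exp (-laxPhase μ s)) - (4 * μ * u s - 2 * deriv u s) *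
        (f μ s * Real.exp (laxPhase μ s)) * Real.exp (-(2 * laxPhase μ s))) μ := by
  have h1 : HasDerivAt (fun μ => -laxPhase μ s) (-(-s + 4 * μ ^ 2)) μ :=
    (hasDerivAt_laxPhase_spectral μ s).neg
  refine ((h.spectral_snd μ s).mul h1.exp).congr_deriv ?_
  have e : Real.exp (laxPhase μ s) * Real.exp (-(2 * laxPhase μ s))
      = Real.exp (-laxPhase μ s) := by
    rw [← Real.exp_add]; ring_nf
  linear_combination ((4 * μ * u s - 2 * deriv u s) * f μ s) * e

/-- The limits at `+∞` of the normalized Lax solution do not depend on the spectral variable. -/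
theorem IsLaxSolution.tendsto_normalized (h : IsLaxSolution u f g) (hu : IsSolution 0 u)
    (hpos : ∀ s, 0 < u s) {a b : ℝ} (ha : Tendsto (f 0) atTop (𝓝 a))
    (hb : Tendsto (g 0) atTop (𝓝 b)) {μ : ℝ} (hμ : 0 ≤ μ) :
    Tendsto (fun s => f μ s * Real.exp (laxPhase μ s)) atTop (𝓝 a) ∧
      Tendsto (fun s => g μ s * Real.exp (-laxPhase μ s)) atTop (𝓝 b) := by
  -- The rate `2 μ + 1` beats the growth `exp (2 μ s)` of the coupling and leaves `exp (-s)` to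
  -- spare.
  obtain ⟨C, hC0, hC⟩ := hu.le_exp hpos (c := 2 * μ + 1) (by positivity)
  set K := Real.exp (8 * μ ^ 3 / 3) with hK
  have hK1 : 1 ≤ K := Real.one_le_exp (by positivity)
  set ε : ℝ → ℝ := fun s => (2 * C ^ 2 + (4 * μ * C + 2 * C) * K) * Real.exp (-s) with hε
  have hε0 : ∀ s, 0 ≤ ε s := fun s => by positivity
  have hεt : Tendsto ε atTop (𝓝 0) := by
    simpa using Real.tendsto_exp_neg_atTop_nhds_zero.const_mul (2 * C ^ 2 + (4 * μ * C + 2 * C) * K)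
  have e0 : ∀ s, laxPhase 0 s = 0 := fun s => by simp [laxPhase]
  have hcoef : ∀ s, 2 ≤ s → ∀ t ∈ Icc 0 μ, 2 * u s ^ 2 ≤ ε s ∧
      |4 * t * u s + 2 * deriv u s| * Real.exp (2 * laxPhase t s) ≤ ε s ∧
      |4 * t * u s - 2 * deriv u s| * Real.exp (-(2 * laxPhase t s)) ≤ ε s := by
    intro s hs t ht
    obtain ⟨h1, h2⟩ := hC s hs
    have hu0 := hpos s
    have d1 : Real.exp (-((2 * μ + 1) * s)) ≤ Real.exp (-s) :=
      Real.exp_le_exp.2 (by nlinarith)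
    have d2 : Real.exp (-((2 * μ + 1) * s)) ≤ 1 := Real.exp_le_one_iff.2 (by nlinarith)
    have d0 := Real.exp_pos (-((2 * μ + 1) * s))
    have q1 : u s ^ 2 ≤ C ^ 2 * Real.exp (-s) := by
      have : u s ^ 2 ≤ (C * Real.exp (-((2 * μ + 1) * s))) ^ 2 :=
        pow_le_pow_left₀ hu0.le h1 2
      nlinarith [sq_nonneg C, mul_le_mul d1 d2 d0.le (Real.exp_pos (-s)).le]
    have q2 : 4 * t * u s + 2 * |deriv u s|
        ≤ (4 * μ * C + 2 * C) * Real.exp (-((2 * μ + 1) * s)) := by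
      have : t * u s ≤ μ * (C * Real.exp (-((2 * μ + 1) * s))) := mul_le_mul ht.2 h1 hu0.le hμ
      nlinarith
    have tu : 0 ≤ 4 * t * u s := by have := ht.1; positivity
    have a1 : |4 * t * u s + 2 * deriv u s| ≤ 4 * t * u s + 2 * |deriv u s| := by
      refine (abs_add_le _ _).trans (le_of_eq ?_)
      rw [abs_of_nonneg tu, abs_mul, abs_two]
    have a2 : |4 * t * u s - 2 * deriv u s| ≤ 4 * t * u s + 2 * |deriv u s| := by
      refine (abs_sub _ _).trans (le_of_eq ?_)
      rw [abs_of_nonneg tu, abs_mul, abs_two]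
    have c0 : 0 ≤ 4 * μ * C + 2 * C := by positivity
    have t3 : t ^ 3 ≤ μ ^ 3 := pow_le_pow_left₀ ht.1 ht.2 3
    have t30 : 0 ≤ t ^ 3 := pow_nonneg ht.1 3
    have hts : t * s ≤ μ * s := mul_le_mul_of_nonneg_right ht.2 (by linarith)
    have hts0 : 0 ≤ t * s := mul_nonneg ht.1 (by linarith)
    have r0 : 0 ≤ 2 * C ^ 2 * Real.exp (-s) := by positivity
    have r1 : 0 ≤ (4 * μ * C + 2 * C) * K * Real.exp (-s) := by positivity
    refine ⟨?_, ?_, ?_⟩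
    · simp only [hε]; nlinarith
    · have x1 : Real.exp (-((2 * μ + 1) * s)) * Real.exp (2 * laxPhase t s) ≤ K * Real.exp (-s) := by
        rw [hK, ← Real.exp_add, ← Real.exp_add, Real.exp_le_exp, laxPhase]
        nlinarith
      have := mul_le_mul_of_nonneg_right (a1.trans q2) (Real.exp_pos (2 * laxPhase t s)).le
      have := mul_le_mul_of_nonneg_left x1 c0
      simp only [hε]; nlinarith
    · have x1 : Real.exp (-((2 * μ + 1) * s)) * Real.exp (-(2 * laxPhase t s))
          ≤ K * Real.exp (-s) := by
        rw [hK, ← Real.exp_add, ← Real.exp_add, Real.exp_le_exp, laxPhase]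
        nlinarith
      have := mul_le_mul_of_nonneg_right (a2.trans q2) (Real.exp_pos (-(2 * laxPhase t s))).le
      have := mul_le_mul_of_nonneg_left x1 c0
      simp only [hε]; nlinarith
  set X : ℝ → ℝ → ℝ := fun s t => f t s * Real.exp (laxPhase t s) with hX
  set Y : ℝ → ℝ → ℝ := fun s t => g t s * Real.exp (-laxPhase t s) with hY
  have hX0 : ∀ s, X s 0 = f 0 s := fun s => by simp [hX, e0]
  have hY0 : ∀ s, Y s 0 = g 0 s := fun s => by simp [hY, e0]
  -- Bound for the change in the normalised solution as the spectral variable runs from `0` to `μ`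
  -- at fixed `s`; it vanishes as `s → ∞`.
  set B : ℝ → ℝ := fun s =>
    ε s * ((f 0 s ^ 2 + g 0 s ^ 2) * Real.exp (4 * ε s * μ) + 1) * μ with hB
  have hBt : Tendsto B atTop (𝓝 0) := by
    have h1 := (hεt.mul ((((ha.pow 2).add (hb.pow 2)).mul
      ((Real.continuous_exp.tendsto _).comp ((hεt.const_mul 4).mul_const μ))).add_const 1)).mul_const μ
    rw [zero_mul, zero_mul] at h1
    exact h1
  have hgen : ∀ a b e x y δ : ℝ, |a| ≤ δ → |b| * e ≤ δ → 0 ≤ e →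
      |a * x - b * y * e| ≤ δ * (|x| + |y|) := by
    intro a b e x y δ h1 h2 he
    refine (abs_sub _ _).trans ?_
    rw [abs_mul, abs_mul, abs_mul, abs_of_nonneg he]
    linarith [mul_le_mul_of_nonneg_right h1 (abs_nonneg x),
      mul_le_mul_of_nonneg_right h2 (abs_nonneg y)]
  have hdX : ∀ s, 2 ≤ s → ∀ t ∈ Icc 0 μ, |2 * u s ^ 2 * X s t - (4 * t * u s + 2 * deriv u s) *
        Y s t * Real.exp (2 * laxPhase t s)| ≤ ε s * (|X s t| + |Y s t|) := by
    intro s hs t ht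
    obtain ⟨h1, h2, -⟩ := hcoef s hs t ht
    exact hgen _ _ _ _ _ _ (by rwa [abs_of_nonneg (by positivity)]) h2 (Real.exp_pos _).le
  have hdY : ∀ s, 2 ≤ s → ∀ t ∈ Icc 0 μ, |-(2 * u s ^ 2) * Y s t - (4 * t * u s - 2 * deriv u s) *
        X s t * Real.exp (-(2 * laxPhase t s))| ≤ ε s * (|X s t| + |Y s t|) := by
    intro s hs t ht
    obtain ⟨h1, -, h2⟩ := hcoef s hs t ht
    rw [add_comm |X s t|]
    exact hgen _ _ _ _ _ _ (by rwa [abs_neg, abs_of_nonneg (by positivity)]) h2 (Real.exp_pos _).le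
  have hbX : ∀ s, 2 ≤ s → |X s μ - f 0 s| ≤ B s := fun s hs => by
    have := abs_sub_le_of_linear_system hμ (hε0 s)
      (fun t _ => h.fst_normalized_spectral t s) (fun t _ => h.snd_normalized_spectral t s)
      (hdX s hs) (hdY s hs)
    simpa [hB, e0, hX] using this
  have hbY : ∀ s, 2 ≤ s → |Y s μ - g 0 s| ≤ B s := fun s hs => by
    have := abs_sub_le_of_linear_system hμ (hε0 s)
      (fun t _ => h.snd_normalized_spectral t s) (fun t _ => h.fst_normalized_spectral t s)
      (fun t ht => (hdY s hs t ht).trans_eq (by rw [add_comm]))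
      (fun t ht => (hdX s hs t ht).trans_eq (by rw [add_comm]))
    simpa [hB, e0, hY, add_comm] using this
  constructor
  · have h1 : Tendsto (fun s => X s μ - f 0 s) atTop (𝓝 0) :=
      squeeze_zero_norm' ((eventually_ge_atTop 2).mono hbX) hBt
    simpa using h1.add ha
  · have h1 : Tendsto (fun s => Y s μ - g 0 s) atTop (𝓝 0) :=
      squeeze_zero_norm' ((eventually_ge_atTop 2).mono hbY) hBt
    simpa using h1.add hb

end PainleveII

/-! ### The Lax solution for large spectral parameter. -/

namespace PainleveII

open Set Topology MeasureTheory

variable {u : ℝ → ℝ} {f g : ℝ → ℝ → ℝ}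

theorem IsSolution.integrableOn_Ioi (hu : IsSolution 0 u) (hpos : ∀ s, 0 < u s) (s : ℝ) :
    IntegrableOn u (Ioi s) := by
  simpa using hu.integrableOn_exp_mul hpos 0 s

/-- For the Lax solution normalized by `(1, κ)` at `+∞`, the second component behaves like
`(κ - k) exp (laxPhase μ s₀)` for large `μ`, with `k` the limit of the quotient by the Airy
function. -/
theorem IsLaxSolution.tendsto_snd_normalized (h : IsLaxSolution u f g) (hu : IsSolution 0 u)
    (hpos : ∀ s, 0 < u s) {k κ : ℝ} (hk : Tendsto (fun s => u s / airyAi s) atTop (𝓝 k))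
    (ha : Tendsto (f 0) atTop (𝓝 1)) (hb : Tendsto (g 0) atTop (𝓝 κ)) (s₀ : ℝ) :
    Tendsto (fun μ => g μ s₀ * Real.exp (-laxPhase μ s₀)) atTop (𝓝 (κ - k)) := by
  have hanti : Antitone u := hu.antitone_of_pos le_rfl hpos
  have huc := hu.continuous
  have hui := hu.integrableOn_Ioi hpos
  set I : ℝ → ℝ := fun s => ∫ t in Ioi s, u t with hI
  have hI0 : ∀ s, 0 ≤ I s := fun s => setIntegral_nonneg measurableSet_Ioi fun t _ => (hpos t).le
  have hIt : Tendsto I atTop (𝓝 0) := tendsto_integral_Ioi_zero hui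
  have hId : ∀ s, HasDerivAt I (-u s) s := hasDerivAt_integral_Ioi huc hui
  -- This is the integral of `u exp (-2 θ)` over `(s, ∞)`, the leading part of the second component:
  -- the Laplace transform at `x = 2 μ`, so it tends to `k`.
  set Λ : ℝ → ℝ → ℝ := fun μ s =>
    Real.exp (-((2 * μ) ^ 3 / 3)) * ∫ t in Ioi s, Real.exp (2 * μ * t) * u t with hΛ
  have hΛt : Tendsto (fun μ => Λ μ s₀) atTop (𝓝 k) :=
    (hu.tendsto_laplace hpos hk s₀).comp (tendsto_id.const_mul_atTop two_pos)
  have hΛs : ∀ μ, Tendsto (Λ μ) atTop (𝓝 0) := fun μ => by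
    simpa using (tendsto_integral_Ioi_zero (hu.integrableOn_exp_mul hpos (2 * μ))).const_mul
      (Real.exp (-((2 * μ) ^ 3 / 3)))
  have hΛd : ∀ μ s, HasDerivAt (Λ μ) (-(u s * Real.exp (-(2 * laxPhase μ s)))) s := fun μ s => by
    refine ((hasDerivAt_integral_Ioi (by fun_prop)
      (hu.integrableOn_exp_mul hpos (2 * μ)) s).const_mul _).congr_deriv ?_
    have e : Real.exp (-(2 * laxPhase μ s))
        = Real.exp (-((2 * μ) ^ 3 / 3)) * Real.exp (2 * μ * s) := by
      rw [← Real.exp_add, laxPhase]; ring_nf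
    rw [e]; ring
  have hΛ0 : ∀ μ s, 0 ≤ Λ μ s := fun μ s => mul_nonneg (Real.exp_pos _).le
    (setIntegral_nonneg measurableSet_Ioi fun t _ => mul_nonneg (Real.exp_pos _).le (hpos t).le)
  have hΛanti : ∀ μ s, s₀ ≤ s → Λ μ s ≤ Λ μ s₀ := fun μ s hs => by
    have := le_of_hasDerivAt_nonneg (f := fun s => -Λ μ s) hs (fun x _ => (hΛd μ x).neg)
      (fun x _ => by rw [neg_neg]; exact mul_nonneg (hpos x).le (Real.exp_pos _).le)
    linarith
  have hIanti : ∀ s, s₀ ≤ s → I s ≤ I s₀ := fun s hs => by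
    have := le_of_hasDerivAt_nonneg (f := fun s => -I s) hs (fun x _ => (hId x).neg)
      (fun x _ => by rw [neg_neg]; exact (hpos x).le)
    linarith
  set U := u s₀ with hU
  set Y : ℝ → ℝ → ℝ := fun μ s => g μ s * Real.exp (-laxPhase μ s) with hY
  set X : ℝ → ℝ → ℝ := fun μ s => f μ s * Real.exp (laxPhase μ s) with hX
  -- Two integrations from infinity. A bound `m` on `Y` makes `X - 1` of size `m U exp (2 θ) / (2
  -- μ)`, and that exponential cancels the `exp (-2 θ)` in the equation for `Y`.
  have hmain : ∀ μ m, 0 < μ → (∀ s, s₀ ≤ s → |Y μ s| ≤ m) → ∀ s, s₀ ≤ s →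
      |Y μ s + Λ μ s - κ| ≤ m * U / (2 * μ) * I s := by
    intro μ m hμ hm
    obtain ⟨hXt, hYt⟩ := h.tendsto_normalized hu hpos ha hb hμ.le
    have hm0 : 0 ≤ m := (abs_nonneg _).trans (hm s₀ le_rfl)
    have hXb : ∀ s, s₀ ≤ s →
        |X μ s - 1| ≤ m * U / (2 * μ) * Real.exp (2 * laxPhase μ s) := by
      intro s hs
      have hd : ∀ t, HasDerivAt (fun s => m * U / (2 * μ) * Real.exp (2 * laxPhase μ s))
          (-(m * U * Real.exp (2 * laxPhase μ t))) t := fun t => by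
        refine ((((hasDerivAt_laxPhase μ t).const_mul 2).exp).const_mul
          (m * U / (2 * μ))).congr_deriv ?_
        field_simp
      refine abs_sub_le_of_tendsto (h := fun s => m * U / (2 * μ) * Real.exp (2 * laxPhase μ s))
        (fun t _ => h.fst_normalized_space μ t) (fun t _ => hd t) ?_ hXt ?_
      · intro t ht
        rw [abs_mul, abs_mul, Real.abs_exp, abs_of_pos (hpos t), neg_neg, mul_comm m]
        exact mul_le_mul_of_nonneg_right (mul_le_mul (hanti (hs.trans ht)) (hm t (hs.trans ht))
          (abs_nonneg _) (hpos s₀).le) (Real.exp_pos _).le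
      · have h1 : Tendsto (fun s => 2 * laxPhase μ s) atTop atBot := by
          simp only [laxPhase]
          exact (tendsto_atBot_add_const_right _ _
            (tendsto_id.const_mul_atTop_of_neg (neg_neg_of_pos hμ))).const_mul_atBot two_pos
        simpa using (Real.tendsto_exp_atBot.comp h1).const_mul (m * U / (2 * μ))
    intro s hs
    have hd : ∀ t, HasDerivAt (fun s => Y μ s + Λ μ s)
        (u t * (X μ t - 1) * Real.exp (-(2 * laxPhase μ t))) t := fun t =>
      ((h.snd_normalized_space μ t).add (hΛd μ t)).congr_deriv (by ring)
    refine abs_sub_le_of_tendsto (h := fun s => m * U / (2 * μ) * I s) (fun t _ => hd t)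
      (fun t _ => (hId t).const_mul _) ?_ (by simpa using hYt.add (hΛs μ))
      (by simpa using hIt.const_mul (m * U / (2 * μ)))
    intro t ht
    have e : Real.exp (2 * laxPhase μ t) * Real.exp (-(2 * laxPhase μ t)) = 1 := by
      rw [← Real.exp_add, add_neg_cancel, Real.exp_zero]
    rw [abs_mul, abs_mul, Real.abs_exp, abs_of_pos (hpos t)]
    have h1 := mul_le_mul_of_nonneg_right (hXb t (hs.trans ht))
      (Real.exp_pos (-(2 * laxPhase μ t))).le
    rw [mul_assoc, e, mul_one] at h1
    have := mul_le_mul_of_nonneg_left h1 (hpos t).le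
    linarith
  -- Self-consistent bound: the supremum `m` of `|Y|` is finite and satisfies `m ≤ |κ| + Λ + m/2`
  -- once `μ ≥ U * I s₀`.
  have hbdd : ∀ μ, 0 < μ → U * I s₀ ≤ μ → ∀ s, s₀ ≤ s → |Y μ s| ≤ 2 * (|κ| + Λ μ s₀) := by
    intro μ hμ hμ1
    have hYt := (h.tendsto_normalized hu hpos ha hb hμ.le).2
    have hYc : Continuous (Y μ) :=
      continuous_iff_continuousAt.2 fun s => (h.snd_normalized_space μ s).continuousAt
    have hB : BddAbove ((fun s => |Y μ s|) '' Ici s₀) := by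
      obtain ⟨T, hT⟩ := eventually_atTop.1 (hYt.abs.eventually_le_const (lt_add_one |κ|))
      obtain ⟨C, hC⟩ := (isCompact_Icc (a := s₀) (b := T)).exists_bound_of_continuousOn hYc.continuousOn
      refine ⟨max C (|κ| + 1), ?_⟩
      rintro _ ⟨s, hs, rfl⟩
      rcases le_total T s with h1 | h1
      · exact (hT s h1).trans (le_max_right _ _)
      · exact (hC s ⟨hs, h1⟩).trans (le_max_left _ _)
    set m := sSup ((fun s => |Y μ s|) '' Ici s₀) with hm
    have hle : ∀ s, s₀ ≤ s → |Y μ s| ≤ m := fun s hs => le_csSup hB ⟨s, hs, rfl⟩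
    have hm0 : 0 ≤ m := (abs_nonneg _).trans (hle s₀ le_rfl)
    have h2 : m ≤ |κ| + Λ μ s₀ + m / 2 := by
      refine csSup_le ⟨_, s₀, mem_Ici.2 le_rfl, rfl⟩ ?_
      rintro _ ⟨s, hs, rfl⟩
      have h3 := hmain μ m hμ hle s hs
      have h4 : m * U / (2 * μ) * I s ≤ m / 2 := by
        rw [div_mul_eq_mul_div, div_le_div_iff₀ (by positivity) two_pos]
        have h5 : U * I s ≤ μ := (mul_le_mul_of_nonneg_left (hIanti s hs) (hpos s₀).le).trans hμ1
        nlinarith [mul_le_mul_of_nonneg_left h5 hm0]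
      have h6 := hΛanti μ s hs
      have h7 := hΛ0 μ s
      have h8 := abs_le.1 h3
      have h9 := neg_abs_le κ
      have h10 := le_abs_self κ
      refine abs_le.2 ⟨by linarith, by linarith⟩
    intro s hs
    linarith [hle s hs]
  have hfin : ∀ᶠ μ in atTop, |Y μ s₀ + Λ μ s₀ - κ|
      ≤ 2 * (|κ| + Λ μ s₀) * U * I s₀ / 2 * μ⁻¹ := by
    filter_upwards [eventually_gt_atTop 0, eventually_ge_atTop (U * I s₀)] with μ h1 h2
    refine (hmain μ _ h1 (hbdd μ h1 h2) s₀ le_rfl).trans_eq ?_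
    field_simp
  have hlim : Tendsto (fun μ => 2 * (|κ| + Λ μ s₀) * U * I s₀ / 2 * μ⁻¹) atTop (𝓝 0) := by
    simpa using (((((hΛt.const_add |κ|).const_mul 2).mul_const U).mul_const (I s₀)).div_const 2).mul
      tendsto_inv_atTop_zero
  have h1 : Tendsto (fun μ => Y μ s₀ + Λ μ s₀ - κ) atTop (𝓝 0) := squeeze_zero_norm' hfin hlim
  have h2 := (h1.sub hΛt).const_add κ
  rw [show κ + (0 - k) = κ - k by ring] at h2
  exact h2.congr fun μ => by ring

end PainleveII

/-! ### Signs of the Lax solution far to the left, and the connection coefficient. -/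

namespace PainleveII

open Set Topology MeasureTheory

variable {u : ℝ → ℝ} {f g : ℝ → ℝ → ℝ}

/-- The diagonal terms cancel in the product, leaving a derivative that is nonnegative as soon as `2
μ u ≥ |u'|`. -/
theorem IsLaxSolution.hasDerivAt_mul (h : IsLaxSolution u f g) (μ s : ℝ) :
    HasDerivAt (fun μ => -4 * (f μ s * g μ s))
      (4 * ((4 * μ * u s + 2 * deriv u s) * g μ s ^ 2
        + (4 * μ * u s - 2 * deriv u s) * f μ s ^ 2)) μ :=
  (((h.spectral_fst μ s).mul (h.spectral_snd μ s)).const_mul (-4)).congr_deriv (by ring)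

theorem IsLaxSolution.hasDerivAt_sq_add_sq (h : IsLaxSolution u f g) (μ s : ℝ) :
    HasDerivAt (fun μ => f μ s ^ 2 + g μ s ^ 2)
      (2 * (s + 2 * u s ^ 2 - 4 * μ ^ 2) * (f μ s ^ 2 - g μ s ^ 2)
        - 16 * μ * u s * (f μ s * g μ s)) μ :=
  (((h.spectral_fst μ s).pow 2).add ((h.spectral_snd μ s).pow 2)).congr_deriv (by
    push_cast; ring)

/-- If, far to the left, the difference mode dominates at `μ = 0`, then the two components of the
Lax solution have opposite signs for all `μ ≥ 0`. -/
theorem IsLaxSolution.mul_neg_of_dominates (h : IsLaxSolution u f g) {s B C : ℝ} (hu : 1 ≤ u s)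
    (hB : |deriv u s| ≤ B) (hC : |s + 2 * u s ^ 2| ≤ C) (hB1 : 10 * B ^ 2 ≤ u s)
    (hB2 : B * (2 * C + 2 * B ^ 2 + 4 * B) ≤ 2 * u s)
    (h0 : 4 * (f 0 s + g 0 s) ^ 2 ≤ (f 0 s - g 0 s) ^ 2) (h0' : f 0 s - g 0 s ≠ 0)
    {μ : ℝ} (hμ : 0 ≤ μ) : f μ s * g μ s < 0 := by
  have hu0 : 0 < u s := by linarith
  have hB0 : 0 ≤ B := (abs_nonneg _).trans hB
  have hC0 : 0 ≤ C := (abs_nonneg _).trans hC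
  have hd := abs_le.1 hB
  -- Beyond `m` the product `-f g` is nondecreasing. On `[0, m]` it could decrease, but the interval
  -- is short: `K m ≤ 1` limits the growth of `f² + g²` to a factor `e`, and `B m ≤ 1/20`.
  set m := B / (2 * u s) with hm
  have hm0 : 0 ≤ m := by positivity
  have hmu : m * u s = B / 2 := by rw [hm]; field_simp
  have hmB : m ≤ B / 2 := by rw [← hmu]; nlinarith
  have hD : 0 < (f 0 s - g 0 s) ^ 2 := by positivity
  set K := 2 * C + 8 * m ^ 2 + 8 * m * u s with hK
  have hK0 : 0 ≤ K := by positivity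
  have hKm : K * m ≤ 1 := by
    have h1 : K ≤ 2 * C + 2 * B ^ 2 + 4 * B := by
      have : m ^ 2 ≤ (B / 2) ^ 2 := pow_le_pow_left₀ hm0 hmB 2
      rw [hK]; nlinarith
    have h2 : B * K ≤ 2 * u s := (mul_le_mul_of_nonneg_left h1 hB0).trans hB2
    rw [hm, mul_div_assoc', div_le_one (by positivity)]
    linarith
  have hn : ∀ x ∈ Icc 0 m, f x s ^ 2 + g x s ^ 2 ≤ (f 0 s ^ 2 + g 0 s ^ 2) * Real.exp 1 := by
    intro x hx
    have h1 := gronwall_scalar (C := K) hx.1 (fun t _ => h.hasDerivAt_sq_add_sq t s) fun t ht => by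
      have ht1 : t ≤ m := ht.2.trans hx.2
      have ht2 : t ^ 2 ≤ m ^ 2 := pow_le_pow_left₀ ht.1 ht1 2
      have htu : t * u s ≤ m * u s := mul_le_mul_of_nonneg_right ht1 hu0.le
      have htu0 : 0 ≤ t * u s := mul_nonneg ht.1 hu0.le
      have hC' := abs_le.1 hC
      have hP : |s + 2 * u s ^ 2 - 4 * t ^ 2| ≤ C + 4 * m ^ 2 :=
        abs_le.2 ⟨by linarith, by linarith [sq_nonneg t, sq_nonneg m]⟩
      have e1 : (s + 2 * u s ^ 2 - 4 * t ^ 2) * (f t s ^ 2 - g t s ^ 2)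
          ≤ (C + 4 * m ^ 2) * (f t s ^ 2 + g t s ^ 2) := by
        refine (le_abs_self _).trans ((abs_mul _ _).trans_le
          (mul_le_mul hP ?_ (abs_nonneg _) (by positivity)))
        exact abs_le.2 ⟨by linarith [sq_nonneg (f t s)], by linarith [sq_nonneg (g t s)]⟩
      have e2 : -(2 * (t * u s) * (f t s * g t s)) ≤ m * u s * (f t s ^ 2 + g t s ^ 2) := by
        have e3 := mul_nonneg htu0 (sq_nonneg (f t s + g t s))
        have e4 := mul_le_mul_of_nonneg_right htu
          (add_nonneg (sq_nonneg (f t s)) (sq_nonneg (g t s)))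
        nlinarith
      rw [hK]; linarith
    refine h1.trans (mul_le_mul_of_nonneg_left (Real.exp_le_exp.2 ?_) (by positivity))
    rw [sub_zero]
    exact (mul_le_mul_of_nonneg_left hx.2 hK0).trans hKm
  have hsmall : ∀ x ∈ Icc 0 m, f x s * g x s < 0 := by
    intro x hx
    set n := (f 0 s ^ 2 + g 0 s ^ 2) * Real.exp 1 with hn'
    have h1 := le_of_hasDerivAt_nonneg (f := fun t => -4 * (f t s * g t s) + 8 * B * n * t) hx.1
      (fun t _ => (h.hasDerivAt_mul t s).add ((hasDerivAt_id t).const_mul (8 * B * n)))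
      fun t ht => by
        have h2 := hn t ⟨ht.1, ht.2.trans hx.2⟩
        have h3 : 0 ≤ t * u s := mul_nonneg ht.1 hu0.le
        have h4 := mul_nonneg (by linarith : 0 ≤ 4 * t * u s + 2 * deriv u s + 2 * B)
          (sq_nonneg (g t s))
        have h5 := mul_nonneg (by linarith : 0 ≤ 4 * t * u s - 2 * deriv u s + 2 * B)
          (sq_nonneg (f t s))
        have h6 := mul_le_mul_of_nonneg_left h2 hB0
        linarith
    have h7 : 8 * B * n * x ≤ 2 / 5 * n := by
      have : B * x ≤ 1 / 20 := by
        refine (mul_le_mul_of_nonneg_left hx.2 hB0).trans ?_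
        rw [hm, mul_div_assoc', div_le_div_iff₀ (by positivity) (by norm_num)]
        linarith
      have hn0 : 0 ≤ n := by positivity
      nlinarith
    -- In units of `(f - g)²` at `μ = 0`, the loss is at most `2/5 · 5/8 · 2.72 = 0.68`, below the
    -- initial `3/4`.
    have h8 : n ≤ 5 / 8 * (f 0 s - g 0 s) ^ 2 * 2.72 := by
      refine mul_le_mul ?_ (by linarith [Real.exp_one_lt_d9]) (Real.exp_pos _).le (by positivity)
      linarith
    have h9 : 3 / 4 * (f 0 s - g 0 s) ^ 2 ≤ -4 * (f 0 s * g 0 s) := by linarith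
    have : 0 < -4 * (f x s * g x s) := by
      simp only [mul_zero, add_zero] at h1
      norm_num at h8
      linarith
    linarith
  rcases le_total μ m with h1 | h1
  · exact hsmall μ ⟨hμ, h1⟩
  · have h2 := le_of_hasDerivAt_nonneg h1 (fun t _ => h.hasDerivAt_mul t s) fun t ht => by
      have h3 : B ≤ 2 * (t * u s) := by
        have := mul_le_mul_of_nonneg_right ht.1 hu0.le
        linarith
      have h4 := mul_nonneg (by linarith : 0 ≤ 4 * t * u s + 2 * deriv u s) (sq_nonneg (g t s))
      have h5 := mul_nonneg (by linarith : 0 ≤ 4 * t * u s - 2 * deriv u s) (sq_nonneg (f t s))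
      linarith
    have := hsmall m ⟨hm0, le_rfl⟩
    linarith

/-- Far to the left, a positive solution is as large as we please at points where its derivative
is controlled. -/
theorem IsSolution.exists_point (hu : IsSolution 0 u) (hpos : ∀ s, 0 < u s) :
    ∃ B C : ℝ, ∀ R T : ℝ, ∃ s ≤ T, R ≤ u s ∧ |deriv u s| ≤ B ∧ |s + 2 * u s ^ 2| ≤ C := by
  obtain ⟨C, hC⟩ := eventually_sq_bounds (hu.isMinimalSolution le_rfl hpos)
    (Eventually.of_forall fun s => (hpos s).le)
  obtain ⟨T₀, hT₀⟩ := eventually_atBot.1 hC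
  refine ⟨1 / 2 + C, C, fun R T => ?_⟩
  set M := max 1 R with hM
  set t := min (min T T₀) (-C - 2 * M ^ 2 - 1) - 1 with ht
  have ht1 : t + 1 ≤ T := by
    rw [ht, sub_add_cancel]; exact (min_le_left _ _).trans (min_le_left _ _)
  have ht2 : t + 1 ≤ T₀ := by
    rw [ht, sub_add_cancel]; exact (min_le_left _ _).trans (min_le_right _ _)
  have ht3 : t + 1 ≤ -C - 2 * M ^ 2 - 1 := by
    rw [ht, sub_add_cancel]; exact min_le_right _ _
  have hge : ∀ s ≤ t + 1, M ≤ u s := fun s hs => by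
    have h1 := (hT₀ s (hs.trans ht2)).1
    exact le_of_sq_le_sq (by linarith) (hpos s).le
  -- The two-sided bounds let `u²` drop by at most `1/2 + C` over a unit interval, so the mean value
  -- theorem provides a point with bounded slope.
  obtain ⟨ξ, hξ, hξd⟩ := exists_hasDerivAt_eq_slope u (deriv u) (lt_add_one t)
    hu.continuous.continuousOn fun x _ => hu.hasDerivAt x
  rw [add_sub_cancel_left, div_one] at hξd
  have hξ1 : ξ ≤ t + 1 := hξ.2.le
  refine ⟨ξ, hξ1.trans ht1, (le_max_right _ _).trans (hge ξ hξ1), ?_, ?_⟩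
  · have hneg := hu.deriv_neg_of_pos le_rfl hpos ξ
    rw [abs_of_neg hneg, hξd]
    have h1 := (hT₀ t (by linarith)).2
    have h2 := (hT₀ (t + 1) ht2).1
    have h3 : 1 ≤ u t := (le_max_left _ _).trans (hge t (by linarith))
    have h4 : 1 ≤ u (t + 1) := (le_max_left _ _).trans (hge _ le_rfl)
    have h5 : u (t + 1) < u t := by linarith
    nlinarith
  · have h1 := hT₀ ξ (hξ1.trans ht2)
    exact abs_le.2 ⟨by linarith, by linarith⟩

/-- The connection coefficient of a positive solution of the homogeneous equation is `1`. -/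
theorem IsSolution.connection_eq_one (hu : IsSolution 0 u) (hpos : ∀ s, 0 < u s) {k : ℝ}
    (hk : Tendsto (fun s => u s / airyAi s) atTop (𝓝 k)) : k = 1 := by
  by_contra hk1
  -- The midpoint makes `κ - k` and `1 - κ` equal, so their product is a square.
  set κ := (k + 1) / 2 with hκ
  have hui := hu.integrableOn_Ioi hpos
  set I : ℝ → ℝ := fun s => ∫ t in Ioi s, u t with hI
  have hIt : Tendsto I atTop (𝓝 0) := tendsto_integral_Ioi_zero hui
  have hId : ∀ s, HasDerivAt I (-u s) s := hasDerivAt_integral_Ioi hu.continuous hui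
  -- The solution of `p' = u q`, `q' = u p` with limits `(1, κ)` at `+∞`; its sum and difference are
  -- multiples of `exp (-I)` and `exp I`.
  set p : ℝ → ℝ := fun s => Real.cosh (I s) - κ * Real.sinh (I s) with hp
  set q : ℝ → ℝ := fun s => κ * Real.cosh (I s) - Real.sinh (I s) with hq
  have hpd : ∀ s, HasDerivAt p (u s * q s) s := fun s =>
    ((hId s).cosh.sub ((hId s).sinh.const_mul κ)).congr_deriv (by simp only [hq]; ring)
  have hqd : ∀ s, HasDerivAt q (u s * p s) s := fun s =>
    (((hId s).cosh.const_mul κ).sub (hId s).sinh).congr_deriv (by simp only [hp]; ring)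
  obtain ⟨f, g, hf0, hg0, h1, h2, h3, h4⟩ := exists_lax_solution hu hpd hqd
  have h : IsLaxSolution u f g := ⟨h1, h2, h3, h4⟩
  have hch : Tendsto (fun s => Real.cosh (I s)) atTop (𝓝 1) := by
    have := (Real.continuous_cosh.tendsto 0).comp hIt
    rwa [Real.cosh_zero] at this
  have hsh : Tendsto (fun s => Real.sinh (I s)) atTop (𝓝 0) := by
    have := (Real.continuous_sinh.tendsto 0).comp hIt
    rwa [Real.sinh_zero] at this
  have ha : Tendsto (f 0) atTop (𝓝 1) := by
    rw [funext hf0]; simpa using hch.sub (hsh.const_mul κ)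
  have hb : Tendsto (g 0) atTop (𝓝 κ) := by
    rw [funext hg0]; simpa using (hch.const_mul κ).sub hsh
  have hdiff : ∀ s, f 0 s - g 0 s = (1 - κ) * Real.exp (I s) := fun s => by
    rw [hf0, hg0, ← Real.cosh_add_sinh]; simp only [hp, hq]; ring
  have hsum : ∀ s, f 0 s + g 0 s = (1 + κ) * Real.exp (-I s) := fun s => by
    rw [hf0, hg0, ← Real.cosh_sub_sinh]; simp only [hp, hq]; ring
  have hκ1 : 1 - κ ≠ 0 := fun e => hk1 (by rw [hκ] at e; linarith)
  -- Monotonicity gives `u ≥ u 0` on the left, so `I` diverges at least linearly and the difference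
  -- mode dominates.
  have hItop : Tendsto (fun s => Real.exp (I s)) atBot atTop := by
    refine Real.tendsto_exp_atTop.comp ?_
    refine tendsto_atTop_mono' (f₁ := fun s => u 0 * -s) _ ?_
      (tendsto_neg_atBot_atTop.const_mul_atTop (hpos 0))
    filter_upwards [eventually_le_atBot 0] with s hs
    have h5 := le_of_hasDerivAt_nonneg (f := fun s => -I s - u 0 * s) hs
      (fun x _ => (hId x).neg.sub ((hasDerivAt_id x).const_mul (u 0)))
      (fun x hx => by
        have := hu.antitone_of_pos le_rfl hpos hx.2
        linarith)
    have h6 : 0 ≤ I 0 := setIntegral_nonneg measurableSet_Ioi fun t _ => (hpos t).le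
    linarith
  obtain ⟨T, hT⟩ := eventually_atBot.1
    (hItop.eventually_ge_atTop (max 1 (2 * |1 + κ| / |1 - κ|)))
  obtain ⟨B, C, hBC⟩ := hu.exists_point hpos
  obtain ⟨s, hsT, hsR, hsB, hsC⟩ :=
    hBC (max 1 (max (10 * B ^ 2) (B * (2 * C + 2 * B ^ 2 + 4 * B)))) T
  have hR1 : 1 ≤ u s := (le_max_left _ _).trans hsR
  have hR2 : 10 * B ^ 2 ≤ u s := ((le_max_left _ _).trans (le_max_right _ _)).trans hsR
  have hR3 : B * (2 * C + 2 * B ^ 2 + 4 * B) ≤ u s :=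
    ((le_max_right _ _).trans (le_max_right _ _)).trans hsR
  have hE1 : 1 ≤ Real.exp (I s) := (le_max_left _ _).trans (hT s hsT)
  have hE2 : 2 * |1 + κ| ≤ |1 - κ| * Real.exp (I s) := by
    have := (le_max_right _ _).trans (hT s hsT)
    rwa [div_le_iff₀' (abs_pos.2 hκ1)] at this
  have hdom : 4 * (f 0 s + g 0 s) ^ 2 ≤ (f 0 s - g 0 s) ^ 2 := by
    have e : 2 * |f 0 s + g 0 s| ≤ |f 0 s - g 0 s| := by
      rw [hdiff, hsum, abs_mul, abs_mul, Real.abs_exp, Real.abs_exp]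
      have : Real.exp (-I s) ≤ 1 := by
        rw [Real.exp_neg]; exact inv_le_one_of_one_le₀ hE1
      nlinarith [abs_nonneg (1 + κ)]
    have := pow_le_pow_left₀ (by positivity) e 2
    rw [mul_pow, sq_abs, sq_abs] at this
    linarith
  have hne : f 0 s - g 0 s ≠ 0 := by rw [hdiff]; exact mul_ne_zero hκ1 (Real.exp_ne_zero _)
  have hfg : ∀ μ, 0 ≤ μ → f μ s * g μ s < 0 := fun μ hμ =>
    h.mul_neg_of_dominates hR1 hsB hsC hR2 (by linarith) hdom hne hμ
  -- Opposite signs prevent `f = g`, so by continuity in `μ` the difference `f - g` keeps the sign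
  -- of `1 - κ`, and `g` has the other one.
  have hgs : ∀ μ, 0 ≤ μ → g μ s * (1 - κ) < 0 := by
    intro μ hμ
    have hDc : Continuous fun μ => (f μ s - g μ s) * (1 - κ) :=
      ((continuous_iff_continuousAt.2 fun μ => (h3 μ s).continuousAt).sub
        (continuous_iff_continuousAt.2 fun μ => (h4 μ s).continuousAt)).mul continuous_const
    have hD0 : 0 < (f 0 s - g 0 s) * (1 - κ) := by
      rw [hdiff]
      have := mul_pos (mul_self_pos.2 hκ1) (Real.exp_pos (I s))
      linarith
    have hDμ : 0 < (f μ s - g μ s) * (1 - κ) := by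
      by_contra! hle
      obtain ⟨x, hx, hx0⟩ := intermediate_value_Icc' hμ hDc.continuousOn ⟨hle, hD0.le⟩
      have hx1 := hfg x hx.1
      have hx2 : f x s = g x s := sub_eq_zero.1 ((mul_eq_zero.1 hx0).resolve_right hκ1)
      rw [hx2] at hx1
      exact absurd hx1 (not_lt.2 (mul_self_nonneg _))
    have hμ1 := hfg μ hμ
    by_contra! hge
    have h5 : 0 < f μ s * (1 - κ) := by linarith
    have h6 := mul_nonneg h5.le hge
    have h7 : f μ s * g μ s * (1 - κ) ^ 2 < 0 := mul_neg_of_neg_of_pos hμ1 (by positivity)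
    linarith
  have hlim := (h.tendsto_snd_normalized hu hpos hk ha hb s).mul_const (1 - κ)
  -- Let `μ → ∞` at this fixed `s`; the sign of `g` passes to the limit `κ - k` of its
  -- normalisation.
  have hle : (κ - k) * (1 - κ) ≤ 0 := by
    refine le_of_tendsto hlim ?_
    filter_upwards [eventually_ge_atTop 0] with μ hμ
    have := mul_neg_of_neg_of_pos (hgs μ hμ) (Real.exp_pos (-laxPhase μ s))
    linarith
  have : (κ - k) * (1 - κ) = (1 - κ) ^ 2 := by rw [hκ]; ring
  rw [this] at hle
  exact absurd hle (not_le.2 (by positivity))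

/-- A positive solution of the homogeneous equation is asymptotic to the Airy function. -/
theorem IsSolution.isEquivalent_airyAi (hu : IsSolution 0 u) (hpos : ∀ s, 0 < u s) :
    u ~[atTop] airyAi := by
  obtain ⟨-, k, hk⟩ := hu.exists_tendsto_div_airyAi hpos
  obtain rfl := hu.connection_eq_one hpos hk
  refine (isEquivalent_iff_tendsto_one ?_).2 hk
  filter_upwards [eventually_gt_atTop 0] with s hs using (airyAi_pos hs).ne'

end PainleveII

theorem theorem3 :
    -- Part (i)
    (∀ α : ℝ, α ≤ 0 →
      ∃ y : ℝ → ℝ,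
        PainleveII.IsMinimalSolution α y ∧
        (∀ s : ℝ, 0 < y s) ∧
        (∀ s : ℝ, deriv y s < 0) ∧
        -- (a)
        (α = 0 →
          y ~[atTop] PainleveII.airyAi ∧
          y ~[atBot] (fun s : ℝ => √(|s| / 2)) ∧
          ∀ z : ℝ → ℝ,
            (PainleveII.IsMinimalSolution α z ∧ (∀ s : ℝ, 0 ≤ z s) ∧
              PainleveII.BoundedAtInfty z) ↔ z = y) ∧
        -- (b)
        (α < 0 →
          y ~[atTop] (fun s : ℝ => |α| / s) ∧
          y ~[atBot] (fun s : ℝ => √(|s| / 2)))) ∧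
    -- Part (ii)
    (∀ α : ℝ, α < 0 →
      ∀ y : ℝ → ℝ, PainleveII.IsMinimalSolution α y → PainleveII.BoundedAtInfty y →
        (∃ s₁ : ℝ, y s₁ = 0) →
          y ~[atTop] (fun s : ℝ => |α| / s) ∧
          y ~[atBot] (fun s : ℝ => -√(|s| / 2))) := by
  refine ⟨fun α hα => ?_, fun α hα y hy hb ⟨s₁, h0⟩ => ?_⟩
  · obtain ⟨y, hy, hpos⟩ := PainleveII.exists_pos_isSolution hα
    have hmin := hy.isMinimalSolution hα hpos
    have hbot := hmin.isEquivalent_atBot (Eventually.of_forall fun s => (hpos s).le)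
    refine ⟨y, hmin, hpos, hy.deriv_neg_of_pos hα hpos, ?_,
      fun hα' => ⟨hy.isEquivalent_atTop hα', hbot⟩⟩
    rintro rfl
    refine ⟨hy.isEquivalent_airyAi hpos, hbot, fun z => ⟨?_, ?_⟩⟩
    · rintro ⟨hz, hnn, -⟩
      exact hy.eq_of_pos le_rfl hz.1 hpos (hz.pos_of_nonneg hnn)
    · rintro rfl
      exact ⟨hmin, fun s => (hpos s).le, hy.boundedAtInfty⟩
  · exact ⟨hy.1.isEquivalent_atTop hα, hy.isEquivalent_atBot_of_zero hα h0⟩
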